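/- **Setting.** Let $(\mathcal R,\mu)$ be a $\sigma$-finite measure space and let $\mathcal M$ be the set of (a.e.-classes of) extended complex-valued measurable functions on it. For $f\in\mathcal M$ put $f^*(t)=\inf\{s\in[0,\infty):\mu(\{|f|>s\})\le t\}$, $t\ge 0$. The space is *resonant* if $\sup_{\tilde g^*=g^*}\int|f\tilde g|\,d\mu=\int_0^\infty f^*g^*\,d\lambda$ for all $f,g\in\mathcal M$; assume this. A *Banach function norm* is a map $\|\cdot\|_X:\mathcal M\to[0,\infty]$ with $\|f\|_X=\|\,|f|\,\|_X$ which on non-negative functions is absolutely homogeneous, subadditive, zero only at $f=0$ a.e., monotone with respect to $\le$ a.e., has the Fatou property ($0\le f_n\uparrow f$ a.e. implies $\|f_n\|_X\uparrow\|f\|_X$), is finite at $\chi_E$ whenever $\mu(E)<\infty$, and for each $E$ with $\mu(E)<\infty$ satisfies $\int_E f\,d\mu\le C_E\|f\|_X$ with some $C_E<\infty$. It is *rearrangement-invariant* (r.i.) if $f^*=g^*$ implies $\|f\|_X=\|g\|_X$. Put $X=\{f:\|f\|_X<\infty\}$; the associate space $X'$ is given in the same way by $\|f\|_{X'}=\sup_{g\in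 X}\|g\|_X^{-1}\int|fg|\,d\mu$ (with $0/0=0$, $a/0=\infty$ for $a>0$). A function $f\in X$ has *absolutely continuous norm* if $\|f\chi_{E_k}\|_X\to0$ whenever $E_k$ are measurable and $\chi_{E_k}\to0$ a.e.; $X_a$ is the set of these functions, and $X$ has absolutely continuous norm if $X_a=X$. A space $Y$ of this kind has the *(ACR) property* if $f^*(t)\to0$ as $t\to\infty$ for all $f\in Y$. On $X$ let $\xi$ be the topology generated by the functionals $|f|_\psi=\int_0^\infty\psi^*f^*\,d\lambda$, $\psi\in X'$. **Theorem.** Let $X$ be an r.i. Banach function space over $(\mathcal R,\mu)$ such that $X'$ has the (ACR) property. Let $\phi:\mathcal R\to\mathcal R$ be measurable and suppose that there is $A\in(0,\infty)$ with $\mu(\phi^{-n}(E))\le A\,\mu(E)$ for all $n\ge1$ and all measurable $E$. Let $T_\phi f=f\circ\phi$. 1. If $X$ has absolutely continuous norm, then $T_\phi$ is a continuous operator on $X$ and there is a continuous linear operator $T:X\to X$ such that $\frac1n\sum_{i=0}^{n-1}T_\phi^if\to Tf$ in $\|\cdot\|_X$ for every $f\in X$. The operator $T$ is positive, and there is a continuous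 linear operator $T':X'\to X'$ with $\int (Tf)\psi\,d\mu=\int f\,(T'\psi)\,d\mu$ for all $f\in X$, $\psi\in X'$. Moreover $T$ is a projection onto $\operatorname{Ker}(I-T_\phi)$, $I-T$ is a projection onto $\overline{\operatorname{Im}(I-T_\phi)}^{\|\cdot\|_X}$, and $$X=\operatorname{Ker}(I-T_\phi)\oplus\overline{\operatorname{Im}(I-T_\phi)}^{\|\cdot\|_X}.$$ 2. If $X$ is only assumed to have the (ACR) property, then $\xi$ is a Hausdorff locally convex vector space topology on $X$, coarser than (or equal to) the norm topology and finer than (or equal to) $\sigma(X,X')$; $T_\phi$ is a continuous operator on $X$, and there is a linear operator $T:X\to X$, continuous both for $\|\cdot\|_X$ and for $\xi$, such that $\frac1n\sum_{i=0}^{n-1}T_\phi^if\to Tf$ in $\xi$ for every $f\in X$, and in $\|\cdot\|_X$ for every $f\in X_a$. The operator $T$ is positive and has a continuous associate operator $T'$ on $X'$ as in 1. Moreover $T$ is a projection onto $\operatorname{Ker}(I-T_\phi)$, $I-T$ is a projection onto the linear subspace $\overline{\operatorname{Im}(I-T_\phi)}^{\xi}\supseteq\overline{\operatorname{Im}(I-T_\phi)}^{\|\cdot\|_X}$,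 and $X=\operatorname{Ker}(I-T_\phi)\oplus\overline{\operatorname{Im}(I-T_\phi)}^{\xi}$. -/

import Mathlib

open MeasureTheory Filter Topology
open scoped ENNReal NNReal

noncomputable section

/-- The non-increasing rearrangement `f^*(t) = inf {s ∈ [0, ∞) : μ {f > s} ≤ t}`, `t ∈ [0, ∞)`,
of a `[0, ∞]`-valued function; for a complex function apply it to the modulus. -/
def rearrangement {α : Type*} [MeasurableSpace α] (μ : Measure α) (f : α → ℝ≥0∞) (t : ℝ) :
    ℝ≥0∞ :=
  ⨅ (s : ℝ≥0) (_ : μ {x | (s : ℝ≥0∞) < f x} ≤ ENNReal.ofReal t), (s : ℝ≥0∞)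

/-- Two functions on the same measure space are equimeasurable if `f^* = g^*` on `[0, ∞)`. -/
def Equimeasurable {α : Type*} [MeasurableSpace α] (μ : Measure α) (f g : α → ℝ≥0∞) : Prop :=
  ∀ t : ℝ, 0 ≤ t → rearrangement μ f t = rearrangement μ g t

/-- A measure space is resonant if the supremum of `∫ |f h| dμ` over all `h` with `h^* = g^*` equals
`∫_0^∞ f^* g^* dλ`, for all measurable `f` and `g`. -/
def IsResonant {α : Type*} [MeasurableSpace α] (μ : Measure α) : Prop :=
  ∀ f g : α → ℝ≥0∞, AEMeasurable f μ → AEMeasurable g μ →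
    (⨆ (h : α → ℝ≥0∞) (_ : AEMeasurable h μ) (_ : Equimeasurable μ h g), ∫⁻ x, f x * h x ∂μ) =
      ∫⁻ t in Set.Ioi (0 : ℝ), rearrangement μ f t * rearrangement μ g t

/-- Banach function norms, given through their restriction to the non-negative (extended-valued)
measurable functions. Values at functions that are not a.e. measurable play no role. -/
structure BanachFunctionNorm {α : Type*} [MeasurableSpace α] (μ : Measure α) where
  toFun : (α → ℝ≥0∞) → ℝ≥0∞
  /-- absolute homogeneity -/
  smul' : ∀ (a : ℝ≥0) (f : α → ℝ≥0∞), AEMeasurable f μ →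
    toFun (fun x => a * f x) = a * toFun f
  /-- definiteness -/
  eq_zero_iff' : ∀ f : α → ℝ≥0∞, AEMeasurable f μ → (toFun f = 0 ↔ f =ᵐ[μ] 0)
  /-- subadditivity -/
  add_le' : ∀ f g : α → ℝ≥0∞, AEMeasurable f μ → AEMeasurable g μ →
    toFun (fun x => f x + g x) ≤ toFun f + toFun g
  /-- the lattice property -/
  mono' : ∀ f g : α → ℝ≥0∞, AEMeasurable f μ → AEMeasurable g μ → f ≤ᵐ[μ] g → toFun f ≤ toFun g
  /-- the Fatou property -/
  fatou' : ∀ f : ℕ → α → ℝ≥0∞, (∀ n, AEMeasurable (f n) μ) →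
    (∀ᵐ x ∂μ, Monotone fun n => f n x) →
    Tendsto (fun n => toFun (f n)) atTop (𝓝 (toFun fun x => ⨆ n, f n x))
  /-- characteristic functions of sets of finite measure have finite norm -/
  indicator_lt_top' : ∀ E : Set α, MeasurableSet E → μ E < ∞ → toFun (E.indicator 1) < ∞
  /-- functions of finite norm are integrable over sets of finite measure -/
  lintegral_le' : ∀ E : Set α, MeasurableSet E → μ E < ∞ →
    ∃ C : ℝ≥0, ∀ f : α → ℝ≥0∞, AEMeasurable f μ → ∫⁻ x in E, f x ∂μ ≤ C * toFun f

namespace BanachFunctionNorm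

variable {α : Type*} [MeasurableSpace α] {μ : Measure α}

/-- The value of the norm at (the modulus of) a class of complex measurable functions. -/
def eval (ρ : BanachFunctionNorm μ) (f : α →ₘ[μ] ℂ) : ℝ≥0∞ := ρ.toFun fun x => ‖f x‖ₑ

theorem aemeasurable_enorm (f : α →ₘ[μ] ℂ) : AEMeasurable (fun x => ‖f x‖ₑ) μ :=
  f.aestronglyMeasurable.enorm

theorem eval_zero (ρ : BanachFunctionNorm μ) : ρ.eval 0 = 0 := by
  refine (ρ.eq_zero_iff' _ (aemeasurable_enorm _)).2 ?_
  filter_upwards [AEEqFun.coeFn_zero (α := α) (β := ℂ) (μ := μ)] with x hx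
  simp [hx]

theorem eval_add_le (ρ : BanachFunctionNorm μ) (f g : α →ₘ[μ] ℂ) :
    ρ.eval (f + g) ≤ ρ.eval f + ρ.eval g := by
  refine (ρ.mono' _ _ (aemeasurable_enorm _)
    ((aemeasurable_enorm f).add (aemeasurable_enorm g)) ?_).trans
    (ρ.add_le' _ _ (aemeasurable_enorm f) (aemeasurable_enorm g))
  filter_upwards [AEEqFun.coeFn_add f g] with x hx
  simpa [hx] using enorm_add_le (f x) (g x)

theorem eval_smul (ρ : BanachFunctionNorm μ) (c : ℂ) (f : α →ₘ[μ] ℂ) :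
    ρ.eval (c • f) = ‖c‖ₑ * ρ.eval f := by
  have h := ρ.smul' ‖c‖₊ _ (aemeasurable_enorm f)
  have hae : (fun x => ‖(c • f) x‖ₑ) =ᵐ[μ] fun x => (‖c‖₊ : ℝ≥0∞) * ‖f x‖ₑ := by
    filter_upwards [AEEqFun.coeFn_smul c f] with x hx
    rw [hx, Pi.smul_apply, enorm_smul]; rfl
  have hm := (aemeasurable_enorm f).const_mul (‖c‖₊ : ℝ≥0∞)
  exact (le_antisymm (ρ.mono' _ _ (aemeasurable_enorm _) hm hae.le)
    (ρ.mono' _ _ hm (aemeasurable_enorm _) hae.symm.le)).trans h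

/-- The Banach function space of the norm `ρ`. (Functions of finite norm are finite a.e. when `μ` is
σ-finite, so nothing is lost by using complex-valued rather than extended-valued functions.) -/
def space (ρ : BanachFunctionNorm μ) : Submodule ℂ (α →ₘ[μ] ℂ) where
  carrier := {f | ρ.eval f < ∞}
  zero_mem' := by simp [ρ.eval_zero]
  add_mem' := fun {f g} hf hg => (ρ.eval_add_le f g).trans_lt (ENNReal.add_lt_top.2 ⟨hf, hg⟩)
  smul_mem' := fun c f hf => by
    change ρ.eval (c • f) < ∞
    rw [eval_smul]
    exact ENNReal.mul_lt_top enorm_lt_top hf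

instance (ρ : BanachFunctionNorm μ) : NormedAddCommGroup ρ.space :=
  AddGroupNorm.toNormedAddCommGroup
    { toFun := fun f => (ρ.eval f.1).toReal
      map_zero' := by simp [ρ.eval_zero]
      add_le' := fun f g => by
        rw [← ENNReal.toReal_add (ne_of_lt f.2) (ne_of_lt g.2)]
        exact ENNReal.toReal_mono (ENNReal.add_lt_top.2 ⟨f.2, g.2⟩).ne (ρ.eval_add_le f.1 g.1)
      neg' := fun f => by
        have h := ρ.eval_smul (-1) f.1
        have h1 : (-1 : ℂ) • f.1 = -f.1 := neg_one_smul ℂ f.1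
        rw [h1, enorm_neg, enorm_one, one_mul] at h
        exact congrArg ENNReal.toReal h
      eq_zero_of_map_eq_zero' := fun f hf => by
        have h0 : ρ.eval f.1 = 0 := by
          rcases (ENNReal.toReal_eq_zero_iff _).1 hf with h | h
          · exact h
          · exact absurd h (ne_of_lt f.2)
        have h1 := (ρ.eq_zero_iff' _ (aemeasurable_enorm _)).1 h0
        refine Subtype.ext (AEEqFun.ext ?_)
        filter_upwards [h1, AEEqFun.coeFn_zero (α := α) (β := ℂ) (μ := μ)] with x hx h0x
        rw [Submodule.coe_zero, h0x]
        simpa using hx }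

theorem norm_def (ρ : BanachFunctionNorm μ) (f : ρ.space) : ‖f‖ = (ρ.eval f.1).toReal := rfl

instance (ρ : BanachFunctionNorm μ) : NormedSpace ℂ ρ.space where
  norm_smul_le c f := by
    rw [norm_def, norm_def, Submodule.coe_smul, eval_smul, ENNReal.toReal_mul]
    simp

/-- `ρ` is rearrangement-invariant. -/
def IsRearrangementInvariant (ρ : BanachFunctionNorm μ) : Prop :=
  ∀ f g : α → ℝ≥0∞, AEMeasurable f μ → AEMeasurable g μ → Equimeasurable μ f g →
    ρ.toFun f = ρ.toFun g

/-- `f` has absolutely continuous norm, i.e. `f ∈ X_a`. -/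
def HasACNorm (ρ : BanachFunctionNorm μ) (f : ρ.space) : Prop :=
  ∀ E : ℕ → Set α, (∀ k, MeasurableSet (E k)) →
    (∀ᵐ x ∂μ, Tendsto (fun k => (E k).indicator (1 : α → ℝ) x) atTop (𝓝 0)) →
    Tendsto (fun k => ρ.toFun ((E k).indicator fun x => ‖f.1 x‖ₑ)) atTop (𝓝 0)

/-- The space `X` has absolutely continuous norm, i.e. `X_a = X`. -/
def SpaceHasACNorm (ρ : BanachFunctionNorm μ) : Prop := ∀ f : ρ.space, ρ.HasACNorm f

/-- The (ACR) property: `f^*(t) → 0` as `t → ∞` for every `f ∈ X`. -/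
def HasACR (ρ : BanachFunctionNorm μ) : Prop :=
  ∀ f : ρ.space, Tendsto (rearrangement μ fun x => ‖f.1 x‖ₑ) atTop (𝓝 0)

/-- The associate functional `f ↦ sup_{g ∈ X} ‖g‖_X⁻¹ ∫ |f g| dμ` (here `0 / 0 = 0` and
`a / 0 = ∞` for `a > 0`). -/
def associateFun (ρ : BanachFunctionNorm μ) (f : α → ℝ≥0∞) : ℝ≥0∞ :=
  ⨆ (g : α → ℝ≥0∞) (_ : AEMeasurable g μ) (_ : ρ.toFun g < ∞),
    (∫⁻ x, f x * g x ∂μ) / ρ.toFun g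

theorem le_associateFun (ρ : BanachFunctionNorm μ) (f g : α → ℝ≥0∞) (hg : AEMeasurable g μ)
    (h : ρ.toFun g < ∞) : (∫⁻ x, f x * g x ∂μ) / ρ.toFun g ≤ ρ.associateFun f :=
  le_iSup_of_le g (le_iSup_of_le hg (le_iSup_of_le h le_rfl))

theorem lintegral_le_associateFun (ρ : BanachFunctionNorm μ) (f : α → ℝ≥0∞) (E : Set α)
    (hE : MeasurableSet E) (hμ : μ E < ∞) :
    ∫⁻ x in E, f x ∂μ ≤ ρ.associateFun f * ρ.toFun (E.indicator 1) := by
  have hm : AEMeasurable (E.indicator (1 : α → ℝ≥0∞)) μ :=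
    (measurable_one.indicator hE).aemeasurable
  have hint : ∫⁻ x in E, f x ∂μ = ∫⁻ x, f x * E.indicator 1 x ∂μ := by
    rw [← lintegral_indicator hE]
    congr 1 with x
    by_cases hx : x ∈ E <;> simp [hx]
  rw [hint]
  have hlt := ρ.indicator_lt_top' E hE hμ
  by_cases h0 : ρ.toFun (E.indicator 1) = 0
  · have hz := (ρ.eq_zero_iff' _ hm).1 h0
    have : ∫⁻ x, f x * E.indicator 1 x ∂μ = 0 := by
      rw [lintegral_congr_ae (g := fun _ => 0), lintegral_zero]
      filter_upwards [hz] with x hx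
      simp [hx]
    simp [this]
  · exact (ENNReal.div_le_iff h0 hlt.ne).1 (ρ.le_associateFun f _ hm hlt)

theorem associateFun_mono (ρ : BanachFunctionNorm μ) {f g : α → ℝ≥0∞} (h : f ≤ᵐ[μ] g) :
    ρ.associateFun f ≤ ρ.associateFun g := by
  refine iSup_le fun u => iSup_le fun hu => iSup_le fun hu' => ?_
  refine le_trans ?_ (ρ.le_associateFun g u hu hu')
  refine ENNReal.div_le_div_right (lintegral_mono_ae ?_) _
  filter_upwards [h] with x hx
  gcongr

/-- The associate norm of a Banach function norm over a σ-finite measure space, which is again a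
Banach function norm. The associate space `X'` is `ρ.associate.space`. -/
def associate [SigmaFinite μ] (ρ : BanachFunctionNorm μ) : BanachFunctionNorm μ where
  toFun := ρ.associateFun
  smul' a f hf := by
    simp only [associateFun, ENNReal.mul_iSup, mul_assoc]
    refine iSup_congr fun g => iSup_congr fun hg => iSup_congr fun _ => ?_
    have h : ∫⁻ x, (a : ℝ≥0∞) * (f x * g x) ∂μ = a * ∫⁻ x, f x * g x ∂μ :=
      lintegral_const_mul'' _ (hf.mul hg)
    rw [h, mul_div_assoc]
  eq_zero_iff' f hf := by
    constructor
    · intro h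
      refine ae_eq_of_forall_setLIntegral_eq_of_sigmaFinite₀ hf aemeasurable_const
        fun E hE hμ => ?_
      have h1 := ρ.lintegral_le_associateFun f E hE hμ
      rw [h, zero_mul] at h1
      simpa using h1
    · intro h
      refine le_antisymm ((ρ.associateFun_mono h.le).trans ?_) bot_le
      simp [associateFun]
  add_le' f g hf hg := by
    refine iSup_le fun u => iSup_le fun hu => iSup_le fun hu' => ?_
    simp only [add_mul]
    have h : ∫⁻ x, f x * u x + g x * u x ∂μ = ∫⁻ x, f x * u x ∂μ + ∫⁻ x, g x * u x ∂μ :=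
      lintegral_add_left' (hf.mul hu) _
    rw [h, ENNReal.add_div]
    exact add_le_add (ρ.le_associateFun f u hu hu') (ρ.le_associateFun g u hu hu')
  mono' f g _ _ h := ρ.associateFun_mono h
  fatou' f hf hmono := by
    have hle : ∀ m n : ℕ, m ≤ n → ρ.associateFun (f m) ≤ ρ.associateFun (f n) := fun m n hmn => by
      refine ρ.associateFun_mono ?_
      filter_upwards [hmono] with x hx using hx hmn
    have key : ρ.associateFun (fun x => ⨆ n, f n x) = ⨆ n, ρ.associateFun (f n) := by
      refine le_antisymm ?_ (iSup_le fun n => ρ.associateFun_mono (ae_of_all _ fun x =>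
        le_iSup (fun n => f n x) n))
      refine iSup_le fun u => iSup_le fun hu => iSup_le fun hu' => ?_
      simp only [ENNReal.iSup_mul]
      have h : ∫⁻ x, ⨆ n, f n x * u x ∂μ = ⨆ n, ∫⁻ x, f n x * u x ∂μ := by
        refine lintegral_iSup' (fun n => (hf n).mul hu) ?_
        filter_upwards [hmono] with x hx
        intro m n hmn
        have := hx hmn
        dsimp at this ⊢
        gcongr
      rw [h, ENNReal.iSup_div]
      exact iSup_mono fun n => ρ.le_associateFun (f n) u hu hu'
    rw [key]
    exact tendsto_atTop_iSup hle
  indicator_lt_top' E hE hμ := by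
    obtain ⟨C, hC⟩ := ρ.lintegral_le' E hE hμ
    refine lt_of_le_of_lt ?_ (ENNReal.coe_lt_top (r := C))
    refine iSup_le fun u => iSup_le fun hu => iSup_le fun hu' => ?_
    refine ENNReal.div_le_of_le_mul ((le_of_eq ?_).trans (hC u hu))
    rw [← lintegral_indicator hE]
    congr 1 with x
    by_cases hx : x ∈ E <;> simp [hx]
  lintegral_le' E hE hμ := by
    refine ⟨(ρ.toFun (E.indicator 1)).toNNReal, fun f _ => ?_⟩
    rw [ENNReal.coe_toNNReal (ρ.indicator_lt_top' E hE hμ).ne, mul_comm]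
    exact ρ.lintegral_le_associateFun f E hE hμ

/-- The functional `|f|_ψ = ∫_0^∞ ψ^* f^* dλ`. -/
def rearrangementPairing (ψ f : α →ₘ[μ] ℂ) : ℝ≥0∞ :=
  ∫⁻ t in Set.Ioi (0 : ℝ),
    rearrangement μ (fun x => ‖ψ x‖ₑ) t * rearrangement μ (fun x => ‖f x‖ₑ) t

/-- The rearrangement-invariant locally convex topology `ξ` on `X`: the topology generated by the
balls of the functionals `|·|_ψ`, where `ψ` runs through the associate space `X'`. -/
@[reducible] def xi [SigmaFinite μ] (ρ : BanachFunctionNorm μ) : TopologicalSpace ρ.space :=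
  TopologicalSpace.generateFrom
    {U | ∃ (ψ : ρ.associate.space) (f : ρ.space) (ε : ℝ≥0∞), 0 < ε ∧
      U = {g : ρ.space | rearrangementPairing ψ.1 (g - f).1 < ε}}

/-- The weak topology `σ(X, X')` on `X`. -/
@[reducible] def weakAssociate [SigmaFinite μ] (ρ : BanachFunctionNorm μ) : TopologicalSpace ρ.space :=
  ⨅ ψ : ρ.associate.space, TopologicalSpace.induced (fun f : ρ.space => ∫ x, ψ.1 x * f.1 x ∂μ)
    inferInstance

/-- `T` is positive: it maps a.e. non-negative functions to a.e. non-negative functions. -/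
def IsPositiveOp (ρ : BanachFunctionNorm μ) (T : ρ.space →L[ℂ] ρ.space) : Prop :=
  ∀ f : ρ.space, (∀ᵐ x ∂μ, 0 ≤ (f.1 x).re ∧ (f.1 x).im = 0) →
    ∀ᵐ x ∂μ, 0 ≤ ((T f).1 x).re ∧ ((T f).1 x).im = 0

/-- `T` on `X` and `T'` on `X'` are mutually associate. -/
def AreAssociate [SigmaFinite μ] (ρ : BanachFunctionNorm μ) (T : ρ.space →L[ℂ] ρ.space)
    (T' : ρ.associate.space →L[ℂ] ρ.associate.space) : Prop :=
  ∀ (f : ρ.space) (ψ : ρ.associate.space),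
    ∫ x, (T f).1 x * ψ.1 x ∂μ = ∫ x, f.1 x * (T' ψ).1 x ∂μ

/-- The Cesàro mean `n⁻¹ ∑_{i < n} S^i f`. -/
def cesaro (ρ : BanachFunctionNorm μ) (S : ρ.space →L[ℂ] ρ.space) (n : ℕ) (f : ρ.space) :
    ρ.space :=
  (n : ℂ)⁻¹ • ∑ i ∈ Finset.range n, (S ^ i) f

end BanachFunctionNorm

/-- `φ` is power-measure-bounded. -/
def PowerMeasureBounded {α : Type*} [MeasurableSpace α] (μ : Measure α) (φ : α → α) : Prop :=
  ∃ A : ℝ≥0, 0 < A ∧ ∀ n : ℕ, 1 ≤ n → ∀ E : Set α, MeasurableSet E →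
    μ (φ^[n] ⁻¹' E) ≤ A * μ E

theorem PowerMeasureBounded.quasiMeasurePreserving {α : Type*} [MeasurableSpace α]
    {μ : Measure α} {φ : α → α} (h : PowerMeasureBounded μ φ) (hφ : Measurable φ) :
    Measure.QuasiMeasurePreserving φ μ μ := by
  obtain ⟨A, -, hA⟩ := h
  refine ⟨hφ, Measure.AbsolutelyContinuous.mk fun E hE h0 => ?_⟩
  rw [Measure.map_apply hφ hE]
  simpa [h0] using hA 1 le_rfl E hE

/-- The composition operator `f ↦ f ∘ φ` on classes of measurable functions, for a non-singular
measurable `φ`. -/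
def compositionOperator {α : Type*} [MeasurableSpace α] {μ : Measure α} {φ : α → α}
    (hφ : Measure.QuasiMeasurePreserving φ μ μ) (f : α →ₘ[μ] ℂ) : α →ₘ[μ] ℂ :=
  f.compQuasiMeasurePreserving φ hφ

end

/-! Resonance turns the pairing of `f^*` and `g^*` into a supremum of ordinary integrals over
functions equimeasurable with `g`. Hence the functionals generating `ξ` are seminorms that satisfy
Hölder's inequality and Fatou's lemma. A power-measure-bounded `φ` enlarges every distribution
function by at most a factor `C`, uniformly in the iterate. This dilates the rearrangement, so the
powers of the composition operator are bounded by `C` in every generating seminorm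
(`rearrangementLIntegral_dilation`). By the Lorentz–Luxemburg theorem
(`toFun_le_of_forall_lintegral_mul_le`) the same holds in norm.

Convergence starts in `L²`, where the composition operator is power bounded and the Hilbert space
mean ergodic theorem applies. For a bounded integrable `f` the Cesàro means are uniformly bounded in
`L¹` and `L^∞` and converge in measure. (ACR) for `X'` upgrades this: rearrangements in the unit
ball of `X'` decay uniformly, so a function that is uniformly small with bounded integral is small
in `X`, while the rest lives on sets of small measure (`HasACR.tendsto_zero_of_tendsto_measure`).
Small sets are negligible for every `|·|_ψ`, and also for the norm once some nonzero element has
absolutely continuous norm (`tendsto_toFun_indicator_of_hasACNorm`).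

By (ACR) for `X` and `X'`, every `f` is a `ξ`-limit of bounded integrable functions, and a norm
limit if `f ∈ X_a`. Uniform boundedness makes the Cesàro means of every `f` a norm-bounded
`ξ`-Cauchy sequence, and such sequences converge (`exists_tendsto_of_cauchy_pairingSeminorm`). This
defines `T`. Almost everywhere convergence along a subsequence gives positivity. The associate
operator comes from the `L²` adjoint on bounded integrable `ψ` and extends by the same approximation
carried out in `X'`.

The decomposition is then algebra: `T` kills the range of `I - T_φ` and fixes its kernel, and `f`
minus its Cesàro means lies in the range, so `ker T` is the closure of that range in whichever
topology the means converge. -/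

noncomputable section

/-! ### Rearrangements and their pairing on a resonant space. -/

section Rearrangement

variable {α : Type*} [MeasurableSpace α] {μ : Measure α} {f g h : α → ℝ≥0∞}

theorem rearrangement_le_of_measure_le {t : ℝ} {s : ℝ≥0}
    (h : μ {x | (s : ℝ≥0∞) < f x} ≤ ENNReal.ofReal t) : rearrangement μ f t ≤ s :=
  iInf₂_le s h

theorem measure_le_of_rearrangement_lt {t : ℝ} {s : ℝ≥0∞} (h : rearrangement μ f t < s) :
    μ {x | s < f x} ≤ ENNReal.ofReal t := by
  obtain ⟨r, hr⟩ := iInf_lt_iff.1 h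
  obtain ⟨hr1, hr2⟩ := iInf_lt_iff.1 hr
  exact (measure_mono fun x hx => hr2.trans hx).trans hr1

/-- The infimum defining the rearrangement is attained: the set above level `s` is the increasing
union of those above `s + 1/n`, and the measure is continuous from below. -/
theorem measure_le_of_rearrangement_le {t : ℝ} {s : ℝ≥0∞} (h : rearrangement μ f t ≤ s) :
    μ {x | s < f x} ≤ ENNReal.ofReal t := by
  have hU : {x | s < f x} = ⋃ n : ℕ, {x | s + (n : ℝ≥0∞)⁻¹ < f x} := by
    ext x
    simp only [Set.mem_ofPred_eq, Set.mem_iUnion]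
    constructor
    · intro hx
      obtain ⟨n, hn⟩ := ENNReal.exists_inv_nat_lt (tsub_pos_of_lt hx).ne'
      exact ⟨n, by rw [add_comm]; exact lt_tsub_iff_right.1 hn⟩
    · rintro ⟨n, hn⟩
      exact lt_of_le_of_lt le_self_add hn
  have hmono : Monotone fun n : ℕ => {x | s + (n : ℝ≥0∞)⁻¹ < f x} := fun m n hmn x hx => by
    refine lt_of_le_of_lt (b := s + (m : ℝ≥0∞)⁻¹) ?_ hx
    gcongr
  rw [hU, hmono.measure_iUnion]
  refine iSup_le fun n => ?_
  rcases eq_or_ne s ∞ with rfl | hs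
  · simp
  · exact measure_le_of_rearrangement_lt
      (h.trans_lt (ENNReal.lt_add_right hs (by simp)))

theorem rearrangement_antitone : Antitone (rearrangement μ f) := fun _ _ h =>
  le_iInf₂ fun s hs => iInf₂_le s (hs.trans (ENNReal.ofReal_le_ofReal h))

theorem measurable_rearrangement : Measurable (rearrangement μ f) :=
  rearrangement_antitone.measurable

/-- Every level admissible for `f` at `t` is admissible for `g` at `A t`. Power-measure-boundedness
enters the estimates in this form. -/
theorem rearrangement_dilation {A : ℝ≥0}
    (h : ∀ s : ℝ≥0, μ {x | (s : ℝ≥0∞) < g x} ≤ A * μ {x | (s : ℝ≥0∞) < f x}) (t : ℝ) :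
    rearrangement μ g (A * t) ≤ rearrangement μ f t :=
  le_iInf₂ fun s hs => iInf₂_le s ((h s).trans (by
    rw [ENNReal.ofReal_mul (NNReal.coe_nonneg A), ENNReal.ofReal_coe_nnreal]
    gcongr))

theorem rearrangement_mono (h : f ≤ᵐ[μ] g) (t : ℝ) :
    rearrangement μ f t ≤ rearrangement μ g t := by
  have := rearrangement_dilation (μ := μ) (f := g) (g := f) (A := 1) (fun s => by
    rw [ENNReal.coe_one, one_mul]
    refine measure_mono_ae ?_
    filter_upwards [h] with x hx h2 using lt_of_lt_of_le h2 hx) t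
  simpa using this

theorem rearrangement_indicator (E : Set α) (t : ℝ) :
    rearrangement μ (E.indicator 1) t = {t : ℝ | ENNReal.ofReal t < μ E}.indicator 1 t := by
  have hE : ∀ s : ℝ≥0, s < 1 → {x | (s : ℝ≥0∞) < E.indicator 1 x} = E := fun s hs => by
    ext x
    by_cases hx : x ∈ E <;> simp [hx, hs]
  by_cases ht : ENNReal.ofReal t < μ E
  · rw [Set.indicator_of_mem (by exact ht)]
    refine le_antisymm ?_ (le_iInf₂ fun s hs => ?_)
    · refine (rearrangement_le_of_measure_le (s := 1) ?_).trans (by simp)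
      have : {x | ((1 : ℝ≥0) : ℝ≥0∞) < E.indicator (1 : α → ℝ≥0∞) x} = ∅ := by
        ext x
        by_cases hx : x ∈ E <;> simp [hx]
      rw [this, measure_empty]
      exact bot_le
    · by_contra hlt
      rw [hE s (by simpa using hlt)] at hs
      exact absurd hs (not_le.2 ht)
  · rw [Set.indicator_of_notMem (by exact ht)]
    refine le_antisymm (rearrangement_le_of_measure_le (s := 0) ?_) bot_le
    rw [hE 0 one_pos]
    exact not_lt.1 ht

theorem rearrangement_le_const {M : ℝ≥0} (h : ∀ᵐ x ∂μ, f x ≤ M) (t : ℝ) :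
    rearrangement μ f t ≤ M := by
  refine rearrangement_le_of_measure_le ?_
  have : μ {x | (M : ℝ≥0∞) < f x} = 0 := by
    simpa [ae_iff] using h
  simp [this]

theorem ae_le_of_rearrangement_zero_le {M : ℝ≥0∞} (h : rearrangement μ f 0 ≤ M) :
    ∀ᵐ x ∂μ, f x ≤ M := by
  have := measure_le_of_rearrangement_le h
  simpa [ae_iff] using this

/-- The pairing `∫_0^∞ f^* g^* dλ`. -/
def rearrangementLIntegral (μ : Measure α) (f g : α → ℝ≥0∞) : ℝ≥0∞ :=
  ∫⁻ t in Set.Ioi (0 : ℝ), rearrangement μ f t * rearrangement μ g t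

theorem rearrangementLIntegral_comm (f g : α → ℝ≥0∞) :
    rearrangementLIntegral μ f g = rearrangementLIntegral μ g f := by
  simp only [rearrangementLIntegral, mul_comm]

theorem Equimeasurable.refl (f : α → ℝ≥0∞) : Equimeasurable μ f f := fun _ _ => rfl

theorem Equimeasurable.symm (h : Equimeasurable μ f g) : Equimeasurable μ g f :=
  fun t ht => (h t ht).symm

theorem Equimeasurable.rearrangementLIntegral_eq (h : Equimeasurable μ f g) (k : α → ℝ≥0∞) :
    rearrangementLIntegral μ f k = rearrangementLIntegral μ g k :=
  setLIntegral_congr_fun measurableSet_Ioi fun t ht => by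
    simp only [h t (le_of_lt ht)]

theorem rearrangementLIntegral_mono (h : f ≤ᵐ[μ] g) (k : α → ℝ≥0∞) :
    rearrangementLIntegral μ f k ≤ rearrangementLIntegral μ g k :=
  lintegral_mono fun t => by gcongr; exact rearrangement_mono h t

theorem rearrangementLIntegral_congr (h : f =ᵐ[μ] g) (k : α → ℝ≥0∞) :
    rearrangementLIntegral μ f k = rearrangementLIntegral μ g k :=
  le_antisymm (rearrangementLIntegral_mono h.le k) (rearrangementLIntegral_mono h.symm.le k)

/-- The substitution `t ↦ A t` produces the factor `A` and the dilated rearrangement of `g`. Since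
`A ≥ 1` and `k^*` is non-increasing, the dilation of `k^*` can be dropped. -/
theorem rearrangementLIntegral_dilation {A : ℝ≥0} (hA : 1 ≤ A)
    (h : ∀ s : ℝ≥0, μ {x | (s : ℝ≥0∞) < g x} ≤ A * μ {x | (s : ℝ≥0∞) < f x}) (k : α → ℝ≥0∞) :
    rearrangementLIntegral μ g k ≤ A * rearrangementLIntegral μ f k := by
  have hA0 : (0 : ℝ) < A := lt_of_lt_of_le one_pos (by exact_mod_cast hA)
  have hvol : (volume : Measure ℝ) = (A : ℝ≥0∞) • Measure.map
    (fun t : ℝ => (A : ℝ) * t) volume := by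
    rw [Real.map_volume_mul_left hA0.ne', smul_smul, abs_of_pos (inv_pos.2 hA0),
      ENNReal.ofReal_inv_of_pos hA0, ENNReal.ofReal_coe_nnreal, ENNReal.mul_inv_cancel, one_smul]
    · exact_mod_cast (lt_of_lt_of_le one_pos hA).ne'
    · simp
  have hmeas : ∀ u v : α → ℝ≥0∞,
      Measurable fun t => rearrangement μ u t * rearrangement μ v t := fun u v =>
    measurable_rearrangement.mul measurable_rearrangement
  unfold rearrangementLIntegral
  rw [← lintegral_indicator measurableSet_Ioi, ← lintegral_indicator measurableSet_Ioi, hvol,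
    lintegral_smul_measure, lintegral_map ((hmeas _ _).indicator measurableSet_Ioi)
      (measurable_const_mul _), ← hvol, smul_eq_mul]
  gcongr with t
  by_cases ht : 0 < t
  · rw [Set.indicator_of_mem (by exact mul_pos hA0 ht), Set.indicator_of_mem (by exact ht)]
    gcongr
    · exact rearrangement_dilation h t
    · refine rearrangement_antitone ?_
      have : (1 : ℝ) ≤ A := by exact_mod_cast hA
      nlinarith
  · rw [Set.indicator_of_notMem]
    · exact bot_le
    · intro h2
      exact ht (by simpa [hA0] using h2)


/-- The Hardy–Littlewood formula: in a resonant space the pairing is a supremum of integrals. -/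
theorem IsResonant.rearrangementLIntegral_eq (hres : IsResonant μ) (hf : AEMeasurable f μ)
    (hg : AEMeasurable g μ) : rearrangementLIntegral μ f g =
      ⨆ (h : α → ℝ≥0∞) (_ : AEMeasurable h μ) (_ : Equimeasurable μ h g), ∫⁻ x, f x * h x ∂μ :=
  (hres f g hf hg).symm

theorem IsResonant.lintegral_mul_le_of_equimeasurable (hres : IsResonant μ)
    (hf : AEMeasurable f μ) (hg : AEMeasurable g μ) (hh : AEMeasurable h μ)
    (he : Equimeasurable μ h g) : ∫⁻ x, f x * h x ∂μ ≤ rearrangementLIntegral μ f g := by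
  rw [hres.rearrangementLIntegral_eq hf hg]
  exact le_iSup_of_le h (le_iSup_of_le hh (le_iSup_of_le he le_rfl))

theorem IsResonant.lintegral_mul_le (hres : IsResonant μ) (hf : AEMeasurable f μ)
    (hg : AEMeasurable g μ) : ∫⁻ x, f x * g x ∂μ ≤ rearrangementLIntegral μ f g :=
  hres.lintegral_mul_le_of_equimeasurable hf hg hg (.refl g)

theorem IsResonant.rearrangementLIntegral_le (hres : IsResonant μ) (hf : AEMeasurable f μ)
    (hg : AEMeasurable g μ) {c : ℝ≥0∞}
    (H : ∀ h : α → ℝ≥0∞, AEMeasurable h μ → Equimeasurable μ h g → ∫⁻ x, f x * h x ∂μ ≤ c) :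
    rearrangementLIntegral μ f g ≤ c := by
  rw [hres.rearrangementLIntegral_eq hf hg]
  exact iSup_le fun h => iSup_le fun hh => iSup_le fun he => H h hh he

theorem IsResonant.rearrangementLIntegral_const_mul (hres : IsResonant μ) (c : ℝ≥0∞)
    (hf : AEMeasurable f μ) (hg : AEMeasurable g μ) :
    rearrangementLIntegral μ (fun x => c * f x) g = c * rearrangementLIntegral μ f g := by
  rw [hres.rearrangementLIntegral_eq hf hg, hres.rearrangementLIntegral_eq (hf.const_mul c) hg]
  simp only [ENNReal.mul_iSup, mul_assoc]
  refine iSup_congr fun h => iSup_congr fun hh => iSup_congr fun _ => ?_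
  exact lintegral_const_mul'' c (hf.mul hh)

/-- The rearrangement itself is not subadditive pointwise. The pairing is, because it is a supremum
of functionals additive in the first argument. -/
theorem IsResonant.rearrangementLIntegral_add_le (hres : IsResonant μ) {f₁ f₂ : α → ℝ≥0∞}
    (hf₁ : AEMeasurable f₁ μ) (hf₂ : AEMeasurable f₂ μ) (hg : AEMeasurable g μ) :
    rearrangementLIntegral μ (fun x => f₁ x + f₂ x) g ≤
      rearrangementLIntegral μ f₁ g + rearrangementLIntegral μ f₂ g := by
  refine hres.rearrangementLIntegral_le (hf₁.add hf₂) hg fun h hh he => ?_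
  have hadd : ∫⁻ x, (f₁ + f₂) x * h x ∂μ = ∫⁻ x, f₁ x * h x + f₂ x * h x ∂μ := by
    simp only [Pi.add_apply, add_mul]
  rw [hadd]
  refine (lintegral_add_left' (hf₁.mul hh) _).le.trans (add_le_add ?_ ?_)
  · exact hres.lintegral_mul_le_of_equimeasurable hf₁ hg hh he
  · exact hres.lintegral_mul_le_of_equimeasurable hf₂ hg hh he

theorem IsResonant.rearrangementLIntegral_le_liminf (hres : IsResonant μ) {F : ℕ → α → ℝ≥0∞}
    (hF : ∀ n, AEMeasurable (F n) μ) (hf : AEMeasurable f μ) (hg : AEMeasurable g μ)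
    (hlim : ∀ᵐ x ∂μ, Tendsto (fun n => F n x) atTop (𝓝 (f x))) :
    rearrangementLIntegral μ f g ≤ liminf (fun n => rearrangementLIntegral μ (F n) g) atTop := by
  refine hres.rearrangementLIntegral_le hf hg fun h hh he => ?_
  calc ∫⁻ x, f x * h x ∂μ ≤ ∫⁻ x, liminf (fun n => F n x * h x) atTop ∂μ := by
        refine lintegral_mono_ae ?_
        filter_upwards [hlim] with x hx
        -- Since `h x` may be `∞`, the products need not converge to `f x * h x`; the inequality for
        -- the lower limit of a product still holds.
        rw [← hx.liminf_eq]
        calc liminf (fun n => F n x) atTop * h x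
            = liminf (fun n => F n x) atTop * liminf (fun _ : ℕ => h x) atTop := by simp
          _ ≤ _ := ENNReal.le_liminf_mul
    _ ≤ liminf (fun n => ∫⁻ x, F n x * h x ∂μ) atTop :=
        lintegral_liminf_le' fun n => (hF n).mul hh
    _ ≤ _ := liminf_le_liminf (.of_forall fun n =>
        hres.lintegral_mul_le_of_equimeasurable (hF n) hg hh he)

theorem rearrangement_eq_zero_of_measure_univ_le {t : ℝ} (h : μ Set.univ ≤ ENNReal.ofReal t) :
    rearrangement μ f t = 0 :=
  le_antisymm (rearrangement_le_of_measure_le (s := 0) ((measure_mono (Set.subset_univ _)).trans h))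
    bot_le

/-- Pairing with the constant `1` recovers the integral of `f^*`, and every function equimeasurable
with `1` is at most `1` almost everywhere. -/
theorem IsResonant.lintegral_rearrangement_le (hres : IsResonant μ) (hf : AEMeasurable f μ) :
    ∫⁻ t in Set.Ioi (0 : ℝ), rearrangement μ f t ≤ ∫⁻ x, f x ∂μ := by
  have h1 : AEMeasurable (Set.univ.indicator (1 : α → ℝ≥0∞)) μ :=
    (measurable_one.indicator .univ).aemeasurable
  calc ∫⁻ t in Set.Ioi (0 : ℝ), rearrangement μ f t
      ≤ rearrangementLIntegral μ f (Set.univ.indicator 1) := by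
        refine lintegral_mono fun t => ?_
        dsimp only
        rw [rearrangement_indicator]
        by_cases ht : ENNReal.ofReal t < μ Set.univ
        · rw [Set.indicator_of_mem (by exact ht)]
          simp
        · rw [rearrangement_eq_zero_of_measure_univ_le (not_lt.1 ht)]
          exact bot_le
    _ ≤ ∫⁻ x, f x ∂μ := by
        refine hres.rearrangementLIntegral_le hf h1 fun h hh he => ?_
        have : ∀ᵐ x ∂μ, h x ≤ 1 := by
          refine ae_le_of_rearrangement_zero_le ?_
          rw [he 0 le_rfl, rearrangement_indicator]
          exact Set.indicator_le_self' (by simp) _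
        refine lintegral_mono_ae ?_
        filter_upwards [this] with x hx
        simpa using mul_le_mul_right hx (f x)

/-- If `F n` tends to zero in measure and is dominated, then so do its pairings. -/
theorem tendsto_rearrangementLIntegral_zero {F : ℕ → α → ℝ≥0∞} 
    (hdom : ∀ᶠ n in atTop, ∀ t, rearrangement μ (F n) t ≤ rearrangement μ f t)
    (hfin : rearrangementLIntegral μ f g < ∞) (hgfin : ∀ t : ℝ, 0 < t → rearrangement μ g t < ∞)
    (hF : ∀ ε : ℝ≥0, 0 < ε → Tendsto (fun n => μ {x | (ε : ℝ≥0∞) < F n x}) atTop (𝓝 0)) :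
    Tendsto (fun n => rearrangementLIntegral μ (F n) g) atTop (𝓝 0) := by
  have key : ∀ t : ℝ, 0 < t → Tendsto (fun n => rearrangement μ (F n) t) atTop (𝓝 0) := by
    intro t ht
    rw [ENNReal.tendsto_nhds_zero]
    intro ε hε
    rcases eq_or_ne ε ∞ with rfl | hε'
    · simp
    lift ε to ℝ≥0 using hε'
    filter_upwards [(ENNReal.tendsto_nhds_zero.1 (hF ε (by exact_mod_cast hε)))
      (ENNReal.ofReal t) (by simpa using ht)] with n hn
    exact rearrangement_le_of_measure_le hn
  have h0 : ∫⁻ t in Set.Ioi (0 : ℝ), (0 : ℝ≥0∞) = 0 := by simp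
  rw [← h0]
  refine tendsto_lintegral_filter_of_dominated_convergence
    (fun t => rearrangement μ f t * rearrangement μ g t)
    (.of_forall fun n => measurable_rearrangement.mul measurable_rearrangement) ?_ hfin.ne ?_
  · filter_upwards [hdom] with n hn
    refine .of_forall fun t => ?_
    gcongr
    exact hn t
  · filter_upwards [ae_restrict_mem measurableSet_Ioi] with t ht
    -- Finiteness of `g^*(t)` excludes the product `0 * ∞` in the limit.
    simpa using ENNReal.Tendsto.mul_const (key t ht) (Or.inr (hgfin t ht).ne)

end Rearrangement
-- Bounded truncations of finite support measure.
section Truncation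

variable {α : Type*} [MeasurableSpace α] {μ : Measure α} [SigmaFinite μ]

/-- The truncation of `f` to values at most `n` on the `n`-th spanning set. -/
def truncate (μ : Measure α) [SigmaFinite μ] (f : α → ℝ≥0∞) (n : ℕ) : α → ℝ≥0∞ :=
  (spanningSets μ n).indicator fun x => min (f x) n

theorem truncate_le (f : α → ℝ≥0∞) (n : ℕ) (x : α) : truncate μ f n x ≤ f x := by
  unfold truncate
  by_cases hx : x ∈ spanningSets μ n <;> simp [hx]

theorem truncate_le_nat (f : α → ℝ≥0∞) (n : ℕ) (x : α) : truncate μ f n x ≤ n := by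
  unfold truncate
  by_cases hx : x ∈ spanningSets μ n <;> simp [hx]

theorem monotone_truncate (f : α → ℝ≥0∞) (x : α) : Monotone fun n => truncate μ f n x := by
  intro m n hmn
  have hm : (m : ℝ≥0∞) ≤ n := by exact_mod_cast hmn
  unfold truncate
  refine (Set.indicator_le_indicator_of_subset (monotone_spanningSets μ hmn)
    (fun _ => bot_le) x).trans (Set.indicator_le_indicator ?_)
  gcongr

theorem iSup_truncate (f : α → ℝ≥0∞) (x : α) : ⨆ n, truncate μ f n x = f x := by
  refine le_antisymm (iSup_le fun n => truncate_le f n x) (le_of_forall_lt fun c hc => ?_)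
  obtain ⟨n, hn⟩ := ENNReal.exists_nat_gt hc.ne_top
  have hx : x ∈ spanningSets μ (max n (spanningSetsIndex μ x)) :=
    monotone_spanningSets μ (le_max_right _ _) (mem_spanningSetsIndex μ x)
  refine lt_of_lt_of_le ?_ (le_iSup _ (max n (spanningSetsIndex μ x)))
  simp only [truncate, Set.indicator_of_mem hx]
  refine lt_min hc (hn.trans_le ?_)
  exact_mod_cast le_max_left _ _

theorem aemeasurable_truncate {f : α → ℝ≥0∞} (hf : AEMeasurable f μ) (n : ℕ) :
    AEMeasurable (truncate μ f n) μ :=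
  (hf.min aemeasurable_const).indicator (measurableSet_spanningSets μ n)

theorem memLp_toReal_truncate {f : α → ℝ≥0∞} (hf : AEMeasurable f μ) (n : ℕ) (p : ℝ≥0∞) :
    MemLp (fun x => (truncate μ f n x).toReal) p μ := by
  have h1 : MemLp (fun _ : α => (n : ℝ)) p (μ.restrict (spanningSets μ n)) := by
    have : IsFiniteMeasure (μ.restrict (spanningSets μ n)) :=
      ⟨by simpa using measure_spanningSets_lt_top μ n⟩
    exact memLp_const _
  have h2 : MemLp ((spanningSets μ n).indicator fun _ : α => (n : ℝ)) p μ :=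
    (memLp_indicator_iff_restrict (measurableSet_spanningSets μ n)).2 h1
  refine h2.mono (aemeasurable_truncate hf n).ennreal_toReal.aestronglyMeasurable
    (.of_forall fun x => ?_)
  by_cases hx : x ∈ spanningSets μ n
  · rw [Set.indicator_of_mem hx, Real.norm_of_nonneg ENNReal.toReal_nonneg,
      Real.norm_of_nonneg (by positivity)]
    exact ENNReal.toReal_mono (by simp) (truncate_le_nat f n x)
  · simp [truncate, hx]

theorem lintegral_mul_eq_iSup_truncate {f g : α → ℝ≥0∞} (hf : AEMeasurable f μ)
    (hg : AEMeasurable g μ) : ∫⁻ x, f x * g x ∂μ = ⨆ n, ∫⁻ x, f x * truncate μ g n x ∂μ := by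
  have h : ∫⁻ x, ⨆ n, f x * truncate μ g n x ∂μ = ⨆ n, ∫⁻ x, f x * truncate μ g n x ∂μ :=
    lintegral_iSup' (fun m => hf.mul (aemeasurable_truncate hg m)) (.of_forall fun x a b hab => by
      have := monotone_truncate (μ := μ) g x hab
      dsimp only at this ⊢
      gcongr)
  rw [← h]
  simp only [← ENNReal.mul_iSup, iSup_truncate]

end Truncation

/-! ### The Lorentz–Luxemburg theorem. -/

namespace BanachFunctionNorm

variable {α : Type*} [MeasurableSpace α] {μ : Measure α}

theorem toFun_congr (ρ : BanachFunctionNorm μ) {f g : α → ℝ≥0∞} (hf : AEMeasurable f μ)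
    (h : f =ᵐ[μ] g) : ρ.toFun f = ρ.toFun g :=
  le_antisymm (ρ.mono' _ _ hf (hf.congr h) h.le) (ρ.mono' _ _ (hf.congr h) hf h.symm.le)

/-- The Fatou property applies to the infima of the tails, which increase to the limit. -/
theorem toFun_le_liminf (ρ : BanachFunctionNorm μ) {f : α → ℝ≥0∞} {F : ℕ → α → ℝ≥0∞}
    (hF : ∀ n, AEMeasurable (F n) μ) (hf : AEMeasurable f μ)
    (hlim : ∀ᵐ x ∂μ, Tendsto (fun n => F n x) atTop (𝓝 (f x))) :
    ρ.toFun f ≤ liminf (fun n => ρ.toFun (F n)) atTop := by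
  have hG : ∀ n, AEMeasurable (fun x => ⨅ m, F (n + m) x) μ := fun n => .iInf fun m => hF _
  have hmono : ∀ x, Monotone fun n => ⨅ m, F (n + m) x := fun x a b hab =>
    le_iInf fun m => (iInf_le _ (b - a + m)).trans (le_of_eq (by congr 1; omega))
  have h1 := ρ.fatou' _ hG (.of_forall hmono)
  have h2 : ρ.toFun f = ρ.toFun fun x => ⨆ n, ⨅ m, F (n + m) x := by
    refine ρ.toFun_congr hf ?_
    filter_upwards [hlim] with x hx
    rw [← hx.liminf_eq, liminf_eq_iSup_iInf_of_nat']
    simp only [add_comm]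
  rw [h2, ← h1.liminf_eq]
  refine liminf_le_liminf (.of_forall fun n => ρ.mono' _ _ (hG n) (hF n) (.of_forall fun x => ?_))
  exact iInf_le_of_le 0 le_rfl

theorem lintegral_mul_le (ρ : BanachFunctionNorm μ) (f g : α → ℝ≥0∞) (hg : AEMeasurable g μ)
    (h : ρ.toFun g < ∞) : ∫⁻ x, f x * g x ∂μ ≤ ρ.associateFun f * ρ.toFun g := by
  by_cases h0 : ρ.toFun g = 0
  · have hz := (ρ.eq_zero_iff' _ hg).1 h0
    have : ∫⁻ x, f x * g x ∂μ = 0 := by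
      rw [lintegral_congr_ae (g := fun _ => 0), lintegral_zero]
      filter_upwards [hz] with x hx
      simp [hx]
    simp [this]
  · exact (ENNReal.div_le_iff h0 h.ne).1 (ρ.le_associateFun f g hg h)

theorem associateFun_le (ρ : BanachFunctionNorm μ) {f : α → ℝ≥0∞} {c : ℝ≥0∞}
    (h : ∀ g : α → ℝ≥0∞, AEMeasurable g μ → ρ.toFun g < ∞ → ∫⁻ x, f x * g x ∂μ ≤ c * ρ.toFun g) :
    ρ.associateFun f ≤ c :=
  iSup_le fun g => iSup_le fun hg => iSup_le fun hg' => ENNReal.div_le_of_le_mul (h g hg hg')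

/-- Separation is carried out in `L²`, where the dual is known, by regarding the balls of `ρ` as
convex subsets of that Hilbert space. -/
theorem convex_unitBall_L2 (ρ : BanachFunctionNorm μ) (c : ℝ≥0∞) :
    Convex ℝ {u : Lp ℝ 2 μ | ρ.toFun (fun x => ‖u x‖ₑ) ≤ c} := by
  intro u hu v hv a b ha hb hab
  lift a to ℝ≥0 using ha
  lift b to ℝ≥0 using hb
  have mu : AEMeasurable (fun x => ‖u x‖ₑ) μ := (Lp.aestronglyMeasurable u).enorm
  have mv : AEMeasurable (fun x => ‖v x‖ₑ) μ := (Lp.aestronglyMeasurable v).enorm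
  calc ρ.toFun (fun x => ‖((a : ℝ) • u + (b : ℝ) • v : Lp ℝ 2 μ) x‖ₑ)
      ≤ ρ.toFun (fun x => a * ‖u x‖ₑ + b * ‖v x‖ₑ) := by
        refine ρ.mono' _ _ (Lp.aestronglyMeasurable _).enorm
          ((mu.const_mul _).add (mv.const_mul _)) ?_
        filter_upwards [Lp.coeFn_add ((a : ℝ) • u) ((b : ℝ) • v), Lp.coeFn_smul (a : ℝ) u,
          Lp.coeFn_smul (b : ℝ) v] with x h1 h2 h3
        rw [h1, Pi.add_apply, h2, h3]
        refine (enorm_add_le _ _).trans ?_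
        simp [enorm_mul]
    _ ≤ a * ρ.toFun (fun x => ‖u x‖ₑ) + b * ρ.toFun (fun x => ‖v x‖ₑ) := by
        rw [← ρ.smul' a _ mu, ← ρ.smul' b _ mv]
        exact ρ.add_le' _ _ (mu.const_mul _) (mv.const_mul _)
    _ ≤ a * c + b * c := by
        gcongr
        exacts [hu, hv]
    _ = c := by
        rw [← add_mul]
        have : a + b = 1 := by exact_mod_cast hab
        rw [← ENNReal.coe_add, this]
        simp

/-- An `L²`-convergent sequence has an almost everywhere convergent subsequence, along which `ρ` is
lower semicontinuous. -/
theorem isClosed_unitBall_L2 (ρ : BanachFunctionNorm μ) (c : ℝ≥0∞) :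
    IsClosed {u : Lp ℝ 2 μ | ρ.toFun (fun x => ‖u x‖ₑ) ≤ c} := by
  refine IsSeqClosed.isClosed fun u v hu hv => ?_
  obtain ⟨n, -, hn⟩ := (tendstoInMeasure_of_tendsto_Lp hv).exists_seq_tendsto_ae
  refine (ρ.toFun_le_liminf (F := fun i x => ‖u (n i) x‖ₑ)
    (fun i => (Lp.aestronglyMeasurable _).enorm) (Lp.aestronglyMeasurable _).enorm ?_).trans ?_
  · filter_upwards [hn] with x hx using hx.enorm
  · exact (liminf_le_liminf (.of_forall fun i => hu (n i))).trans (by simp)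

variable [SigmaFinite μ]

/-- The Lorentz–Luxemburg theorem: a Banach function norm is the associate of its associate. -/
theorem toFun_le_of_forall_lintegral_mul_le (ρ : BanachFunctionNorm μ) {f : α → ℝ≥0∞}
    (hf : AEMeasurable f μ) {c : ℝ≥0∞}
    (h : ∀ g : α → ℝ≥0∞, AEMeasurable g μ → ρ.associateFun g < ∞ →
      ∫⁻ x, f x * g x ∂μ ≤ c * ρ.associateFun g) : ρ.toFun f ≤ c := by
  -- Truncations lie in `L²` and increase to `f`, so the Fatou property reduces the claim to them.
  suffices H : ∀ n, ρ.toFun (truncate μ f n) ≤ c by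
    have h1 := ρ.fatou' _ (aemeasurable_truncate hf) (.of_forall (monotone_truncate f))
    simp only [iSup_truncate] at h1
    exact le_of_tendsto' h1 H
  intro n
  by_contra! hlt
  -- A finite radius strictly above `c` is positive, so the final division by `d` is legitimate even
  -- for `c = 0`.
  obtain ⟨d, hcd, hd⟩ := ENNReal.lt_iff_exists_nnreal_btwn.1 hlt
  have hd0 : (d : ℝ≥0∞) ≠ 0 := (bot_le.trans_lt hcd).ne'
  set u : Lp ℝ 2 μ := (memLp_toReal_truncate hf n 2).toLp with hu
  have huf : (fun x => ‖u x‖ₑ) =ᵐ[μ] truncate μ f n := by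
    filter_upwards [(memLp_toReal_truncate hf n 2).coeFn_toLp] with x hx
    rw [hu, hx, Real.enorm_of_nonneg ENNReal.toReal_nonneg, ENNReal.ofReal_toReal]
    exact ((truncate_le_nat f n x).trans_lt (by simp)).ne
  have hmu : AEMeasurable (fun x => ‖u x‖ₑ) μ := (Lp.aestronglyMeasurable u).enorm
  have hnot : u ∉ {u : Lp ℝ 2 μ | ρ.toFun (fun x => ‖u x‖ₑ) ≤ d} := fun hmem =>
    absurd ((ρ.toFun_congr hmu huf).symm.le.trans hmem) (not_le.2 hd)
  obtain ⟨l, γ, hl, hγ⟩ := geometric_hahn_banach_closed_point (ρ.convex_unitBall_L2 d)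
    (ρ.isClosed_unitBall_L2 d) hnot
  set w : Lp ℝ 2 μ := (InnerProductSpace.toDual ℝ (Lp ℝ 2 μ)).symm l with hw
  have hlw : ∀ k : Lp ℝ 2 μ, l k = ∫ x, k x * w x ∂μ := fun k => by
    rw [← InnerProductSpace.toDual_symm_apply, L2.inner_def]
    simp [hw]
  have hγ0 : 0 < γ := by
    have h0 := hl 0 (by
      show ρ.toFun _ ≤ _
      have : (fun x => ‖(0 : Lp ℝ 2 μ) x‖ₑ) =ᵐ[μ] 0 := by
        filter_upwards [Lp.coeFn_zero ℝ 2 μ] with x hx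
        rw [hx]
        simp
      rw [(ρ.eq_zero_iff' _ (Lp.aestronglyMeasurable _).enorm).2 this]
      exact bot_le)
    simpa using h0
  have hmw : AEMeasurable (fun x => ‖w x‖ₑ) μ := (Lp.aestronglyMeasurable w).enorm
  -- The separating functional bounds integrals only over `L²` functions. Truncating `g` and
  -- multiplying by the sign of `w` reaches the integral of `|w| g`.
  have hball : ∀ g : α → ℝ≥0∞, AEMeasurable g μ → ρ.toFun g ≤ d →
      ∫⁻ x, ‖w x‖ₑ * g x ∂μ ≤ ENNReal.ofReal γ := by
    intro g hg hgd
    rw [lintegral_mul_eq_iSup_truncate hmw hg]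
    refine iSup_le fun m => ?_
    have hsgn : AEStronglyMeasurable (fun x => (SignType.sign (w x) : ℝ)) μ := by
      have : Measurable fun r : ℝ => (SignType.sign r : ℝ) := by
        have h3 : (fun r : ℝ => (SignType.sign r : ℝ)) =
            fun r => if 0 < r then 1 else if r < 0 then -1 else 0 := by
          ext r
          rw [sign_apply]
          split_ifs <;> simp
        rw [h3]
        exact Measurable.ite measurableSet_Ioi measurable_const
          (Measurable.ite measurableSet_Iio measurable_const measurable_const)
      exact (this.comp_aemeasurable (Lp.aestronglyMeasurable w).aemeasurable).aestronglyMeasurable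
    have hk : MemLp (fun x => (truncate μ g m x).toReal * SignType.sign (w x)) 2 μ := by
      refine (memLp_toReal_truncate hg m 2).mono
        ((memLp_toReal_truncate hg m 2).1.mul hsgn) (.of_forall fun x => ?_)
      rw [norm_mul]
      refine mul_le_of_le_one_right (norm_nonneg _) ?_
      rcases lt_trichotomy (w x) 0 with h | h | h <;> simp [h]
    have hkρ : ρ.toFun (fun x => ‖(hk.toLp _) x‖ₑ) ≤ d := by
      refine (ρ.mono' _ _ (Lp.aestronglyMeasurable _).enorm hg ?_).trans hgd
      filter_upwards [MemLp.coeFn_toLp hk] with x hx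
      rw [hx, enorm_mul]
      refine le_trans ?_ (truncate_le (μ := μ) g m x)
      rw [Real.enorm_of_nonneg ENNReal.toReal_nonneg]
      refine (mul_le_of_le_one_right bot_le ?_).trans ENNReal.ofReal_toReal_le
      rcases lt_trichotomy (w x) 0 with h | h | h <;> simp [h]
    have h1 := (hl _ hkρ).le
    rw [hlw] at h1
    have h2 : (fun x => (hk.toLp _) x * w x) =ᵐ[μ] fun x => ‖w x‖ * (truncate μ g m x).toReal := by
      filter_upwards [hk.coeFn_toLp] with x hx
      rw [hx, mul_assoc, mul_comm, sign_mul_self, Real.norm_eq_abs]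
    rw [integral_congr_ae h2] at h1
    have hint : Integrable (fun x => ‖w x‖ * (truncate μ g m x).toReal) μ :=
      (Lp.memLp w).norm.integrable_mul (memLp_toReal_truncate hg m 2)
    have h3 := ofReal_integral_eq_lintegral_ofReal hint
      (.of_forall fun x => mul_nonneg (norm_nonneg _) ENNReal.toReal_nonneg)
    have h4 : ∫⁻ x, ‖w x‖ₑ * truncate μ g m x ∂μ =
        ∫⁻ x, ENNReal.ofReal (‖w x‖ * (truncate μ g m x).toReal) ∂μ := by
      refine lintegral_congr fun x => ?_
      rw [ENNReal.ofReal_mul (norm_nonneg _), ENNReal.ofReal_toReal, ofReal_norm]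
      exact ((truncate_le_nat g m x).trans_lt (by simp)).ne
    rw [h4, ← h3]
    exact ENNReal.ofReal_le_ofReal h1
  have hassoc : ρ.associateFun (fun x => ‖w x‖ₑ) ≤ ENNReal.ofReal γ / d := by
    refine ρ.associateFun_le fun g hg hg' => ?_
    rcases eq_or_ne (ρ.toFun g) 0 with h0 | h0
    · have hz := (ρ.eq_zero_iff' _ hg).1 h0
      rw [lintegral_congr_ae (g := fun _ => 0), lintegral_zero]
      · exact bot_le
      filter_upwards [hz] with x hx
      simp [hx]
    -- This factor rescales `g` to norm `d`.
    · set r : ℝ≥0 := d / (ρ.toFun g).toNNReal with hr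
      have hrg : (r : ℝ≥0∞) = d / ρ.toFun g := by
        rw [hr, ENNReal.coe_div, ENNReal.coe_toNNReal hg'.ne]
        exact (ENNReal.toNNReal_ne_zero).2 ⟨h0, hg'.ne⟩
      have hr0 : (r : ℝ≥0∞) ≠ 0 := by
        rw [hrg]
        exact (ENNReal.div_pos hd0 hg'.ne).ne'
      have h1 := hball (fun x => r * g x) (hg.const_mul _) (by
        rw [ρ.smul' r g hg, hrg, ENNReal.div_mul_cancel h0 hg'.ne])
      have h2 : ∫⁻ x, ‖w x‖ₑ * (r * g x) ∂μ = r * ∫⁻ x, ‖w x‖ₑ * g x ∂μ := by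
        have h3 : ∫⁻ x, r * (‖w x‖ₑ * g x) ∂μ = r * ∫⁻ x, ‖w x‖ₑ * g x ∂μ :=
          lintegral_const_mul'' _ (hmw.mul hg)
        rw [← h3]
        exact lintegral_congr fun x => by ring
      rw [h2, mul_comm, ← ENNReal.le_div_iff_mul_le (Or.inl hr0) (Or.inl (by simp))] at h1
      refine h1.trans (le_of_eq ?_)
      rw [hrg, div_eq_mul_inv, div_eq_mul_inv, div_eq_mul_inv,
        ENNReal.mul_inv (Or.inl hd0) (Or.inl (by simp)), inv_inv, mul_assoc]
  have hfin : ρ.associateFun (fun x => ‖w x‖ₑ) < ∞ :=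
    hassoc.trans_lt (ENNReal.div_lt_top (by simp) hd0)
  have hle : ENNReal.ofReal γ < ∫⁻ x, truncate μ f n x * ‖w x‖ₑ ∂μ := by
    rw [hlw] at hγ
    calc ENNReal.ofReal γ < ENNReal.ofReal (∫ x, u x * w x ∂μ) :=
          (ENNReal.ofReal_lt_ofReal_iff (hγ0.trans hγ)).2 hγ
      _ ≤ ‖∫ x, u x * w x ∂μ‖ₑ := Real.ofReal_le_enorm _
      _ ≤ ∫⁻ x, ‖u x * w x‖ₑ ∂μ := enorm_integral_le_lintegral_enorm _
      _ = _ := by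
        refine lintegral_congr_ae ?_
        filter_upwards [huf] with x hx
        rw [enorm_mul, hx]
  have hfinal := calc ENNReal.ofReal γ < ∫⁻ x, truncate μ f n x * ‖w x‖ₑ ∂μ := hle
      _ ≤ ∫⁻ x, f x * ‖w x‖ₑ ∂μ := lintegral_mono fun x => by
          gcongr
          exact truncate_le f n x
      _ ≤ c * ρ.associateFun (fun x => ‖w x‖ₑ) := h _ hmw hfin
      _ ≤ d * (ENNReal.ofReal γ / d) := by gcongr
      _ = ENNReal.ofReal γ := ENNReal.mul_div_cancel hd0 (by simp)
  exact lt_irrefl _ hfinal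

/-- One inequality is Hölder, the other Lorentz–Luxemburg. Infinite norm is separated because Hölder
is available only for functions of finite norm. -/
theorem toFun_eq_associateFun_associate (ρ : BanachFunctionNorm μ) {f : α → ℝ≥0∞}
    (hf : AEMeasurable f μ) : ρ.associate.associateFun f = ρ.toFun f := by
  refine le_antisymm (associateFun_le _ fun g hg hg' => ?_)
    (ρ.toFun_le_of_forall_lintegral_mul_le hf fun g hg hg' =>
      ρ.associate.lintegral_mul_le f g hg hg')
  rcases eq_or_ne (ρ.toFun f) ∞ with h | h
  · by_cases h0 : ρ.associate.toFun g = 0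
    · have hz := (ρ.associate.eq_zero_iff' _ hg).1 h0
      rw [lintegral_congr_ae (g := fun _ => 0), lintegral_zero]
      · exact bot_le
      filter_upwards [hz] with x hx
      simp [hx]
    · simp [h, ENNReal.top_mul h0]
  · have := ρ.lintegral_mul_le g f hf h.lt_top
    rw [mul_comm (ρ.toFun f)]
    change _ ≤ ρ.associateFun g * _
    simpa only [mul_comm (g _)] using this

end BanachFunctionNorm
-- Rearrangement-invariant norms, (ACR) and absolute continuity.
namespace BanachFunctionNorm

variable {α : Type*} [MeasurableSpace α] {μ : Measure α}

/-- Hölder's inequality for rearrangements. -/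
theorem rearrangementLIntegral_le (hres : IsResonant μ) (ρ : BanachFunctionNorm μ)
    (hri : ρ.IsRearrangementInvariant) {f g : α → ℝ≥0∞} (hf : AEMeasurable f μ)
    (hg : AEMeasurable g μ) (h : ρ.toFun f < ∞) :
    rearrangementLIntegral μ f g ≤ ρ.associateFun g * ρ.toFun f := by
  rw [rearrangementLIntegral_comm]
  refine hres.rearrangementLIntegral_le hg hf fun k hk he => ?_
  rw [← hri k f hk hf he] at h ⊢
  exact ρ.lintegral_mul_le g k hk h

theorem toFun_eq_zero_of_ae (ρ : BanachFunctionNorm μ) {f : α → ℝ≥0∞} (h : f =ᵐ[μ] 0) :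
    ρ.toFun f = 0 :=
  (ρ.eq_zero_iff' f (aemeasurable_const.congr h.symm)).2 h

theorem aemeasurable_indicator_one {E : Set α} (hE : MeasurableSet E) :
    AEMeasurable (E.indicator (1 : α → ℝ≥0∞)) μ :=
  (measurable_one.indicator hE).aemeasurable

theorem lintegral_indicator_one_mul {E : Set α} (hE : MeasurableSet E) (g : α → ℝ≥0∞) :
    ∫⁻ x, E.indicator 1 x * g x ∂μ = ∫⁻ x in E, g x ∂μ := by
  rw [← lintegral_indicator hE]
  congr 1 with x
  by_cases hx : x ∈ E <;> simp [hx]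

variable [SigmaFinite μ]

/-- The dilation estimate for pairings passes to the norm by Lorentz–Luxemburg and Hölder. -/
theorem toFun_dilation (hres : IsResonant μ) (ρ : BanachFunctionNorm μ)
    (hri : ρ.IsRearrangementInvariant) {f g : α → ℝ≥0∞} (hf : AEMeasurable f μ)
    (hg : AEMeasurable g μ) {A : ℝ≥0} (hA : 1 ≤ A)
    (h : ∀ s : ℝ≥0, μ {x | (s : ℝ≥0∞) < g x} ≤ A * μ {x | (s : ℝ≥0∞) < f x}) :
    ρ.toFun g ≤ A * ρ.toFun f := by
  rcases eq_or_ne (ρ.toFun f) ∞ with h0 | h0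
  · rw [h0, ENNReal.mul_top]
    · exact le_top
    · exact_mod_cast (lt_of_lt_of_le one_pos hA).ne'
  refine ρ.toFun_le_of_forall_lintegral_mul_le hg fun k hk _ => ?_
  calc ∫⁻ x, g x * k x ∂μ ≤ rearrangementLIntegral μ g k := hres.lintegral_mul_le hg hk
    _ ≤ A * rearrangementLIntegral μ f k := rearrangementLIntegral_dilation hA h k
    _ ≤ A * (ρ.associateFun k * ρ.toFun f) := by
        gcongr
        exact ρ.rearrangementLIntegral_le hres hri hf hk h0.lt_top
    _ = A * ρ.toFun f * ρ.associateFun k := by ring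

theorem IsRearrangementInvariant.associate (hres : IsResonant μ) {ρ : BanachFunctionNorm μ}
    (hri : ρ.IsRearrangementInvariant) : ρ.associate.IsRearrangementInvariant := by
  have key : ∀ f g : α → ℝ≥0∞, AEMeasurable f μ → AEMeasurable g μ → Equimeasurable μ f g →
      ρ.associateFun f ≤ ρ.associateFun g := fun f g hf hg he =>
    ρ.associateFun_le fun k hk hk' => by
      refine (hres.lintegral_mul_le hf hk).trans ?_
      rw [he.rearrangementLIntegral_eq, rearrangementLIntegral_comm]
      exact ρ.rearrangementLIntegral_le hres hri hk hg hk'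
  exact fun f g hf hg he => le_antisymm (key f g hf hg he) (key g f hg hf he.symm)

/-- The rearrangements of the functions in the unit ball of the associate space decay uniformly. -/
theorem HasACR.exists_rearrangement_le (hres : IsResonant μ) {ρ : BanachFunctionNorm μ}
    (hri : ρ.IsRearrangementInvariant) (hACR : ρ.associate.HasACR) {c : ℝ≥0} (hc : 0 < c) :
    ∃ E : Set α, MeasurableSet E ∧ μ E < ∞ ∧ ∀ ψ : α → ℝ≥0∞, AEMeasurable ψ μ →
      rearrangement μ ψ (μ E).toReal ≤ c * ρ.associateFun ψ := by
  by_cases hfin : μ Set.univ < ∞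
  · refine ⟨Set.univ, .univ, hfin, fun ψ _ => ?_⟩
    rw [rearrangement_eq_zero_of_measure_univ_le (by rw [ENNReal.ofReal_toReal hfin.ne])]
    exact bot_le
  -- On a space of infinite measure the constant `1` has a non-vanishing rearrangement, so (ACR)
  -- keeps it out of `X'`. By the Fatou property the associate norms of the spanning sets then tend
  -- to `∞`, and `E` is one whose norm exceeds `1/c`.
  have htop : ρ.associateFun (Set.univ.indicator 1) = ∞ := by
    by_contra hne
    have hconst : (fun x => ‖(AEEqFun.const α (1 : ℂ) : α →ₘ[μ] ℂ) x‖ₑ) =ᵐ[μ]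
        Set.univ.indicator 1 := by
      filter_upwards [AEEqFun.coeFn_const α (1 : ℂ) (μ := μ)] with x hx
      rw [hx]
      simp
    have hmem : (AEEqFun.const α (1 : ℂ) : α →ₘ[μ] ℂ) ∈ ρ.associate.space := by
      refine lt_of_le_of_lt ?_ (lt_top_iff_ne_top.2 hne)
      exact ρ.associateFun_mono hconst.le
    have h1 := hACR ⟨_, hmem⟩
    have h2 := h1.eventually (gt_mem_nhds (show (0 : ℝ≥0∞) < 1 by simp))
    obtain ⟨t, ht⟩ := h2.exists
    have h3 := rearrangement_mono hconst.symm.le t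
    rw [rearrangement_indicator, Set.indicator_of_mem] at h3
    · exact absurd (h3.trans_lt ht) (by simp)
    · show ENNReal.ofReal t < μ Set.univ
      rw [not_lt_top_iff.1 hfin]
      simp
  have hfatou := ρ.associate.fatou' (fun n => (spanningSets μ n).indicator 1)
    (fun n => aemeasurable_indicator_one (measurableSet_spanningSets μ n))
    (.of_forall fun x m n hmn => Set.indicator_le_indicator_of_subset
      (monotone_spanningSets μ hmn) (fun _ => bot_le) x)
  have hsup : (fun x => ⨆ n, (spanningSets μ n).indicator (1 : α → ℝ≥0∞) x) =
      Set.univ.indicator 1 := by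
    ext x
    refine le_antisymm (iSup_le fun n => Set.indicator_le_indicator_of_subset
      (Set.subset_univ _) (fun _ => bot_le) x) ?_
    refine le_iSup_of_le (spanningSetsIndex μ x) ?_
    rw [Set.indicator_of_mem (mem_spanningSetsIndex μ x)]
    simp
  rw [hsup] at hfatou
  change Tendsto (fun n => ρ.associateFun _) _ (𝓝 (ρ.associateFun _)) at hfatou
  rw [htop] at hfatou
  have hcinv : ((c : ℝ≥0∞)⁻¹) < ∞ := by
    simpa using hc
  obtain ⟨n, hn⟩ := (hfatou.eventually (lt_mem_nhds hcinv)).exists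
  set E := spanningSets μ n
  have hE : MeasurableSet E := measurableSet_spanningSets μ n
  refine ⟨E, hE, measure_spanningSets_lt_top μ n, fun ψ hψ => ?_⟩
  set s := rearrangement μ ψ (μ E).toReal with hs
  -- On `[0, μ E)` the rearrangement of `ψ` is at least its value `s` at `μ E`, so it dominates that
  -- of `s` times the characteristic function of `E`.
  have key : s * ρ.associateFun (E.indicator 1) ≤ ρ.associateFun ψ := by
    unfold associateFun
    simp only [ENNReal.mul_iSup]
    refine iSup_le fun g => iSup_le fun hg => iSup_le fun hg' => ?_
    rw [← mul_div_assoc]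
    refine ENNReal.div_le_of_le_mul ?_
    calc s * ∫⁻ x, E.indicator 1 x * g x ∂μ
        ≤ s * rearrangementLIntegral μ (E.indicator 1) g := by
          gcongr
          exact hres.lintegral_mul_le (aemeasurable_indicator_one hE) hg
      _ = ∫⁻ t in Set.Ioi (0 : ℝ), s * (rearrangement μ (E.indicator 1) t * rearrangement μ g t) :=
          (lintegral_const_mul _ (measurable_rearrangement.mul measurable_rearrangement)).symm
      _ ≤ rearrangementLIntegral μ ψ g := by
          refine lintegral_mono fun t => ?_
          dsimp only
          rw [← mul_assoc]
          gcongr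
          rw [rearrangement_indicator]
          by_cases ht : ENNReal.ofReal t < μ E
          · rw [Set.indicator_of_mem (by exact ht), Pi.one_apply, mul_one]
            refine rearrangement_antitone ?_
            exact (ENNReal.ofReal_le_iff_le_toReal (measure_spanningSets_lt_top μ n).ne).1 ht.le
          · rw [Set.indicator_of_notMem (by exact ht), mul_zero]
            exact bot_le
      _ ≤ ρ.associateFun ψ * ρ.toFun g := by
          rw [rearrangementLIntegral_comm]
          exact ρ.rearrangementLIntegral_le hres hri hg hψ hg'
  calc s = c * (s * (c : ℝ≥0∞)⁻¹) := by
        rw [mul_left_comm, ENNReal.mul_inv_cancel (by exact_mod_cast hc.ne') (by simp), mul_one]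
    _ ≤ c * (s * ρ.associateFun (E.indicator 1)) := by gcongr
    _ ≤ c * ρ.associateFun ψ := by gcongr

/-- In the pairing of `u` with `ψ` the half-line is split at `μ E`. Before it `u^*` is at most `ε`;
after it `ψ^*` is at most `c` times the associate norm of `ψ`, and the integral of `u^*` is bounded
by that of `u`. -/
theorem toFun_le_of_rearrangement_le (hres : IsResonant μ) {ρ : BanachFunctionNorm μ}
    (hri : ρ.IsRearrangementInvariant) {c : ℝ≥0} {E : Set α} (hE : MeasurableSet E)
    (hμE : μ E < ∞) (hEc : ∀ ψ : α → ℝ≥0∞, AEMeasurable ψ μ →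
      rearrangement μ ψ (μ E).toReal ≤ c * ρ.associateFun ψ)
    {u : α → ℝ≥0∞} (hu : AEMeasurable u μ) {ε : ℝ≥0} (hε : ∀ᵐ x ∂μ, u x ≤ ε) :
    ρ.toFun u ≤ ε * ρ.toFun (E.indicator 1) + c * ∫⁻ x, u x ∂μ := by
  refine ρ.toFun_le_of_forall_lintegral_mul_le hu fun ψ hψ hψ' => ?_
  calc ∫⁻ x, u x * ψ x ∂μ ≤ rearrangementLIntegral μ u ψ := hres.lintegral_mul_le hu hψ
    _ ≤ ∫⁻ t in Set.Ioi (0 : ℝ), (ε * (rearrangement μ (E.indicator 1) t * rearrangement μ ψ t) +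
          c * ρ.associateFun ψ * rearrangement μ u t) := by
        refine setLIntegral_mono' measurableSet_Ioi fun t ht0 => ?_
        rw [rearrangement_indicator]
        by_cases ht : ENNReal.ofReal t < μ E
        · rw [Set.indicator_of_mem (by exact ht), Pi.one_apply, one_mul]
          refine le_trans ?_ le_self_add
          gcongr
          exact rearrangement_le_const hε t
        · refine le_trans ?_ le_add_self
          rw [mul_comm]
          gcongr
          refine (rearrangement_antitone ?_).trans (hEc ψ hψ)
          exact ENNReal.toReal_le_of_le_ofReal (le_of_lt ht0) (not_lt.1 ht)
    _ = ε * rearrangementLIntegral μ (E.indicator 1) ψ +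
          c * ρ.associateFun ψ * ∫⁻ t in Set.Ioi (0 : ℝ), rearrangement μ u t := by
        refine (lintegral_add_left
          ((measurable_rearrangement.mul measurable_rearrangement).const_mul _) _).trans ?_
        rw [lintegral_const_mul _ measurable_rearrangement]
        congr 1
        exact lintegral_const_mul _ (measurable_rearrangement.mul measurable_rearrangement)
    _ ≤ ε * (ρ.associateFun ψ * ρ.toFun (E.indicator 1)) +
          c * ρ.associateFun ψ * ∫⁻ x, u x ∂μ := by
        gcongr
        · exact ρ.rearrangementLIntegral_le hres hri (aemeasurable_indicator_one hE) hψ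
            (ρ.indicator_lt_top' E hE hμE)
        · exact hres.lintegral_rearrangement_le hu
    _ = _ := by ring

theorem HasACR.toFun_lt_top (hres : IsResonant μ) {ρ : BanachFunctionNorm μ}
    (hri : ρ.IsRearrangementInvariant) (hACR : ρ.associate.HasACR) {u : α → ℝ≥0∞}
    (hu : AEMeasurable u μ) {M : ℝ≥0} (hM : ∀ᵐ x ∂μ, u x ≤ M) (hint : ∫⁻ x, u x ∂μ < ∞) :
    ρ.toFun u < ∞ := by
  obtain ⟨E, hE, hμE, hEc⟩ := hACR.exists_rearrangement_le hres hri one_pos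
  refine (toFun_le_of_rearrangement_le hres hri hE hμE hEc hu hM).trans_lt ?_
  exact ENNReal.add_lt_top.2 ⟨ENNReal.mul_lt_top (by simp) (ρ.indicator_lt_top' E hE hμE),
    ENNReal.mul_lt_top (by simp) hint⟩

/-- A functional that is small on small sets and dominated by the norm tends to zero along uniformly
bounded, uniformly integrable-norm sequences that tend to zero in measure. -/
theorem HasACR.tendsto_zero_of_tendsto_measure (hres : IsResonant μ) {ρ : BanachFunctionNorm μ}
    (hri : ρ.IsRearrangementInvariant) (hACR : ρ.associate.HasACR)
    {q : (α → ℝ≥0∞) → ℝ≥0∞} {B : ℝ≥0∞} (hB : B ≠ ∞)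
    (qmono : ∀ f g : α → ℝ≥0∞, AEMeasurable f μ → AEMeasurable g μ → f ≤ᵐ[μ] g → q f ≤ q g)
    (qadd : ∀ f g : α → ℝ≥0∞, AEMeasurable f μ → AEMeasurable g μ →
      q (fun x => f x + g x) ≤ q f + q g)
    (qsmul : ∀ (a : ℝ≥0) (f : α → ℝ≥0∞), AEMeasurable f μ → q (fun x => a * f x) = a * q f)
    (qle : ∀ f : α → ℝ≥0∞, AEMeasurable f μ → ρ.toFun f < ∞ → q f ≤ B * ρ.toFun f)
    (qsmall : ∀ G : ℕ → Set α, (∀ n, MeasurableSet (G n)) →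
      Tendsto (fun n => μ (G n)) atTop (𝓝 0) → Tendsto (fun n => q ((G n).indicator 1)) atTop (𝓝 0))
    {F : ℕ → α → ℝ≥0∞} (hF : ∀ n, AEMeasurable (F n) μ) {M : ℝ≥0}
    (hM : ∀ n, ∀ᵐ x ∂μ, F n x ≤ M) {K : ℝ≥0∞} (hK : K ≠ ∞) (hint : ∀ n, ∫⁻ x, F n x ∂μ ≤ K)
    (hlim : ∀ ε : ℝ≥0, 0 < ε → Tendsto (fun n => μ {x | (ε : ℝ≥0∞) < F n x}) atTop (𝓝 0)) :
    Tendsto (fun n => q (F n)) atTop (𝓝 0) := by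
  rw [ENNReal.tendsto_nhds_zero]
  intro η hη
  have hη3 : η / 3 ≠ 0 := (ENNReal.div_pos hη.ne' (by simp)).ne'
  -- The order of choices matters: `c` depends on `B K`, the set `E` on `c`, and `ε` on the norm of
  -- `E`. The part of `F n` above `ε` is handled by `qsmall`, the part below by the preceding norm
  -- estimate.
  obtain ⟨c, hc, hcη⟩ := ENNReal.exists_nnreal_pos_mul_lt (ENNReal.mul_ne_top hB hK) hη3
  obtain ⟨E, hE, hμE, hEc⟩ := hACR.exists_rearrangement_le hres hri hc
  have hEfin := (ρ.indicator_lt_top' E hE hμE).ne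
  obtain ⟨ε, hε, hεη⟩ := ENNReal.exists_nnreal_pos_mul_lt (ENNReal.mul_ne_top hB hEfin) hη3
  set G : ℕ → Set α := fun n => toMeasurable μ {x | (ε : ℝ≥0∞) < F n x} with hG
  have hGm : ∀ n, MeasurableSet (G n) := fun n => measurableSet_toMeasurable _ _
  have h1 : Tendsto (fun n => M * q ((G n).indicator 1)) atTop (𝓝 0) := by
    have := ENNReal.Tendsto.const_mul (a := (M : ℝ≥0∞)) (qsmall G hGm (by
      simpa [hG, measure_toMeasurable] using hlim ε hε)) (Or.inr (by simp))
    simpa using this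
  filter_upwards [ENNReal.tendsto_nhds_zero.1 h1 (η / 3) (pos_iff_ne_zero.2 hη3)] with n hn
  have hmin : AEMeasurable (fun x => min (F n x) ε) μ := (hF n).min aemeasurable_const
  have hind := aemeasurable_indicator_one (μ := μ) (hGm n)
  have hρ : ρ.toFun (fun x => min (F n x) ε) ≤ ε * ρ.toFun (E.indicator 1) + c * K := by
    refine (toFun_le_of_rearrangement_le hres hri hE hμE hEc hmin
      (.of_forall fun x => min_le_right _ _)).trans ?_
    gcongr
    exact (lintegral_mono fun x => min_le_left _ _).trans (hint n)
  calc q (F n) ≤ q (fun x => M * (G n).indicator 1 x + min (F n x) ε) := by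
        refine qmono _ _ (hF n) ((hind.const_mul _).add hmin) ?_
        filter_upwards [hM n] with x hx
        by_cases hxε : (ε : ℝ≥0∞) < F n x
        · have : x ∈ G n := subset_toMeasurable _ _ hxε
          rw [Set.indicator_of_mem this, Pi.one_apply, mul_one]
          exact hx.trans le_self_add
        · rw [min_eq_left (not_lt.1 hxε)]
          exact le_add_self
    _ ≤ q (fun x => M * (G n).indicator 1 x) + q (fun x => min (F n x) ε) :=
        qadd _ _ (hind.const_mul _) hmin
    _ ≤ M * q ((G n).indicator 1) + B * (ε * ρ.toFun (E.indicator 1) + c * K) := by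
        rw [qsmul M _ hind]
        gcongr
        refine (qle _ hmin (hρ.trans_lt ?_)).trans (by gcongr)
        exact ENNReal.add_lt_top.2 ⟨(ENNReal.mul_ne_top (by simp) hEfin).lt_top,
          (ENNReal.mul_ne_top (by simp) hK).lt_top⟩
    _ = M * q ((G n).indicator 1) + ε * (B * ρ.toFun (E.indicator 1)) + c * (B * K) := by ring
    _ ≤ η / 3 + η / 3 + η / 3 := by gcongr
    _ = η := ENNReal.add_thirds η

/-- Absolute continuity of `f` controls only subsets of a set `F` on which `|f|` exceeds some `c >
0`. Resonance replaces a small set by one inside `F` of comparable measure, hence comparable norm.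
If the norms stayed large, copies of summable measure would contradict absolute continuity by
Borel–Cantelli. -/
theorem tendsto_toFun_indicator_of_hasACNorm (hres : IsResonant μ) {ρ : BanachFunctionNorm μ}
    (hri : ρ.IsRearrangementInvariant) {f : ρ.space} (hf : ρ.HasACNorm f) (hf0 : f ≠ 0)
    {G : ℕ → Set α} (hG : ∀ n, MeasurableSet (G n)) (hlim : Tendsto (fun n => μ (G n)) atTop (𝓝
      0)) :
    Tendsto (fun n => ρ.toFun ((G n).indicator 1)) atTop (𝓝 0) := by
  have hfm : Measurable fun x => ‖f.1 x‖ₑ := f.1.stronglyMeasurable.measurable.enorm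
  obtain ⟨c, hc, hμF⟩ : ∃ c : ℝ≥0, 0 < c ∧ μ {x | (c : ℝ≥0∞) < ‖f.1 x‖ₑ} ≠ 0 := by
    by_contra! h
    refine hf0 (Subtype.ext (AEEqFun.ext ?_))
    have h1 : ∀ n : ℕ, ∀ᵐ x ∂μ, ‖f.1 x‖ₑ ≤ (((n : ℝ≥0) + 1)⁻¹ : ℝ≥0) := fun n => by
      have := h ((n : ℝ≥0) + 1)⁻¹ (by positivity)
      exact ae_iff.2 (by simpa only [not_le] using this)
    filter_upwards [ae_all_iff.2 h1, AEEqFun.coeFn_zero (α := α) (β := ℂ) (μ := μ)] with x hx h0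
    rw [Submodule.coe_zero, h0]
    have : ‖f.1 x‖ₑ ≤ 0 := by
      refine ENNReal.le_of_forall_pos_le_add fun ε hε _ => ?_
      obtain ⟨n, hn⟩ := exists_nat_one_div_lt (K := ℝ≥0) hε
      rw [zero_add]
      refine (hx n).trans ?_
      rw [one_div] at hn
      exact_mod_cast hn.le
    simpa using this
  set F := {x | (c : ℝ≥0∞) < ‖f.1 x‖ₑ} with hFdef
  have hF : MeasurableSet F := measurableSet_lt measurable_const hfm
  -- sets of small measure have smaller copies inside `F`
  have hcopy : ∀ H : Set α, MeasurableSet H → μ H < μ F → ∃ H' ⊆ F, MeasurableSet H' ∧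
      μ H' ≤ μ H ∧ ρ.toFun (H.indicator 1) ≤ 2 * ρ.toFun (H'.indicator 1) := by
    intro H hH hHF
    by_cases h0 : μ H = 0
    · refine ⟨∅, Set.empty_subset _, .empty, by simp, ?_⟩
      rw [ρ.toFun_eq_zero_of_ae]
      · exact bot_le
      · exact indicator_meas_zero h0
    have hpair : rearrangementLIntegral μ (F.indicator 1) (H.indicator 1) = μ H := by
      have h1 : ∀ t : ℝ, rearrangement μ (F.indicator 1) t * rearrangement μ (H.indicator 1) t =
          {t : ℝ | ENNReal.ofReal t < μ H}.indicator 1 t := fun t => by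
        rw [rearrangement_indicator, rearrangement_indicator]
        by_cases ht : ENNReal.ofReal t < μ H
        · rw [Set.indicator_of_mem (by exact ht.trans hHF), Pi.one_apply, one_mul]
        · rw [Set.indicator_of_notMem (s := {t : ℝ | ENNReal.ofReal t < μ H}) (by exact ht),
            mul_zero]
      have hset : {t : ℝ | ENNReal.ofReal t < μ H} ∩ Set.Ioi 0 = Set.Ioo 0 (μ H).toReal := by
        ext t
        simp only [Set.mem_inter_iff, Set.mem_Ioi, Set.mem_Ioo]
        constructor
        · rintro ⟨h2, h3⟩
          exact ⟨h3, (ENNReal.ofReal_lt_iff_lt_toReal h3.le hHF.ne_top).1 h2⟩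
        · rintro ⟨h2, h3⟩
          exact ⟨(ENNReal.ofReal_lt_iff_lt_toReal h2.le hHF.ne_top).2 h3, h2⟩
      unfold rearrangementLIntegral
      simp only [h1]
      rw [lintegral_indicator_one, Measure.restrict_apply, hset, Real.volume_Ioo, sub_zero,
        ENNReal.ofReal_toReal hHF.ne_top]
      · exact measurableSet_lt ENNReal.measurable_ofReal measurable_const
      · exact measurableSet_lt ENNReal.measurable_ofReal measurable_const
    -- The supremum in the resonance formula need not be attained, so half of it is aimed for; this
    -- is the source of the factor `2`.
    have hhalf : μ H / 2 < rearrangementLIntegral μ (F.indicator 1) (H.indicator 1) := by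
      rw [hpair]
      exact ENNReal.half_lt_self h0 hHF.ne_top
    rw [hres.rearrangementLIntegral_eq (aemeasurable_indicator_one hF)
      (aemeasurable_indicator_one hH)] at hhalf
    obtain ⟨h, hh⟩ := lt_iSup_iff.1 hhalf
    obtain ⟨hhm, hh⟩ := lt_iSup_iff.1 hh
    obtain ⟨he, hh⟩ := lt_iSup_iff.1 hh
    have hle1 : ∀ᵐ x ∂μ, h x ≤ 1 := by
      refine ae_le_of_rearrangement_zero_le ?_
      rw [he 0 le_rfl, rearrangement_indicator]
      exact Set.indicator_le_self' (by simp) _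
    have hsupp : μ {x | 0 < h x} ≤ μ H := by
      have h1 := measure_le_of_rearrangement_le (μ := μ) (f := h) (t := (μ H).toReal) (s := 0) (by
        rw [he _ ENNReal.toReal_nonneg, rearrangement_indicator, Set.indicator_of_notMem]
        show ¬ (ENNReal.ofReal _ < _)
        rw [ENNReal.ofReal_toReal hHF.ne_top]
        exact lt_irrefl _)
      rwa [ENNReal.ofReal_toReal hHF.ne_top] at h1
    -- Since `h ≤ 1` almost everywhere, the integral of `h` over `F` is a lower bound for the
    -- measure of this set; `h` is equimeasurable with `χ_H`, so its support has measure at most `μ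
    -- H`.
    set H' := F ∩ toMeasurable μ {x | 0 < h x}
    have hH'm : MeasurableSet H' := hF.inter (measurableSet_toMeasurable _ _)
    have hH'le : μ H' ≤ μ H :=
      (measure_mono Set.inter_subset_right).trans (by rwa [measure_toMeasurable])
    have hH'ge : μ H ≤ 2 * μ H' := by
      have h1 : ∫⁻ x, F.indicator 1 x * h x ∂μ ≤ μ H' := by
        rw [← lintegral_indicator_one hH'm]
        refine lintegral_mono_ae ?_
        filter_upwards [hle1] with x hx
        by_cases hxF : x ∈ F
        · by_cases hxh : 0 < h x
          · have : x ∈ H' := ⟨hxF, subset_toMeasurable _ _ hxh⟩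
            simpa [hxF, this] using hx
          · simp [not_lt.1 hxh |>.antisymm bot_le]
        · simp [hxF]
      have h2 := hh.le.trans h1
      rw [ENNReal.div_le_iff (by simp) (by simp), mul_comm] at h2
      exact h2
    refine ⟨H', Set.inter_subset_left, hH'm, hH'le, ?_⟩
    have hdil := ρ.toFun_dilation hres hri (f := H'.indicator 1) (g := H.indicator 1) (A := 2)
      (aemeasurable_indicator_one hH'm) (aemeasurable_indicator_one hH) (by norm_num) (fun s => by
        by_cases hs : s < 1
        · have hset : ∀ L : Set α, {x | (s : ℝ≥0∞) < L.indicator 1 x} = L := fun L => by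
            ext x
            by_cases hx : x ∈ L <;> simp [hx, hs]
          rw [hset, hset]
          exact hH'ge
        · have hset : {x | (s : ℝ≥0∞) < H.indicator (1 : α → ℝ≥0∞) x} = ∅ := by
            ext x
            by_cases hx : x ∈ H <;> simp [hx, not_lt.1 hs]
          rw [hset]
          simp)
    exact hdil
  rw [ENNReal.tendsto_nhds_zero]
  intro ε hε
  by_contra hcon
  rw [not_eventually] at hcon
  have hfreq : ∀ n : ℕ, ∃ H : Set α, MeasurableSet H ∧ μ H < min (μ F) (2⁻¹ ^ n) ∧
      ε < ρ.toFun (H.indicator 1) := fun n => by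
    have hpos : 0 < min (μ F) ((2 : ℝ≥0∞)⁻¹ ^ n) := by
      refine lt_min (pos_iff_ne_zero.2 hμF) ?_
      exact ENNReal.pow_pos (by simp) n
    obtain ⟨m, hm1, hm2⟩ := (hcon.and_eventually (hlim.eventually (gt_mem_nhds hpos))).exists
    exact ⟨G m, hG m, hm2, not_le.1 hm1⟩
  choose H hHm hHμ hHε using hfreq
  choose H' hH'F hH'm hH'μ hH'ρ using fun n => hcopy (H n) (hHm n)
    ((hHμ n).trans_le (min_le_left _ _))
  have hsum : ∑' n, μ (H' n) ≠ ∞ := by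
    refine ne_top_of_le_ne_top (b := ∑' n : ℕ, (2 : ℝ≥0∞)⁻¹ ^ n) ?_ (ENNReal.tsum_le_tsum fun n =>
      (hH'μ n).trans ((hHμ n).le.trans (min_le_right _ _)))
    rw [ENNReal.tsum_geometric]
    simp [ENNReal.one_sub_inv_two]
  have hae := ae_eventually_notMem hsum
  have hAC := hf H' hH'm (by
    filter_upwards [hae] with x hx
    refine tendsto_const_nhds.congr' ?_
    filter_upwards [hx] with n hn
    simp [hn])
  have hlow : ∀ n, c * (ε / 2) ≤ ρ.toFun ((H' n).indicator fun x => ‖f.1 x‖ₑ) := fun n => by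
    calc c * (ε / 2) ≤ c * ρ.toFun ((H' n).indicator 1) := by
          gcongr
          refine ENNReal.div_le_of_le_mul ?_
          rw [mul_comm]
          exact (hHε n).le.trans (hH'ρ n)
      _ = ρ.toFun (fun x => c * (H' n).indicator 1 x) :=
          (ρ.smul' c _ (aemeasurable_indicator_one (hH'm n))).symm
      _ ≤ _ := by
          refine ρ.mono' _ _ ((aemeasurable_indicator_one (hH'm n)).const_mul _)
            (hfm.indicator (hH'm n)).aemeasurable (.of_forall fun x => ?_)
          by_cases hx : x ∈ H' n
          · have : (c : ℝ≥0∞) < ‖f.1 x‖ₑ := hH'F n hx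
            simpa [hx] using this.le
          · simp [hx]
  have h0 := ge_of_tendsto' hAC hlow
  have hpos : 0 < (c : ℝ≥0∞) * (ε / 2) :=
    ENNReal.mul_pos (by exact_mod_cast hc.ne') (ENNReal.div_pos hε.ne' (by simp)).ne'
  exact absurd h0 (not_le.2 hpos)

/-- If `f^*` stays away from `0`, some set `F = {|f| > s}` has infinite measure. Removing the
spanning sets leaves sets of infinite measure shrinking to the empty set, whose characteristic
functions are all equimeasurable with that of `F`. Their norms cannot decay. -/
theorem SpaceHasACNorm.hasACR {ρ : BanachFunctionNorm μ} (hri : ρ.IsRearrangementInvariant)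
    (h : ρ.SpaceHasACNorm) : ρ.HasACR := by
  intro f
  have hfm : Measurable fun x => ‖f.1 x‖ₑ := f.1.stronglyMeasurable.measurable.enorm
  rw [ENNReal.tendsto_nhds_zero]
  intro ε hε
  obtain ⟨s, hs0, hsε⟩ := ENNReal.lt_iff_exists_nnreal_btwn.1 hε
  by_cases hex : ∃ t, rearrangement μ (fun x => ‖f.1 x‖ₑ) t ≤ ε
  · obtain ⟨t, ht⟩ := hex
    filter_upwards [eventually_ge_atTop t] with r hr using (rearrangement_antitone hr).trans ht
  exfalso
  push Not at hex
  set F := {x | (s : ℝ≥0∞) < ‖f.1 x‖ₑ} with hFdef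
  have hF : MeasurableSet F := measurableSet_lt measurable_const hfm
  have hFtop : μ F = ∞ := by
    by_contra hne
    refine absurd (hex (μ F).toReal) (not_lt.2 ?_)
    refine (rearrangement_le_of_measure_le (s := s) ?_).trans hsε.le
    rw [ENNReal.ofReal_toReal hne]
  set E : ℕ → Set α := fun n => F \ spanningSets μ n
  have hEm : ∀ n, MeasurableSet (E n) := fun n => hF.diff (measurableSet_spanningSets μ n)
  have hEtop : ∀ n, μ (E n) = ∞ := fun n => by
    rw [measure_sdiff_eq_top hFtop (measure_spanningSets_lt_top μ n).ne]
  have hAC := h f E hEm (.of_forall fun x => by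
    refine tendsto_const_nhds.congr' ?_
    filter_upwards [eventually_ge_atTop (spanningSetsIndex μ x)] with n hn
    have : x ∉ E n := fun hx => hx.2 (monotone_spanningSets μ hn (mem_spanningSetsIndex μ x))
    simp [this])
  have hlow : ∀ n, s * ρ.toFun (F.indicator 1) ≤ ρ.toFun ((E n).indicator fun x => ‖f.1 x‖ₑ) := by
    intro n
    have heq : ρ.toFun (F.indicator 1) = ρ.toFun ((E n).indicator 1) := by
      refine hri _ _ (aemeasurable_indicator_one hF) (aemeasurable_indicator_one (hEm n))
        fun t _ => ?_
      rw [rearrangement_indicator, rearrangement_indicator, hFtop, hEtop n]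
    rw [heq, ← ρ.smul' s _ (aemeasurable_indicator_one (hEm n))]
    refine ρ.mono' _ _ ((aemeasurable_indicator_one (hEm n)).const_mul _)
      (hfm.indicator (hEm n)).aemeasurable (.of_forall fun x => ?_)
    by_cases hx : x ∈ E n
    · have : (s : ℝ≥0∞) < ‖f.1 x‖ₑ := hx.1
      simpa [hx] using this.le
    · simp [hx]
  have h0 := (ge_of_tendsto' hAC hlow).antisymm bot_le
  have h1 : ρ.toFun (F.indicator 1) = 0 := by
    rcases mul_eq_zero.1 h0 with h2 | h2
    · exact absurd h2 hs0.ne'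
    · exact h2
  have h2 := (ρ.eq_zero_iff' _ (aemeasurable_indicator_one hF)).1 h1
  have h3 : μ F = 0 := by
    rw [← lintegral_indicator_one hF, lintegral_congr_ae h2]
    simp
  simp [h3] at hFtop

end BanachFunctionNorm
-- Cesàro means and the Hilbert space mean ergodic theorem.
section CesaroMeans

theorem Seminorm.inv_smul_sum_range_le {E : Type*} [AddCommGroup E] [Module ℂ E] (p : Seminorm ℂ E)
    {x : ℕ → E} {B : ℝ} (hB : 0 ≤ B) (h : ∀ i, p (x i) ≤ B) (n : ℕ) :
    p ((n : ℂ)⁻¹ • ∑ i ∈ Finset.range n, x i) ≤ B := by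
  have h1 : p (∑ i ∈ Finset.range n, x i) ≤ n * B := by
    refine (Finset.le_sum_of_subadditive p (map_zero p).le (map_add_le_add p) _ _).trans
      ((Finset.sum_le_sum fun i _ => h i).trans ?_)
    simp
  rw [map_smul_eq_mul, norm_inv, Complex.norm_natCast]
  -- With `0⁻¹ = 0` the mean for `n = 0` is zero; only this case uses `0 ≤ B`.
  rcases n.eq_zero_or_pos with rfl | hn
  · simpa using hB
  · rw [inv_mul_le_iff₀ (by exact_mod_cast hn)]
    exact h1

variable {E : Type*} [NormedAddCommGroup E] [NormedSpace ℂ E]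

/-- The geometric sum factors `1 - S ^ i` through `1 - S`, and the difference is an average of such
terms. -/
theorem cesaro_mem_range (S : E →L[ℂ] E) (x : E) {n : ℕ} (hn : n ≠ 0) :
    x - (n : ℂ)⁻¹ • ∑ i ∈ Finset.range n, (S ^ i) x ∈ LinearMap.range (1 - S).toLinearMap := by
  have h1 : ∀ i : ℕ, x - (S ^ i) x ∈ LinearMap.range (1 - S).toLinearMap := fun i => by
    refine ⟨∑ j ∈ Finset.range i, (S ^ j) x, ?_⟩
    have h2 := congrArg (fun L : E →L[ℂ] E => L x) (mul_neg_geom_sum S i)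
    simpa using h2
  have h3 : x - (n : ℂ)⁻¹ • ∑ i ∈ Finset.range n, (S ^ i) x =
      (n : ℂ)⁻¹ • ∑ i ∈ Finset.range n, (x - (S ^ i) x) := by
    rw [Finset.sum_sub_distrib, smul_sub]
    congr 1
    rw [Finset.sum_const, Finset.card_range, ← Nat.cast_smul_eq_nsmul ℂ, smul_smul,
      inv_mul_cancel₀ (by exact_mod_cast hn), one_smul]
  rw [h3]
  exact Submodule.smul_mem _ _ (Submodule.sum_mem _ fun i _ => h1 i)

theorem cesaro_of_fixed (S : E →L[ℂ] E) {x : E} (hx : S x = x) {n : ℕ} (hn : n ≠ 0) :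
    (n : ℂ)⁻¹ • ∑ i ∈ Finset.range n, (S ^ i) x = x := by
  have h1 : ∀ i : ℕ, (S ^ i) x = x := fun i => by
    induction i with
    | zero => simp
    | succ i ih => rw [pow_succ, mul_apply_eq_comp, hx, ih]
  simp only [h1]
  rw [Finset.sum_const, Finset.card_range, ← Nat.cast_smul_eq_nsmul ℂ, smul_smul,
    inv_mul_cancel₀ (by exact_mod_cast hn), one_smul]

theorem cesaro_sub_apply (S : E →L[ℂ] E) (x : E) (n : ℕ) :
    (n : ℂ)⁻¹ • ∑ i ∈ Finset.range n, (S ^ i) (x - S x) = (n : ℂ)⁻¹ • (x - (S ^ n) x) := by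
  congr 1
  have h := Finset.sum_range_sub' (fun i => (S ^ i) x) n
  rw [pow_zero, show (1 : E →L[ℂ] E) x = x from rfl] at h
  rw [← h]
  refine Finset.sum_congr rfl fun i _ => ?_
  rw [map_sub, pow_succ]
  rfl

theorem tendsto_cesaro_sub_apply {S : E →L[ℂ] E} {C : ℝ} (hS : ∀ (n : ℕ) (x : E), ‖(S ^ n) x‖ ≤ C
    * ‖x‖)
    (x : E) : Tendsto (fun n : ℕ => (n : ℂ)⁻¹ • ∑ i ∈ Finset.range n, (S ^ i) (x - S x)) atTop
      (𝓝 0) := by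
  simp only [cesaro_sub_apply]
  refine squeeze_zero_norm (a := fun n : ℕ => (n : ℝ)⁻¹ * (‖x‖ + C * ‖x‖)) (fun n => ?_) ?_
  · rw [norm_smul, norm_inv, Complex.norm_natCast]
    gcongr
    exact (norm_sub_le _ _).trans (by gcongr; exact hS n x)
  · simpa using (tendsto_inv_atTop_nhds_zero_nat (𝕜 := ℝ)).mul_const (‖x‖ + C * ‖x‖)

theorem norm_cesaro_le {S : E →L[ℂ] E} {C : ℝ} (hS : ∀ (n : ℕ) (x : E), ‖(S ^ n) x‖ ≤ C * ‖x‖)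
    (x : E) (n : ℕ) : ‖(n : ℂ)⁻¹ • ∑ i ∈ Finset.range n, (S ^ i) x‖ ≤ C * ‖x‖ :=
  (normSeminorm ℂ E).inv_smul_sum_range_le ((norm_nonneg _).trans (hS 0 x)) (fun i => hS i x) n

theorem tendsto_cesaro_of_mem_closure_range {S : E →L[ℂ] E} {C : ℝ}
    (hS : ∀ (n : ℕ) (x : E), ‖(S ^ n) x‖ ≤ C * ‖x‖) {x : E}
    (hx : x ∈ (LinearMap.range (1 - S).toLinearMap).topologicalClosure) :
    Tendsto (fun n : ℕ => (n : ℂ)⁻¹ • ∑ i ∈ Finset.range n, (S ^ i) x) atTop (𝓝 0) := by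
  rw [Metric.tendsto_atTop]
  intro ε hε
  have hx' : x ∈ closure (LinearMap.range (1 - S).toLinearMap : Set E) := hx
  -- No sign is assumed for `C`; `|C| + 1` keeps the denominator positive.
  obtain ⟨_, ⟨y, rfl⟩, hy⟩ := Metric.mem_closure_iff.1 hx' (ε / (2 * (|C| + 1))) (by positivity)
  obtain ⟨N, hN⟩ := Metric.tendsto_atTop.1 (tendsto_cesaro_sub_apply hS y) (ε / 2) (by positivity)
  refine ⟨N, fun n hn => ?_⟩
  have h1 := hN n hn
  rw [dist_zero_right] at h1 ⊢
  have h2 : (n : ℂ)⁻¹ • ∑ i ∈ Finset.range n, (S ^ i) x =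
      (n : ℂ)⁻¹ • ∑ i ∈ Finset.range n, (S ^ i) (x - (y - S y)) +
        (n : ℂ)⁻¹ • ∑ i ∈ Finset.range n, (S ^ i) (y - S y) := by
    rw [← smul_add, ← Finset.sum_add_distrib]
    simp
  rw [h2]
  have h3 := norm_cesaro_le hS (x - (y - S y)) n
  have h4 : ‖x - (y - S y)‖ < ε / (2 * (|C| + 1)) := by
    rw [dist_eq_norm] at hy
    simpa using hy
  have h5 : C * ‖x - (y - S y)‖ ≤ ε / 2 := by
    rw [lt_div_iff₀ (by positivity)] at h4
    have := mul_le_mul_of_nonneg_right (le_abs_self C) (norm_nonneg (x - (y - S y)))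
    nlinarith [norm_nonneg (x - (y - S y))]
  refine (norm_add_le _ _).trans_lt ?_
  linarith

/-- The mean ergodic theorem for power-bounded operators on a Hilbert space. -/
theorem exists_tendsto_cesaro_of_powerBounded {H : Type*} [NormedAddCommGroup H]
    [InnerProductSpace ℂ H] [CompleteSpace H] {S : H →L[ℂ] H} {C : ℝ}
    (hS : ∀ (n : ℕ) (x : H), ‖(S ^ n) x‖ ≤ C * ‖x‖) :
    ∃ P : H →L[ℂ] H, ∀ x, Tendsto (fun n : ℕ => (n : ℂ)⁻¹ • ∑ i ∈ Finset.range n, (S ^ i) x) atTop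
      (𝓝 (P x)) := by
  have key : ∀ x : H, ∃ g : H,
      Tendsto (fun n : ℕ => (n : ℂ)⁻¹ • ∑ i ∈ Finset.range n, (S ^ i) x) atTop (𝓝 g) := by
    intro x
    set y : ℕ → H := fun n => (n : ℂ)⁻¹ • ∑ i ∈ Finset.range n, (S ^ i) x with hy
    -- Banach–Alaoglu gives a weak limit `g` of the bounded means along a free ultrafilter, so
    -- separability plays no role.
    let u : ℕ → WeakDual ℂ H := fun n =>
      StrongDual.toWeakDual (InnerProductSpace.toDual ℂ H (y n))
    obtain ⟨l, -, hl⟩ := (WeakDual.isCompact_closedBall (0 : StrongDual ℂ H)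
      (C * ‖x‖)).ultrafilter_le_nhds' ((hyperfilter ℕ).map u) (by
        refine Ultrafilter.mem_map.2 (Filter.univ_mem' fun n => ?_)
        show InnerProductSpace.toDual ℂ H (y n) ∈ Metric.closedBall 0 (C * ‖x‖)
        rw [mem_closedBall_zero_iff, LinearIsometryEquiv.norm_map]
        exact norm_cesaro_le hS x n)
    set g : H := (InnerProductSpace.toDual ℂ H).symm (WeakDual.toStrongDual l)
    have hg : ∀ z : H, Tendsto (fun n => inner ℂ (y n) z) (hyperfilter ℕ) (𝓝 (inner ℂ g z)) := by
      intro z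
      have h1 : Tendsto u (hyperfilter ℕ) (𝓝 l) := hl
      have h2 := ((WeakDual.eval_continuous z).tendsto l).comp h1
      rw [InnerProductSpace.toDual_symm_apply]
      exact h2
    have hle : (hyperfilter ℕ : Filter ℕ) ≤ atTop := Nat.hyperfilter_le_atTop
    have hdiff : Tendsto (fun n => y n - S (y n)) (hyperfilter ℕ) (𝓝 0) := by
      refine ((tendsto_cesaro_sub_apply hS x).mono_left hle).congr fun n => ?_
      simp only [hy, map_smul, map_sum, map_sub, Finset.sum_sub_distrib, smul_sub]
      congr 2
      refine Finset.sum_congr rfl fun i _ => ?_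
      rw [← mul_apply_eq_comp, ← mul_apply_eq_comp, ← pow_succ, ← pow_succ']
    -- The adjoint moves `S` onto the test vector; since `y n - S (y n)` tends to `0`, both weak
    -- limits agree.
    have hfix : S g = g := by
      refine ext_inner_right ℂ fun z => ?_
      have h1 := hg (ContinuousLinearMap.adjoint S z)
      simp only [ContinuousLinearMap.adjoint_inner_right] at h1
      have h2 : Tendsto (fun n => inner ℂ (y n - S (y n)) z) (hyperfilter ℕ) (𝓝 (inner ℂ 0 z)) :=
        hdiff.inner tendsto_const_nhds
      have h3 := (hg z).sub h2
      simp only [inner_sub_left, sub_sub_cancel, inner_zero_left, sub_zero] at h3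
      exact tendsto_nhds_unique h1 h3
    -- Each `x - y n` with `n ≠ 0` lies in the range, so the weak limit lies in its double
    -- orthogonal complement. Then `x = g + (x - g)`: the means fix the first term and send the
    -- second to `0`.
    have hmem : x - g ∈ (LinearMap.range (1 - S).toLinearMap).topologicalClosure := by
      rw [← Submodule.orthogonal_orthogonal_eq_closure, Submodule.mem_orthogonal']
      intro z hz
      have h1 : Tendsto (fun n => inner ℂ (x - y n) z) (hyperfilter ℕ) (𝓝 (inner ℂ (x - g) z)) := by
        simp only [inner_sub_left]
        exact tendsto_const_nhds.sub (hg z)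
      refine tendsto_nhds_unique h1 (tendsto_const_nhds.congr' ?_)
      filter_upwards [hle (eventually_ne_atTop 0)] with n hn
      exact ((Submodule.mem_orthogonal _ _).1 hz _ (cesaro_mem_range S x hn)).symm
    refine ⟨g, ?_⟩
    have h1 := (tendsto_cesaro_of_mem_closure_range hS hmem).add_const g
    rw [zero_add] at h1
    refine h1.congr' ?_
    filter_upwards [eventually_ne_atTop 0] with n hn
    have h2 := cesaro_of_fixed S hfix hn
    simp only [map_sub, Finset.sum_sub_distrib, smul_sub, h2, hy, sub_add_cancel]
  choose P hP using key
  have hlim : Tendsto (fun (n : ℕ) (x : H) =>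
      ((n : ℂ)⁻¹ • ∑ i ∈ Finset.range n, S ^ i : H →L[ℂ] H) x) atTop (𝓝 P) :=
    tendsto_pi_nhds.2 fun x => by simpa [sum_apply] using hP x
  exact ⟨continuousLinearMapOfTendsto _ hlim, fun x => hP x⟩

end CesaroMeans

/-! ### Iterates and Cesàro means of the composition operator. -/

section Composition

variable {α : Type*} [MeasurableSpace α] {μ : Measure α} {φ : α → α}

theorem PowerMeasureBounded.exists_map_iterate_le (h : PowerMeasureBounded μ φ)
    (hφ : Measurable φ) : ∃ C : ℝ≥0, 1 ≤ C ∧ ∀ n, μ.map φ^[n] ≤ (C : ℝ≥0∞) • μ := by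
  obtain ⟨A, -, hA⟩ := h
  -- The maximum with `1` covers the iterate `n = 0` and supplies the bound `1 ≤ C` that the
  -- dilation estimates need.
  refine ⟨max A 1, le_max_right _ _, fun n => Measure.le_iff.2 fun E hE => ?_⟩
  rw [Measure.map_apply (hφ.iterate n) hE, Measure.smul_apply, smul_eq_mul]
  rcases Nat.eq_zero_or_pos n with rfl | hn
  · simp only [Function.iterate_zero, Set.preimage_id]
    refine le_mul_of_one_le_left bot_le ?_
    exact_mod_cast le_max_right A 1
  · refine (hA n hn E hE).trans ?_
    gcongr
    exact le_max_left _ _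

theorem iterate_compositionOperator_coeFn
    (hq : Measure.QuasiMeasurePreserving φ μ μ) (n : ℕ) (f : α →ₘ[μ] ℂ) :
    ((compositionOperator hq)^[n] f : α → ℂ) =ᵐ[μ] f ∘ φ^[n] := by
  induction n with
  | zero => simp
  | succ n ih =>
    rw [Function.iterate_succ_apply', Function.iterate_succ]
    exact (AEEqFun.coeFn_compQuasiMeasurePreserving _ hq).trans (hq.ae_eq_comp ih)

variable {C : ℝ≥0}

theorem measure_iterate_lt_le (hC : ∀ n, μ.map φ^[n] ≤ (C : ℝ≥0∞) • μ) (hφ : Measurable φ)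
    (g : α → ℝ≥0∞) (n : ℕ) (s : ℝ≥0) :
    μ {x | (s : ℝ≥0∞) < g (φ^[n] x)} ≤ C * μ {x | (s : ℝ≥0∞) < g x} := by
  have h1 := (hC n) {x | (s : ℝ≥0∞) < g x}
  exact (Measure.le_map_apply (hφ.iterate n).aemeasurable _).trans h1

theorem lintegral_iterate_le (hC : ∀ n, μ.map φ^[n] ≤ (C : ℝ≥0∞) • μ) (hφ : Measurable φ)
    {g : α → ℝ≥0∞} (hg : AEMeasurable g μ) (n : ℕ) :
    ∫⁻ x, g (φ^[n] x) ∂μ ≤ C * ∫⁻ x, g x ∂μ := by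
  have habs : μ.map φ^[n] ≪ μ := Measure.absolutelyContinuous_of_le_smul (hC n)
  rw [← lintegral_map' (hg.mono_ac habs) (hφ.iterate n).aemeasurable]
  refine (lintegral_mono' (hC n) le_rfl).trans ?_
  rw [lintegral_smul_measure, smul_eq_mul]

/-- The Cesàro means of the composition operator on classes of measurable functions. -/
def compositionCesaro (hq : Measure.QuasiMeasurePreserving φ μ μ) (n : ℕ) (f : α →ₘ[μ] ℂ) :
    α →ₘ[μ] ℂ :=
  (n : ℂ)⁻¹ • ∑ i ∈ Finset.range n, (compositionOperator hq)^[i] f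

theorem AEEqFun.coeFn_finset_sum {ι : Type*} (s : Finset ι) (f : ι → α →ₘ[μ] ℂ) :
    (∑ i ∈ s, f i : α →ₘ[μ] ℂ) =ᵐ[μ] fun x => ∑ i ∈ s, f i x := by
  classical
  induction s using Finset.induction_on with
  | empty => simpa using AEEqFun.coeFn_zero.trans (by rfl)
  | insert a s ha ih =>
    rw [Finset.sum_insert ha]
    filter_upwards [AEEqFun.coeFn_add (f a) (∑ i ∈ s, f i), ih] with x h1 h2
    rw [h1, Pi.add_apply, h2, Finset.sum_insert ha]

theorem compositionCesaro_coeFn (hq : Measure.QuasiMeasurePreserving φ μ μ) (n : ℕ)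
    (f : α →ₘ[μ] ℂ) : compositionCesaro hq n f =ᵐ[μ]
      fun x => (n : ℂ)⁻¹ * ∑ i ∈ Finset.range n, f (φ^[i] x) := by
  filter_upwards [AEEqFun.coeFn_smul (n : ℂ)⁻¹ (∑ i ∈ Finset.range n, (compositionOperator hq)^[i]
    f),
    AEEqFun.coeFn_finset_sum (Finset.range n) (fun i => (compositionOperator hq)^[i] f),
    ae_all_iff.2 fun i => iterate_compositionOperator_coeFn hq i f] with x h1 h2 h3
  rw [compositionCesaro, h1, Pi.smul_apply, h2, smul_eq_mul]
  simp [h3]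

theorem compositionCesaro_ae_le (hC : ∀ n, μ.map φ^[n] ≤ (C : ℝ≥0∞) • μ) (hφ : Measurable φ)
    (hq : Measure.QuasiMeasurePreserving φ μ μ) (n : ℕ)
    {f : α →ₘ[μ] ℂ} {M : ℝ≥0} (hM : ∀ᵐ x ∂μ, ‖f x‖ₑ ≤ M) :
    ∀ᵐ x ∂μ, ‖compositionCesaro hq n f x‖ₑ ≤ M := by
  have h1 : ∀ i, ∀ᵐ x ∂μ, ‖f (φ^[i] x)‖ₑ ≤ M := fun i =>
    (Measure.QuasiMeasurePreserving.mk (hφ.iterate i)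
      (Measure.absolutelyContinuous_of_le_smul (hC i))).ae hM
  filter_upwards [compositionCesaro_coeFn hq n f, ae_all_iff.2 h1] with x hx h2
  rw [hx, enorm_le_coe]
  exact (normSeminorm ℂ ℂ).inv_smul_sum_range_le M.2
    (fun i => by
      have := h2 i
      rw [enorm_le_coe] at this
      exact_mod_cast this) n

theorem lintegral_compositionCesaro_le (hC : ∀ n, μ.map φ^[n] ≤ (C : ℝ≥0∞) • μ)
    (hφ : Measurable φ) (hq : Measure.QuasiMeasurePreserving φ μ μ) (n : ℕ) (f : α →ₘ[μ] ℂ) :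
    ∫⁻ x, ‖compositionCesaro hq n f x‖ₑ ∂μ ≤ C * ∫⁻ x, ‖f x‖ₑ ∂μ := by
  have hm := BanachFunctionNorm.aemeasurable_enorm f
  have hmi : ∀ i, AEMeasurable (fun x => ‖f (φ^[i] x)‖ₑ) μ := fun i =>
    (hm.mono_ac (Measure.absolutelyContinuous_of_le_smul (hC i))).comp_aemeasurable
      (hφ.iterate i).aemeasurable
  rcases Nat.eq_zero_or_pos n with rfl | hn
  · rw [lintegral_congr_ae (g := fun _ => 0)]
    · simp
    filter_upwards [compositionCesaro_coeFn hq 0 f] with x hx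
    simp [hx]
  have hn0 : (n : ℝ≥0∞) ≠ 0 := by exact_mod_cast hn.ne'
  calc ∫⁻ x, ‖compositionCesaro hq n f x‖ₑ ∂μ
      ≤ ∫⁻ x, (n : ℝ≥0∞)⁻¹ * ∑ i ∈ Finset.range n, ‖f (φ^[i] x)‖ₑ ∂μ := by
        refine lintegral_mono_ae ?_
        filter_upwards [compositionCesaro_coeFn hq n f] with x hx
        rw [hx, enorm_mul, enorm_inv (by exact_mod_cast hn.ne')]
        gcongr
        · rw [← ofReal_norm, Complex.norm_natCast, ENNReal.ofReal_natCast]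
        · exact enorm_sum_le _ _
    _ = (n : ℝ≥0∞)⁻¹ * ∑ i ∈ Finset.range n, ∫⁻ x, ‖f (φ^[i] x)‖ₑ ∂μ := by
        rw [lintegral_const_mul' _ _ (by simpa using hn0), lintegral_finsetSum' _ fun i _ => hmi i]
    _ ≤ (n : ℝ≥0∞)⁻¹ * ∑ i ∈ Finset.range n, (C * ∫⁻ x, ‖f x‖ₑ ∂μ) := by
        gcongr with i
        exact lintegral_iterate_le hC hφ hm i
    _ = C * ∫⁻ x, ‖f x‖ₑ ∂μ := by
        rw [Finset.sum_const, Finset.card_range, nsmul_eq_mul, ← mul_assoc,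
          ENNReal.inv_mul_cancel hn0 (by simp), one_mul]

theorem eLpNorm_iterate_compositionOperator_le (hC : ∀ n, μ.map φ^[n] ≤ (C : ℝ≥0∞) • μ)
    (hφ : Measurable φ) (hq : Measure.QuasiMeasurePreserving φ μ μ) (n : ℕ) (f : α →ₘ[μ] ℂ) :
    eLpNorm ((compositionOperator hq)^[n] f) 2 μ ≤ (C : ℝ≥0∞) ^ (1 / 2 : ℝ) * eLpNorm f 2 μ := by
  rw [eLpNorm_congr_ae (iterate_compositionOperator_coeFn hq n f),
    ← eLpNorm_map_measure (f.aestronglyMeasurable.mono_ac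
      (Measure.absolutelyContinuous_of_le_smul (hC n))) (hφ.iterate n).aemeasurable]
  refine (eLpNorm_mono_measure _ (hC n)).trans ?_
  rw [eLpNorm_smul_measure_of_ne_top (by simp)]
  simp

/-- The Cesàro means of a composition operator converge in `L²`. -/
theorem exists_tendsto_compositionCesaro_L2 (hC : ∀ n, μ.map φ^[n] ≤ (C : ℝ≥0∞) • μ)
    (hφ : Measurable φ) (hq : Measure.QuasiMeasurePreserving φ μ μ) :
    ∃ P : Lp ℂ 2 μ →L[ℂ] Lp ℂ 2 μ, ∀ f : Lp ℂ 2 μ, ∃ F : ℕ → Lp ℂ 2 μ,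
      (∀ n, (F n : α →ₘ[μ] ℂ) = compositionCesaro hq n f) ∧ Tendsto F atTop (𝓝 (P f)) := by
  have hmem : ∀ (n : ℕ) (f : Lp ℂ 2 μ), (compositionOperator hq)^[n] f.1 ∈ Lp ℂ 2 μ := fun n f => by
    rw [Lp.mem_Lp_iff_eLpNorm_lt_top]
    refine (eLpNorm_iterate_compositionOperator_le hC hφ hq n f.1).trans_lt ?_
    exact ENNReal.mul_lt_top (ENNReal.rpow_lt_top_of_nonneg (by norm_num) (by simp))
      (Lp.eLpNorm_lt_top f)
  have hnorm : ∀ (n : ℕ) (f : Lp ℂ 2 μ), ‖(⟨_, hmem n f⟩ : Lp ℂ 2 μ)‖ ≤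
      ((C : ℝ≥0∞) ^ (1 / 2 : ℝ)).toReal * ‖f‖ := fun n f => by
    rw [Lp.norm_def, Lp.norm_def, ← ENNReal.toReal_mul]
    exact ENNReal.toReal_mono (ENNReal.mul_lt_top
      (ENNReal.rpow_lt_top_of_nonneg (by norm_num) (by simp)) (Lp.eLpNorm_lt_top f)).ne
      (eLpNorm_iterate_compositionOperator_le hC hφ hq n f.1)
  have hadd : ∀ f g : α →ₘ[μ] ℂ, compositionOperator hq (f + g) =
      compositionOperator hq f + compositionOperator hq g := fun f g => by
    induction f using AEEqFun.induction_on
    induction g using AEEqFun.induction_on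
    rfl
  have hsmul : ∀ (c : ℂ) (f : α →ₘ[μ] ℂ), compositionOperator hq (c • f) =
      c • compositionOperator hq f := fun c f => by
    induction f using AEEqFun.induction_on
    rfl
  let S₀ : Lp ℂ 2 μ →ₗ[ℂ] Lp ℂ 2 μ :=
    { toFun := fun f => ⟨compositionOperator hq f.1, hmem 1 f⟩
      map_add' := fun f g => Subtype.ext (hadd f.1 g.1)
      map_smul' := fun c f => Subtype.ext (hsmul c f.1) }
  let S : Lp ℂ 2 μ →L[ℂ] Lp ℂ 2 μ := S₀.mkContinuous _ fun f => hnorm 1 f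
  have hpow : ∀ (n : ℕ) (f : Lp ℂ 2 μ), (S ^ n) f = ⟨_, hmem n f⟩ := fun n f => by
    induction n with
    | zero => rfl
    | succ n ih =>
      rw [pow_succ', mul_apply_eq_comp, ih]
      exact Subtype.ext (Function.iterate_succ_apply' _ _ _).symm
  obtain ⟨P, hP⟩ := exists_tendsto_cesaro_of_powerBounded (S := S)
    (fun n x => by rw [hpow]; exact hnorm n x)
  refine ⟨P, fun f => ⟨_, fun n => ?_, hP f⟩⟩
  simp only [hpow]
  change (n : ℂ)⁻¹ • ((∑ i ∈ Finset.range n, (⟨_, hmem i f⟩ : Lp ℂ 2 μ) : Lp ℂ 2 μ) : α →ₘ[μ] ℂ) = _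
  rw [AddSubgroup.val_finsetSum]
  rfl

end Composition
-- Topologies generated by families of seminorms.
section Seminorms

variable {E ι : Type*} [AddCommGroup E] [Module ℂ E]

/-- A ball of a finite supremum of seminorms is a finite intersection of balls, so openness of the
single balls suffices. This links a subbasis of balls with the usual locally convex topology. -/
theorem le_moduleFilterBasis_topology [Nonempty ι] (p : SeminormFamily ℂ E ι) {τ :
    TopologicalSpace E}
    (h : ∀ (i : ι) (x : E) (r : ℝ), 0 < r → IsOpen[τ] ((p i).ball x r)) :
    τ ≤ p.moduleFilterBasis.topology := by
  intro U hU
  let τ₀ : TopologicalSpace E := p.moduleFilterBasis.topology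
  have hp : WithSeminorms p := ⟨rfl⟩
  have h1 := (hp.isOpen_iff_mem_balls U).1 hU
  refine (@isOpen_iff_forall_mem_open E τ U).2 fun x hx => ?_
  obtain ⟨s, r, hr, hs⟩ := h1 x hx
  refine ⟨_, hs, ?_, Seminorm.mem_ball_self _ hr⟩
  rw [Seminorm.ball_finset_sup_eq_iInter _ _ _ hr]
  exact @isOpen_biInter_finset _ _ τ _ _ fun i _ => h i x r hr

theorem isOpen_seminorm_ball [TopologicalSpace E] {p : SeminormFamily ℂ E ι} (hp : WithSeminorms p)
    (i : ι) (x : E) (r : ℝ) : IsOpen ((p i).ball x r) := by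
  have := hp.topologicalAddGroup
  exact isOpen_lt ((hp.continuous_seminorm i).comp (continuous_id.sub continuous_const))
    continuous_const

theorem WithSeminorms.tendsto_nhds_iff [TopologicalSpace E] {p : SeminormFamily ℂ E ι}
    (hp : WithSeminorms p) {β : Type*} {l : Filter β} (u : β → E) (x : E) :
    Tendsto u l (𝓝 x) ↔ ∀ i, Tendsto (fun b => p i (u b - x)) l (𝓝 0) := by
  rw [hp.tendsto_nhds]
  refine forall_congr' fun i => ?_
  rw [Metric.tendsto_nhds]
  simp [abs_of_nonneg (apply_nonneg (p i) _)]

theorem WithSeminorms.topology_properties [Module ℝ E] [IsScalarTower ℝ ℂ E]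
    {p : SeminormFamily ℂ E ι} [TopologicalSpace E] (hp : WithSeminorms p)
    (hsep : ∀ x, (∀ i, p i x = 0) → x = 0) : IsTopologicalAddGroup E ∧ ContinuousSMul ℂ E ∧
      LocallyConvexSpace ℝ E ∧ T2Space E := by
  have h := hp.topologicalAddGroup
  have h1 : T1Space E := hp.T1_of_separating fun x hx => by
    by_contra! h2
    exact hx (hsep x h2)
  exact ⟨h, hp.continuousSMul, hp.toLocallyConvexSpace, inferInstance⟩

end Seminorms

/-! ### The topology `ξ`. -/

namespace BanachFunctionNorm

variable {α : Type*} [MeasurableSpace α] {μ : Measure α}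

theorem _root_.IsResonant.rearrangementPairing_smul (hres : IsResonant μ) (ψ f : α →ₘ[μ] ℂ)
    (c : ℂ) :
    rearrangementPairing ψ (c • f) = ‖c‖ₑ * rearrangementPairing ψ f := by
  have h1 := hres.rearrangementLIntegral_const_mul ‖c‖ₑ (aemeasurable_enorm f)
    (aemeasurable_enorm ψ)
  have h2 : (fun x => ‖(c • f) x‖ₑ) =ᵐ[μ] fun x => ‖c‖ₑ * ‖f x‖ₑ := by
    filter_upwards [AEEqFun.coeFn_smul c f] with x hx
    rw [hx, Pi.smul_apply, enorm_smul]
  rw [← rearrangementLIntegral_congr h2, rearrangementLIntegral_comm,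
    rearrangementLIntegral_comm (fun x => ‖f x‖ₑ)] at h1
  exact h1

theorem _root_.IsResonant.rearrangementPairing_add_le (hres : IsResonant μ) (ψ f g : α →ₘ[μ] ℂ) :
    rearrangementPairing ψ (f + g) ≤ rearrangementPairing ψ f + rearrangementPairing ψ g := by
  have h1 := hres.rearrangementLIntegral_add_le (aemeasurable_enorm f) (aemeasurable_enorm g)
    (aemeasurable_enorm ψ)
  have h2 : (fun x => ‖(f + g) x‖ₑ) ≤ᵐ[μ] fun x => ‖f x‖ₑ + ‖g x‖ₑ := by
    filter_upwards [AEEqFun.coeFn_add f g] with x hx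
    rw [hx, Pi.add_apply]
    exact enorm_add_le _ _
  have h3 := (rearrangementLIntegral_mono h2 _).trans h1
  rw [rearrangementLIntegral_comm, rearrangementLIntegral_comm (fun x => ‖f x‖ₑ),
    rearrangementLIntegral_comm (fun x => ‖g x‖ₑ)] at h3
  exact h3

theorem lintegral_mul_le_pairing (ψ f : α →ₘ[μ] ℂ) (hres : IsResonant μ) :
    ∫⁻ x, ‖ψ x * f x‖ₑ ∂μ ≤ rearrangementPairing ψ f := by
  simp only [enorm_mul]
  exact hres.lintegral_mul_le (aemeasurable_enorm ψ) (aemeasurable_enorm f)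

variable [SigmaFinite μ]

theorem ae_lt_top (ρ : BanachFunctionNorm μ) {g : α → ℝ≥0∞} (hg : AEMeasurable g μ)
    (h : ρ.toFun g < ∞) : ∀ᵐ x ∂μ, g x < ∞ := by
  have h1 : ∀ n, ∀ᵐ x ∂μ.restrict (spanningSets μ n), g x < ∞ := fun n => by
    obtain ⟨C, hC⟩ := ρ.lintegral_le' _ (measurableSet_spanningSets μ n)
      (measure_spanningSets_lt_top μ n)
    exact ae_lt_top' hg.restrict ((hC g hg).trans_lt (ENNReal.mul_lt_top (by simp) h)).ne
  have h2 := (ae_restrict_iUnion_iff (μ := μ) (spanningSets μ) (fun x => g x < ∞)).2 h1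
  rwa [iUnion_spanningSets, Measure.restrict_univ] at h2

/-- Every function of finite norm is the modulus of an element of the space. -/
theorem exists_enorm_eq (ρ : BanachFunctionNorm μ) {g : α → ℝ≥0∞} (hg : AEMeasurable g μ)
    (h : ρ.toFun g < ∞) : ∃ G : ρ.space, (fun x => ‖G.1 x‖ₑ) =ᵐ[μ] g := by
  have hm : AEStronglyMeasurable (fun x => ((g x).toReal : ℂ)) μ :=
    (Complex.measurable_ofReal.comp_aemeasurable hg.ennreal_toReal).aestronglyMeasurable
  have hae : (fun x => ‖AEEqFun.mk _ hm x‖ₑ) =ᵐ[μ] g := by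
    filter_upwards [AEEqFun.coeFn_mk _ hm, ρ.ae_lt_top hg h] with x hx hx'
    rw [hx, ← ofReal_norm, Complex.norm_real, Real.norm_of_nonneg ENNReal.toReal_nonneg,
      ENNReal.ofReal_toReal hx'.ne]
  exact ⟨⟨AEEqFun.mk _ hm, (ρ.toFun_congr (aemeasurable_enorm _) hae).trans_lt h⟩, hae⟩

theorem rearrangementPairing_le (hres : IsResonant μ) (ρ : BanachFunctionNorm μ)
    (hri : ρ.IsRearrangementInvariant) (ψ : ρ.associate.space) (f : ρ.space) :
    rearrangementPairing ψ.1 f.1 ≤ ρ.associate.eval ψ.1 * ρ.eval f.1 := by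
  have := ρ.rearrangementLIntegral_le hres hri (aemeasurable_enorm f.1) (aemeasurable_enorm ψ.1) f.2
  rw [rearrangementLIntegral_comm] at this
  exact this

theorem rearrangementPairing_ne_top (hres : IsResonant μ) (ρ : BanachFunctionNorm μ)
    (hri : ρ.IsRearrangementInvariant) (ψ : ρ.associate.space) (f : ρ.space) :
    rearrangementPairing ψ.1 f.1 ≠ ∞ :=
  ((rearrangementPairing_le hres ρ hri ψ f).trans_lt (ENNReal.mul_lt_top ψ.2 f.2)).ne

/-- The seminorms `|·|_ψ` that generate the topology `ξ`. -/
def pairingSeminorm (hres : IsResonant μ) (ρ : BanachFunctionNorm μ)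
    (hri : ρ.IsRearrangementInvariant) : SeminormFamily ℂ ρ.space ρ.associate.space := fun ψ =>
  Seminorm.of (fun f => (rearrangementPairing ψ.1 f.1).toReal)
    (fun f g => by
      have hf := rearrangementPairing_ne_top hres ρ hri ψ f
      have hg := rearrangementPairing_ne_top hres ρ hri ψ g
      rw [← ENNReal.toReal_add hf hg]
      exact ENNReal.toReal_mono (ENNReal.add_ne_top.2 ⟨hf, hg⟩)
        (hres.rearrangementPairing_add_le ψ.1 f.1 g.1))
    (fun c f => by
      rw [Submodule.coe_smul, hres.rearrangementPairing_smul, ENNReal.toReal_mul, toReal_enorm])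

variable (hres : IsResonant μ) (ρ : BanachFunctionNorm μ) (hri : ρ.IsRearrangementInvariant)

theorem ofReal_pairingSeminorm (ψ : ρ.associate.space) (f : ρ.space) :
    ENNReal.ofReal (ρ.pairingSeminorm hres hri ψ f) = rearrangementPairing ψ.1 f.1 :=
  ENNReal.ofReal_toReal (rearrangementPairing_ne_top hres ρ hri ψ f)

theorem pairingSeminorm_le (ψ : ρ.associate.space) (f : ρ.space) :
    ρ.pairingSeminorm hres hri ψ f ≤ ‖ψ‖ * ‖f‖ := by
  rw [norm_def, norm_def, ← ENNReal.toReal_mul]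
  exact ENNReal.toReal_mono (ENNReal.mul_lt_top ψ.2 f.2).ne (rearrangementPairing_le hres ρ hri ψ f)

/-- Both topologies are generated by the same balls, with all centres allowed. A ball of radius `∞`
is the whole space because the pairings are finite. -/
theorem withSeminorms_xi :
    @WithSeminorms ℂ ρ.space ρ.associate.space _ _ _ (ρ.pairingSeminorm hres hri) ρ.xi := by
  refine @WithSeminorms.mk ℂ ρ.space ρ.associate.space _ _ _ (ρ.pairingSeminorm hres hri) ρ.xi ?_
  have hball : ∀ (ψ : ρ.associate.space) (f : ρ.space) (ε : ℝ), 0 < ε →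
      {g : ρ.space | rearrangementPairing ψ.1 (g - f).1 < ENNReal.ofReal ε} =
        (ρ.pairingSeminorm hres hri ψ).ball f ε := fun ψ f ε hε => by
    ext g
    rw [Seminorm.mem_ball, ← ENNReal.ofReal_lt_ofReal_iff hε, ofReal_pairingSeminorm]
    rfl
  refine le_antisymm (le_moduleFilterBasis_topology _ fun ψ f r hr => ?_) ?_
  · refine TopologicalSpace.isOpen_generateFrom_of_mem
      ⟨ψ, f, ENNReal.ofReal r, by simpa using hr, ?_⟩
    exact (hball ψ f r hr).symm
  · let τ₀ : TopologicalSpace ρ.space :=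
      (ρ.pairingSeminorm hres hri).moduleFilterBasis.topology
    have hp : WithSeminorms (ρ.pairingSeminorm hres hri) := ⟨rfl⟩
    refine le_generateFrom ?_
    rintro U ⟨ψ, f, ε, hε, rfl⟩
    rcases eq_or_ne ε ∞ with rfl | hε'
    · convert isOpen_univ (X := ρ.space)
      ext g
      simpa [lt_top_iff_ne_top] using rearrangementPairing_ne_top hres ρ hri ψ (g - f)
    · have h1 := hball ψ f ε.toReal (ENNReal.toReal_pos hε.ne' hε')
      rw [ENNReal.ofReal_toReal hε'] at h1
      rw [h1]
      exact isOpen_seminorm_ball hp ψ f _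

theorem tendsto_xi_iff {β : Type*} {l : Filter β} (u : β → ρ.space) (f : ρ.space) :
    Tendsto u l (@nhds _ ρ.xi f) ↔
      ∀ ψ, Tendsto (fun b => ρ.pairingSeminorm hres hri ψ (u b - f)) l (𝓝 0) :=
  @WithSeminorms.tendsto_nhds_iff ρ.space ρ.associate.space _ _ ρ.xi _
    (ρ.withSeminorms_xi hres hri) β l u f

include hres hri in
theorem integrable_mul (ψ : ρ.associate.space) (f : ρ.space) :
    Integrable (fun x => ψ.1 x * f.1 x) μ :=
  ⟨ψ.1.aestronglyMeasurable.mul f.1.aestronglyMeasurable,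
    (lintegral_mul_le_pairing ψ.1 f.1 hres).trans_lt
      (rearrangementPairing_ne_top hres ρ hri ψ f).lt_top⟩

theorem norm_integral_mul_le (ψ : ρ.associate.space) (f : ρ.space) :
    ‖∫ x, ψ.1 x * f.1 x ∂μ‖ ≤ ρ.pairingSeminorm hres hri ψ f := by
  have h1 := enorm_integral_le_lintegral_enorm (μ := μ) fun x => ψ.1 x * f.1 x
  have h2 := h1.trans (lintegral_mul_le_pairing ψ.1 f.1 hres)
  rw [← ofReal_pairingSeminorm hres ρ hri, ← ofReal_norm] at h2
  exact (ENNReal.ofReal_le_ofReal_iff (apply_nonneg _ _)).1 h2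

include hres hri in
theorem integral_mul_sub (ψ : ρ.associate.space) (f g : ρ.space) :
    ∫ x, ψ.1 x * (f - g).1 x ∂μ = ∫ x, ψ.1 x * f.1 x ∂μ - ∫ x, ψ.1 x * g.1 x ∂μ := by
  rw [← integral_sub (ρ.integrable_mul hres hri ψ f) (ρ.integrable_mul hres hri ψ g)]
  refine integral_congr_ae ?_
  filter_upwards [AEEqFun.coeFn_sub f.1 g.1] with x hx
  rw [Submodule.coe_sub, hx, Pi.sub_apply, mul_sub]

/-- If all `ψ` in the unit ball of the associate space pair small with `f`, then `f` is small. -/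
theorem toFun_le_of_forall_pairing_le {f : α → ℝ≥0∞} (hf : AEMeasurable f μ) {c : ℝ≥0∞}
    (h : ∀ ψ : ρ.associate.space, ∫⁻ x, f x * ‖ψ.1 x‖ₑ ∂μ ≤ c * ρ.associate.eval ψ.1) :
    ρ.toFun f ≤ c := by
  refine ρ.toFun_le_of_forall_lintegral_mul_le hf fun g hg hg' => ?_
  obtain ⟨G, hG⟩ := ρ.associate.exists_enorm_eq hg hg'
  have h1 := h G
  rw [eval, ρ.associate.toFun_congr (aemeasurable_enorm _) hG] at h1
  refine le_trans (le_of_eq (lintegral_congr_ae ?_)) h1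
  filter_upwards [hG] with x hx
  rw [← hx]

/-- The pairing dominates the integral of `|f ψ|`, so all these integrals vanish and
Lorentz–Luxemburg forces norm `0`. -/
theorem eq_zero_of_pairingSeminorm {f : ρ.space}
    (h : ∀ ψ, ρ.pairingSeminorm hres hri ψ f = 0) : f = 0 := by
  have h1 : ρ.eval f.1 ≤ 0 := by
    refine ρ.toFun_le_of_forall_pairing_le (aemeasurable_enorm f.1) fun ψ => ?_
    have h2 := lintegral_mul_le_pairing ψ.1 f.1 hres
    rw [← ofReal_pairingSeminorm hres ρ hri, h ψ, ENNReal.ofReal_zero] at h2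
    rw [zero_mul]
    simpa only [enorm_mul, mul_comm] using h2
  rw [← norm_eq_zero, norm_def, le_antisymm h1 bot_le, ENNReal.toReal_zero]

theorem eq_of_forall_pairing {f g : ρ.space}
    (h : ∀ ψ, ρ.pairingSeminorm hres hri ψ (f - g) = 0) : f = g :=
  sub_eq_zero.1 (ρ.eq_zero_of_pairingSeminorm hres hri h)

include hres hri in
theorem topology_le_xi : (inferInstance : TopologicalSpace ρ.space) ≤ ρ.xi := by
  refine continuous_id_iff_le.1 ((@continuous_iff_continuousAt _ _ _ ρ.xi _).2 fun f => ?_)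
  refine (ρ.tendsto_xi_iff hres hri _ _).2 fun ψ => ?_
  refine squeeze_zero (fun _ => apply_nonneg _ _) (fun g => ρ.pairingSeminorm_le hres hri ψ (g -
    f)) ?_
  have : Tendsto (fun g : ρ.space => ‖ψ‖ * ‖g - f‖) (𝓝 f) (𝓝 (‖ψ‖ * ‖f - f‖)) :=
    Continuous.tendsto (by fun_prop) f
  simpa using this

include hres hri in
theorem xi_le_weakAssociate : ρ.xi ≤ ρ.weakAssociate := by
  refine le_iInf fun ψ => ?_
  rw [← continuous_iff_le_induced]
  refine (@continuous_iff_continuousAt _ _ ρ.xi _ _).2 fun f => ?_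
  refine (tendsto_iff_norm_sub_tendsto_zero (a := @nhds _ ρ.xi f)).2 ?_
  refine squeeze_zero (fun _ => norm_nonneg _) (fun g => ?_)
    ((ρ.tendsto_xi_iff hres hri id f).1 tendsto_id ψ)
  rw [← ρ.integral_mul_sub hres hri]
  exact ρ.norm_integral_mul_le hres hri ψ (g - f)

include hres hri in
theorem xi_properties : @IsTopologicalAddGroup ρ.space ρ.xi _ ∧ @ContinuousSMul ℂ ρ.space _ _ ρ.xi ∧
    @LocallyConvexSpace ℝ ρ.space _ _ _ _ ρ.xi ∧ @T2Space ρ.space ρ.xi :=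
  @WithSeminorms.topology_properties ρ.space ρ.associate.space _ _ _ _ _ ρ.xi
    (ρ.withSeminorms_xi hres hri) fun _ => ρ.eq_zero_of_pairingSeminorm hres hri

theorem continuous_xi_of_pairingSeminorm_le (T : ρ.space →ₗ[ℂ] ρ.space) {C : ℝ}
    (h : ∀ ψ f, ρ.pairingSeminorm hres hri ψ (T f) ≤ C * ρ.pairingSeminorm hres hri ψ f) :
    Continuous[ρ.xi, ρ.xi] T := by
  refine (@continuous_iff_continuousAt _ _ ρ.xi ρ.xi _).2 fun f => ?_
  refine (ρ.tendsto_xi_iff hres hri T (T f)).2 fun ψ => ?_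
  refine squeeze_zero (fun _ => apply_nonneg _ _) (fun g => ?_)
    (by simpa using ((ρ.tendsto_xi_iff hres hri id f).1 tendsto_id ψ).const_mul C)
  rw [← map_sub]
  exact h ψ (g - f)

end BanachFunctionNorm
-- Bounded integrable functions and completeness of bounded sets for `ξ`.
namespace BanachFunctionNorm

variable {α : Type*} [MeasurableSpace α] {μ : Measure α}

theorem norm_le_of_ae_le (ρ : BanachFunctionNorm μ) {f g : ρ.space}
    (h : (fun x => ‖f.1 x‖ₑ) ≤ᵐ[μ] fun x => ‖g.1 x‖ₑ) :
    ‖f‖ ≤ ‖g‖ :=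
  ENNReal.toReal_mono g.2.ne (ρ.mono' _ _ (aemeasurable_enorm _) (aemeasurable_enorm _) h)

/-- Bounded integrable functions. -/
def IsBoundedIntegrable (f : α →ₘ[μ] ℂ) : Prop :=
  ∃ M : ℝ≥0, (∀ᵐ x ∂μ, ‖f x‖ₑ ≤ M) ∧ ∫⁻ x, ‖f x‖ₑ ∂μ < ∞

theorem IsBoundedIntegrable.mem_Lp_two {f : α →ₘ[μ] ℂ} (hf : IsBoundedIntegrable f) :
    f ∈ Lp ℂ 2 μ := by
  obtain ⟨M, hM, hint⟩ := hf
  rw [Lp.mem_Lp_iff_eLpNorm_lt_top,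
    eLpNorm_lt_top_iff_lintegral_rpow_enorm_lt_top (by simp) (by simp)]
  refine lt_of_le_of_lt (b := ∫⁻ x, M * ‖f x‖ₑ ∂μ) (lintegral_mono_ae ?_) ?_
  · filter_upwards [hM] with x hx
    rw [ENNReal.toReal_ofNat, ENNReal.rpow_two, pow_two]
    gcongr
  · rw [lintegral_const_mul' _ _ (by simp)]
    exact ENNReal.mul_lt_top (by simp) hint

/-- The level sets decrease to the empty set because `f` is finite-valued, and (ACR) makes the one
at level `1` of finite measure. -/
theorem HasACR.tendsto_measure_lt {ρ : BanachFunctionNorm μ} (hACR : ρ.HasACR) (f : ρ.space) :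
    Tendsto (fun n : ℕ => μ {x | (n : ℝ≥0∞) < ‖f.1 x‖ₑ}) atTop (𝓝 0) := by
  have hfm : Measurable fun x => ‖f.1 x‖ₑ := f.1.stronglyMeasurable.measurable.enorm
  obtain ⟨t, ht⟩ := ((hACR f).eventually (gt_mem_nhds (show (0 : ℝ≥0∞) < 1 by simp))).exists
  have h1 : μ (⋂ n : ℕ, {x | (n : ℝ≥0∞) < ‖f.1 x‖ₑ}) = 0 := by
    convert measure_empty (μ := μ)
    ext x
    simp only [Set.mem_iInter, Set.mem_empty_iff_false, iff_false, not_forall]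
    obtain ⟨n, hn⟩ := ENNReal.exists_nat_gt (enorm_ne_top (x := f.1 x))
    exact ⟨n, not_lt.2 hn.le⟩
  rw [← h1]
  refine tendsto_measure_iInter_atTop (fun n => (measurableSet_lt measurable_const
    hfm).nullMeasurableSet) (fun m n hmn x hx => ?_) ⟨1, ?_⟩
  · have hmn' : (m : ℝ≥0∞) ≤ n := by exact_mod_cast hmn
    exact hmn'.trans_lt hx
  · have := measure_le_of_rearrangement_lt ht
    exact (lt_of_le_of_lt (by simpa using this) ENNReal.ofReal_lt_top).ne

theorem HasACR.rearrangement_lt_top {ρ : BanachFunctionNorm μ} (hACR : ρ.HasACR) (f : ρ.space)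
    {t : ℝ} (ht : 0 < t) : rearrangement μ (fun x => ‖f.1 x‖ₑ) t < ∞ := by
  obtain ⟨n, hn⟩ := (ENNReal.tendsto_nhds_zero.1 (hACR.tendsto_measure_lt f) (ENNReal.ofReal t)
    (by simpa using ht)).exists
  exact (rearrangement_le_of_measure_le (s := n) (by simpa using hn)).trans_lt (by simp)

variable [SigmaFinite μ]
variable (hres : IsResonant μ) (ρ : BanachFunctionNorm μ) (hri : ρ.IsRearrangementInvariant)

theorem pairingSeminorm_le_of_ae_le (ψ : ρ.associate.space) {f g : ρ.space}
    (h : (fun x => ‖f.1 x‖ₑ) ≤ᵐ[μ] fun x => ‖g.1 x‖ₑ) :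
    ρ.pairingSeminorm hres hri ψ f ≤ ρ.pairingSeminorm hres hri ψ g := by
  refine ENNReal.toReal_mono (rearrangementPairing_ne_top hres ρ hri ψ g) ?_
  have := rearrangementLIntegral_mono h fun x => ‖ψ.1 x‖ₑ
  rw [rearrangementLIntegral_comm, rearrangementLIntegral_comm (fun x => ‖g.1 x‖ₑ)] at this
  exact this

theorem eq_of_tendsto_pairingSeminorm {u : ℕ → ρ.space} {f g : ρ.space}
    (hf : ∀ ψ, Tendsto (fun n => ρ.pairingSeminorm hres hri ψ (u n - f)) atTop (𝓝 0))
    (hg : ∀ ψ, Tendsto (fun n => ρ.pairingSeminorm hres hri ψ (u n - g)) atTop (𝓝 0)) : f = g := by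
  refine ρ.eq_of_forall_pairing hres hri fun ψ => le_antisymm ?_ (apply_nonneg _ _)
  have h1 := (hf ψ).add (hg ψ)
  rw [add_zero] at h1
  refine ge_of_tendsto' h1 fun n => ?_
  have h2 : f - g = -(u n - f) + (u n - g) := by abel
  rw [h2]
  exact (map_add_le_add _ _ _).trans (by rw [map_neg_eq_map])

theorem tendsto_integral_of_tendsto_pairingSeminorm (ψ : ρ.associate.space) {u : ℕ → ρ.space}
    {f : ρ.space} (h : Tendsto (fun n => ρ.pairingSeminorm hres hri ψ (u n - f)) atTop (𝓝 0)) :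
    Tendsto (fun n => ∫ x, ψ.1 x * (u n).1 x ∂μ) atTop (𝓝 (∫ x, ψ.1 x * f.1 x ∂μ)) := by
  refine tendsto_iff_norm_sub_tendsto_zero.2 (squeeze_zero (fun _ => norm_nonneg _) (fun n => ?_) h)
  rw [← ρ.integral_mul_sub hres hri]
  exact ρ.norm_integral_mul_le hres hri ψ _

/-- Norm-bounded `ξ`-Cauchy sequences converge in `ξ`, and almost everywhere along a subsequence. -/
theorem exists_tendsto_of_cauchy_pairingSeminorm {u : ℕ → ρ.space} {B : ℝ} (hB : ∀ n, ‖u n‖ ≤ B)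
    (hu : ∀ ψ, ∀ ε : ℝ, 0 < ε → ∀ᶠ N in atTop, ∀ n ≥ N, ∀ m ≥ N,
      ρ.pairingSeminorm hres hri ψ (u n - u m) ≤ ε) :
    ∃ g : ρ.space, ‖g‖ ≤ B ∧
      (∀ ψ, Tendsto (fun n => ρ.pairingSeminorm hres hri ψ (u n - g)) atTop (𝓝 0)) ∧
      ∃ ns : ℕ → ℕ, StrictMono ns ∧
        ∀ᵐ x ∂μ, Tendsto (fun j => (u (ns j)).1 x) atTop (𝓝 (g.1 x)) := by
  have hind : ∀ k, ∃ ψ : ρ.associate.space,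
      (fun x => ‖ψ.1 x‖ₑ) =ᵐ[μ] (spanningSets μ k).indicator 1 := fun k =>
    ρ.associate.exists_enorm_eq (aemeasurable_indicator_one (measurableSet_spanningSets μ k))
      (ρ.associate.indicator_lt_top' _ (measurableSet_spanningSets μ k)
        (measure_spanningSets_lt_top μ k))
  choose ψ hψ using hind
  -- Characteristic functions of spanning sets lie in `X'`, so `ξ`-Cauchy implies `L¹`-Cauchy on
  -- each of them. At stage `j` the first `j + 1` test functions are controlled, hence for the
  -- `k`-th set the subsequence is used from index `k` on.
  obtain ⟨ns, hns, hnsu⟩ := extraction_forall_of_eventually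
    (P := fun j N => ∀ k ∈ Finset.range (j + 1), ∀ n ≥ N, ∀ m ≥ N,
      ρ.pairingSeminorm hres hri (ψ k) (u n - u m) ≤ (1 / 2) ^ j) (fun j =>
        ((Finset.range (j + 1)).eventually_all).2 fun k _ => hu (ψ k) _ (by positivity))
  have hlim : ∀ k, ∀ᵐ x ∂μ.restrict (spanningSets μ k),
      ∃ l : ℂ, Tendsto (fun j => (u (ns j)).1 x) atTop (𝓝 l) := by
    intro k
    have h1 := Lp.ae_tendsto_of_cauchy_eLpNorm (μ := μ.restrict (spanningSets μ k)) (p := 1)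
      (f := fun j => ((u (ns (j + k))).1 : α → ℂ))
      (fun j => (u (ns (j + k))).1.aestronglyMeasurable.restrict) le_rfl
      (B := fun j => ENNReal.ofReal (2 * (1 / 2) ^ j)) (by
        rw [← ENNReal.ofReal_tsum_of_nonneg (fun j => by positivity)
          ((summable_geometric_two).mul_left 2)]
        exact ENNReal.ofReal_ne_top) (fun N n m hn hm => by
        have h2 := hnsu (N + k) k (by simp) (ns (n + k)) (hns.monotone (by lia)) (ns (m + k))
          (hns.monotone (by lia))
        have h3 : eLpNorm (((u (ns (n + k))).1 : α → ℂ) - ((u (ns (m + k))).1 : α → ℂ)) 1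
            (μ.restrict (spanningSets μ k)) ≤
            rearrangementPairing (ψ k).1 (u (ns (n + k)) - u (ns (m + k))).1 := by
          rw [eLpNorm_one_eq_lintegral_enorm,
            ← lintegral_indicator_one_mul (measurableSet_spanningSets μ k)]
          refine le_trans (le_of_eq (lintegral_congr_ae ?_)) (lintegral_mul_le_pairing _ _ hres)
          filter_upwards [hψ k, AEEqFun.coeFn_sub (u (ns (n + k))).1 (u (ns (m + k))).1]
            with x hx hx'
          rw [enorm_mul, hx, Submodule.coe_sub, hx']
        refine h3.trans_lt ?_
        rw [← ofReal_pairingSeminorm hres ρ hri]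
        refine (ENNReal.ofReal_lt_ofReal_iff (by positivity)).2 (h2.trans_lt ?_)
        calc ((1 : ℝ) / 2) ^ (N + k) ≤ (1 / 2) ^ N :=
              pow_le_pow_of_le_one (by norm_num) (by norm_num) (by lia)
          _ < 2 * (1 / 2) ^ N := by
              have : (0 : ℝ) < (1 / 2) ^ N := by positivity
              linarith)
    filter_upwards [h1] with x hx
    obtain ⟨l, hl⟩ := hx
    exact ⟨l, (tendsto_add_atTop_iff_nat k).1 hl⟩
  have hlim' := (ae_restrict_iUnion_iff (μ := μ) (spanningSets μ)
    (fun x => ∃ l : ℂ, Tendsto (fun j => (u (ns j)).1 x) atTop (𝓝 l))).2 hlim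
  rw [iUnion_spanningSets, Measure.restrict_univ] at hlim'
  obtain ⟨g₀, hg₀, hg₀lim⟩ := exists_stronglyMeasurable_limit_of_tendsto_ae
    (fun j => (u (ns j)).1.aestronglyMeasurable) hlim'
  set g : α →ₘ[μ] ℂ := AEEqFun.mk g₀ hg₀.aestronglyMeasurable with hg
  have hglim : ∀ᵐ x ∂μ, Tendsto (fun j => (u (ns j)).1 x) atTop (𝓝 (g x)) := by
    filter_upwards [hg₀lim, AEEqFun.coeFn_mk g₀ hg₀.aestronglyMeasurable] with x hx hx'
    rwa [hg, hx']
  have hgB : ρ.eval g ≤ ENNReal.ofReal B := by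
    refine (ρ.toFun_le_liminf (F := fun j x => ‖(u (ns j)).1 x‖ₑ) (fun j => aemeasurable_enorm _)
      (aemeasurable_enorm g) ?_).trans ?_
    · filter_upwards [hglim] with x hx using hx.enorm
    · refine (liminf_le_liminf (v := fun _ => ENNReal.ofReal B) (.of_forall fun j => ?_)).trans
        (by simp)
      exact (ENNReal.le_ofReal_iff_toReal_le (u (ns j)).2.ne ((norm_nonneg _).trans (hB 0))).2
        (hB (ns j))
  have hgX : g ∈ ρ.space := hgB.trans_lt ENNReal.ofReal_lt_top
  refine ⟨⟨g, hgX⟩, ?_, fun ψ' => ?_, ns, hns, hglim⟩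
  · exact ENNReal.toReal_le_of_le_ofReal ((norm_nonneg _).trans (hB 0)) hgB
  · rw [Metric.tendsto_atTop]
    intro ε hε
    obtain ⟨N, hN⟩ := (hu ψ' (ε / 2) (by positivity)).exists
    refine ⟨N, fun n hn => ?_⟩
    rw [Real.dist_0_eq_abs, abs_of_nonneg (apply_nonneg _ _)]
    refine lt_of_le_of_lt ?_ (half_lt_self hε)
    refine ENNReal.toReal_le_of_le_ofReal (by positivity) ?_
    -- Fatou for the pairing bounds the distance from `u n` to `g` by the Cauchy estimate along the
    -- subsequence.
    have h1 := hres.rearrangementLIntegral_le_liminf (F := fun j x => ‖(u n - u (ns j)).1 x‖ₑ)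
      (f := fun x => ‖((u n).1 - g) x‖ₑ) (g := fun x => ‖ψ'.1 x‖ₑ)
      (fun j => aemeasurable_enorm _) (aemeasurable_enorm _) (aemeasurable_enorm _) (by
        filter_upwards [hglim, AEEqFun.coeFn_sub (u n).1 g,
          ae_all_iff.2 fun j => AEEqFun.coeFn_sub (u n).1 (u (ns j)).1] with x hx h2 h3
        rw [h2]
        simp only [Submodule.coe_sub, h3, Pi.sub_apply]
        exact (tendsto_const_nhds.sub hx).enorm)
    rw [rearrangementLIntegral_comm] at h1
    refine h1.trans ?_
    refine (liminf_le_liminf (v := fun _ => ENNReal.ofReal (ε / 2)) ?_).trans (by simp)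
    filter_upwards [hns.tendsto_atTop.eventually_ge_atTop N] with j hj
    rw [rearrangementLIntegral_comm]
    change rearrangementPairing ψ'.1 (u n - u (ns j)).1 ≤ _
    rw [← ofReal_pairingSeminorm hres ρ hri]
    exact ENNReal.ofReal_le_ofReal (hN n hn _ hj)

/-- The composition operator of a power-measure-bounded map, as an operator on the space. -/
theorem exists_compositionOperator {φ : α → α} {C : ℝ≥0} (hC1 : 1 ≤ C)
    (hC : ∀ n, μ.map φ^[n] ≤ (C : ℝ≥0∞) • μ) (hφ : Measurable φ)
    (hq : Measure.QuasiMeasurePreserving φ μ μ) :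
    ∃ S : ρ.space →L[ℂ] ρ.space,
      (∀ (n : ℕ) (f : ρ.space), ((S ^ n) f).1 = (compositionOperator hq)^[n] f.1) ∧
      (∀ (n : ℕ) (f : ρ.space), ‖(S ^ n) f‖ ≤ C * ‖f‖) ∧
      ∀ ψ (n : ℕ) (f : ρ.space),
        ρ.pairingSeminorm hres hri ψ ((S ^ n) f) ≤ C * ρ.pairingSeminorm hres hri ψ f := by
  have hdil : ∀ (n : ℕ) (f : α →ₘ[μ] ℂ) (s : ℝ≥0),
      μ {x | (s : ℝ≥0∞) < ‖(compositionOperator hq)^[n] f x‖ₑ} ≤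
        C * μ {x | (s : ℝ≥0∞) < ‖f x‖ₑ} := fun n f s => by
    refine le_trans (measure_mono_ae ?_) (measure_iterate_lt_le hC hφ (fun x => ‖f x‖ₑ) n s)
    filter_upwards [iterate_compositionOperator_coeFn hq n f] with x hx h
    have h' : (s : ℝ≥0∞) < ‖(compositionOperator hq)^[n] f x‖ₑ := h
    rw [hx] at h'
    exact h'
  have heval : ∀ (n : ℕ) (f : α →ₘ[μ] ℂ),
      ρ.eval ((compositionOperator hq)^[n] f) ≤ C * ρ.eval f := fun n f =>
    ρ.toFun_dilation hres hri (aemeasurable_enorm f) (aemeasurable_enorm _) hC1 (hdil n f)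
  have hmem : ∀ (n : ℕ) (f : ρ.space), (compositionOperator hq)^[n] f.1 ∈ ρ.space := fun n f =>
    (heval n f.1).trans_lt (ENNReal.mul_lt_top (by simp) f.2)
  have hnorm : ∀ (n : ℕ) (f : ρ.space), ‖(⟨_, hmem n f⟩ : ρ.space)‖ ≤ C * ‖f‖ := fun n f => by
    have h1 := ENNReal.toReal_mono (ENNReal.mul_lt_top (by simp) f.2).ne (heval n f.1)
    rw [ENNReal.toReal_mul] at h1
    exact h1
  have hpair : ∀ ψ (n : ℕ) (f : ρ.space), ρ.pairingSeminorm hres hri ψ ⟨_, hmem n f⟩ ≤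
      C * ρ.pairingSeminorm hres hri ψ f := fun ψ n f => by
    have h1 := rearrangementLIntegral_dilation hC1 (hdil n f.1) fun x => ‖ψ.1 x‖ₑ
    rw [rearrangementLIntegral_comm, rearrangementLIntegral_comm (fun x => ‖f.1 x‖ₑ)] at h1
    have h2 := ENNReal.toReal_mono (ENNReal.mul_ne_top (by simp)
      (rearrangementPairing_ne_top hres ρ hri ψ f)) h1
    rw [ENNReal.toReal_mul] at h2
    exact h2
  have hadd : ∀ f g : α →ₘ[μ] ℂ, compositionOperator hq (f + g) =
      compositionOperator hq f + compositionOperator hq g := fun f g => by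
    induction f using AEEqFun.induction_on
    induction g using AEEqFun.induction_on
    rfl
  have hsmul : ∀ (c : ℂ) (f : α →ₘ[μ] ℂ), compositionOperator hq (c • f) =
      c • compositionOperator hq f := fun c f => by
    induction f using AEEqFun.induction_on
    rfl
  let S₀ : ρ.space →ₗ[ℂ] ρ.space :=
    { toFun := fun f => ⟨compositionOperator hq f.1, hmem 1 f⟩
      map_add' := fun f g => Subtype.ext (hadd f.1 g.1)
      map_smul' := fun c f => Subtype.ext (hsmul c f.1) }
  let S : ρ.space →L[ℂ] ρ.space := S₀.mkContinuous _ fun f => hnorm 1 f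
  have hpow : ∀ (n : ℕ) (f : ρ.space), (S ^ n) f = ⟨_, hmem n f⟩ := fun n f => by
    induction n with
    | zero => rfl
    | succ n ih =>
      rw [pow_succ', mul_apply_eq_comp, ih]
      exact Subtype.ext (Function.iterate_succ_apply' _ _ _).symm
  refine ⟨S, fun n f => by rw [hpow], fun n f => by rw [hpow]; exact hnorm n f, fun ψ n f => ?_⟩
  rw [hpow]
  exact hpair ψ n f

include hres hri in
theorem IsBoundedIntegrable.mem_space (hACR' : ρ.associate.HasACR) {f : α →ₘ[μ] ℂ}
    (hf : IsBoundedIntegrable f) : f ∈ ρ.space := by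
  obtain ⟨M, hM, hint⟩ := hf
  exact hACR'.toFun_lt_top hres hri (aemeasurable_enorm f) hM hint

/-- Approximation of functions by bounded integrable ones. -/
theorem exists_approximation {ρ : BanachFunctionNorm μ} (hri : ρ.IsRearrangementInvariant)
    (hACR : ρ.HasACR) (hACR' : ρ.associate.HasACR) (f : ρ.space) :
    ∃ u : ℕ → ρ.space, (∀ k, IsBoundedIntegrable (u k).1) ∧
      (∀ k, (fun x => ‖(u k).1 x‖ₑ) ≤ᵐ[μ] fun x => ‖f.1 x‖ₑ) ∧
      (∀ ψ, Tendsto (fun k => ρ.pairingSeminorm hres hri ψ (u k - f)) atTop (𝓝 0)) ∧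
      (ρ.HasACNorm f → (∀ k, ρ.HasACNorm (u k)) ∧ Tendsto u atTop (𝓝 f)) := by
  have hfm : Measurable fun x => ‖f.1 x‖ₑ := f.1.stronglyMeasurable.measurable.enorm
  -- The upper cut makes the restriction bounded; the lower cut gives `D k` finite measure by (ACR),
  -- hence integrability.
  set D : ℕ → Set α := fun k => {x | ((k : ℝ≥0∞) + 1)⁻¹ < ‖f.1 x‖ₑ ∧ ‖f.1 x‖ₑ ≤ k} with hD
  have hDm : ∀ k, MeasurableSet (D k) := fun k =>
    (measurableSet_lt measurable_const hfm).inter (measurableSet_le hfm measurable_const)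
  have hum : ∀ k, AEStronglyMeasurable ((D k).indicator f.1) μ := fun k =>
    f.1.aestronglyMeasurable.indicator (hDm k)
  have hcoe : ∀ k, AEEqFun.mk _ (hum k) =ᵐ[μ] (D k).indicator f.1 := fun k => AEEqFun.coeFn_mk _ _
  have hule : ∀ k, (fun x => ‖AEEqFun.mk _ (hum k) x‖ₑ) ≤ᵐ[μ] fun x => ‖f.1 x‖ₑ := fun k => by
    filter_upwards [hcoe k] with x hx
    rw [hx]
    exact enorm_indicator_le_enorm_self _ _
  have huX : ∀ k, AEEqFun.mk _ (hum k) ∈ ρ.space := fun k =>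
    (ρ.mono' _ _ (aemeasurable_enorm _) (aemeasurable_enorm _) (hule k)).trans_lt f.2
  have hdiff : ∀ k, (fun x => ‖((⟨_, huX k⟩ : ρ.space) - f).1 x‖ₑ) =ᵐ[μ]
      (D k)ᶜ.indicator fun x => ‖f.1 x‖ₑ := fun k => by
    filter_upwards [hcoe k, AEEqFun.coeFn_sub (AEEqFun.mk _ (hum k)) f.1] with x hx hx'
    rw [Submodule.coe_sub, hx', Pi.sub_apply, hx]
    by_cases hxD : x ∈ D k <;> simp [hxD]
  refine ⟨fun k => ⟨_, huX k⟩, fun k => ⟨k, ?_, ?_⟩, hule, fun ψ => ?_, fun hAC =>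
    ⟨fun k => ?_, ?_⟩⟩
  · filter_upwards [hcoe k] with x hx
    rw [hx]
    by_cases hxD : x ∈ D k
    · simpa [hxD] using hxD.2
    · simp [hxD]
  · have hμD : μ (D k) < ∞ := by
      obtain ⟨t, ht⟩ := ((hACR f).eventually (gt_mem_nhds
        (show (0 : ℝ≥0∞) < ((k : ℝ≥0∞) + 1)⁻¹ by simp))).exists
      exact (measure_mono fun x hx => hx.1).trans_lt
        ((measure_le_of_rearrangement_lt ht).trans_lt ENNReal.ofReal_lt_top)
    calc ∫⁻ x, ‖AEEqFun.mk _ (hum k) x‖ₑ ∂μ ≤ ∫⁻ x, (D k).indicator (fun _ => (k : ℝ≥0∞)) x ∂μ := by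
          refine lintegral_mono_ae ?_
          filter_upwards [hcoe k] with x hx
          rw [hx]
          by_cases hxD : x ∈ D k
          · simpa [hxD] using hxD.2
          · simp [hxD]
      _ = k * μ (D k) := lintegral_indicator_const (hDm k) _
      _ < ∞ := ENNReal.mul_lt_top (by simp) hμD
  · have h1 : Tendsto (fun k => rearrangementLIntegral μ
        (fun x => ‖((⟨_, huX k⟩ : ρ.space) - f).1 x‖ₑ) (fun x => ‖ψ.1 x‖ₑ)) atTop (𝓝 0) := by
      refine tendsto_rearrangementLIntegral_zero (f := fun x => ‖f.1 x‖ₑ)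
        (.of_forall fun k => rearrangement_mono ?_) ?_
        (fun t ht => hACR'.rearrangement_lt_top ψ ht) fun ε hε => ?_
      · filter_upwards [hdiff k] with x hx
        rw [hx]
        exact Set.indicator_le_self' (fun _ _ => bot_le) x
      · rw [rearrangementLIntegral_comm]
        exact (rearrangementPairing_ne_top hres ρ hri ψ f).lt_top
      · refine tendsto_of_tendsto_of_tendsto_of_le_of_le' tendsto_const_nhds
          (hACR.tendsto_measure_lt f) (.of_forall fun _ => bot_le) ?_
        obtain ⟨N, hN⟩ := ENNReal.exists_inv_nat_lt (a := (ε : ℝ≥0∞)) (by exact_mod_cast hε.ne')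
        filter_upwards [eventually_ge_atTop N] with k hk
        refine measure_mono_ae ?_
        filter_upwards [hdiff k] with x hx hxε
        have hxε' : (ε : ℝ≥0∞) < ‖((⟨_, huX k⟩ : ρ.space) - f).1 x‖ₑ := hxε
        rw [hx] at hxε'
        by_cases hxD : x ∈ D k
        · simp [hxD] at hxε'
        · rw [Set.indicator_of_mem (by exact hxD)] at hxε'
          by_contra hle
          refine hxD ⟨?_, not_lt.1 hle⟩
          refine lt_of_le_of_lt ?_ (hN.trans hxε')
          rw [ENNReal.inv_le_inv]
          exact le_trans (by exact_mod_cast hk) le_self_add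
    have h2 := (ENNReal.tendsto_toReal (a := 0) (by simp)).comp h1
    refine h2.congr fun k => ?_
    rw [Function.comp_apply, rearrangementLIntegral_comm]
    rfl
  · intro E hE hlim
    refine tendsto_of_tendsto_of_tendsto_of_le_of_le tendsto_const_nhds (hAC E hE hlim)
      (fun _ => bot_le) fun j => ?_
    refine ρ.mono' _ _ ((aemeasurable_enorm _).indicator (hE j))
      ((aemeasurable_enorm _).indicator (hE j)) ?_
    filter_upwards [hule k] with x hx
    exact Set.indicator_le_indicator hx
  -- Zeros of `f` lie in every complement of `D k`. They must be removed for the characteristic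
  -- functions to tend to `0`, and this does not change the norms.
  · have h1 := hAC (fun k => (D k)ᶜ ∩ {x | f.1 x ≠ 0})
      (fun k => (hDm k).compl.inter
        (f.1.stronglyMeasurable.measurable (measurableSet_singleton 0).compl))
      (.of_forall fun x => by
        refine tendsto_const_nhds.congr' ?_
        by_cases hx0 : f.1 x = 0
        · exact .of_forall fun k => by simp [hx0]
        obtain ⟨N, hN⟩ := ENNReal.exists_inv_nat_lt (a := ‖f.1 x‖ₑ) (by simpa using hx0)
        obtain ⟨N', hN'⟩ := ENNReal.exists_nat_gt (enorm_ne_top (x := f.1 x))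
        filter_upwards [eventually_ge_atTop N, eventually_ge_atTop N'] with k hk hk'
        have hxD : x ∈ D k := by
          refine ⟨lt_of_le_of_lt ?_ hN, hN'.le.trans (by exact_mod_cast hk')⟩
          rw [ENNReal.inv_le_inv]
          exact le_trans (by exact_mod_cast hk) le_self_add
        simp [hxD])
    rw [tendsto_iff_norm_sub_tendsto_zero]
    have h2 := (ENNReal.tendsto_toReal (a := 0) (by simp)).comp h1
    refine h2.congr fun k => ?_
    rw [norm_def, Function.comp_apply, eval, ρ.toFun_congr (aemeasurable_enorm _) (hdiff k)]
    congr 2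
    ext x
    by_cases hxD : x ∈ D k
    · simp [hxD]
    · by_cases hx0 : f.1 x = 0 <;> simp [hxD, hx0]

end BanachFunctionNorm
-- Convergence of the Cesàro means and the limit operator.
namespace BanachFunctionNorm

variable {α : Type*} [MeasurableSpace α] {μ : Measure α}

section Cesaro

variable (ρ : BanachFunctionNorm μ) (S : ρ.space →L[ℂ] ρ.space)

theorem cesaro_add (n : ℕ) (f g : ρ.space) :
    ρ.cesaro S n (f + g) = ρ.cesaro S n f + ρ.cesaro S n g := by
  simp only [cesaro, map_add, Finset.sum_add_distrib, smul_add]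

theorem cesaro_sub (n : ℕ) (f g : ρ.space) :
    ρ.cesaro S n (f - g) = ρ.cesaro S n f - ρ.cesaro S n g := by
  simp only [cesaro, map_sub, Finset.sum_sub_distrib, smul_sub]

theorem cesaro_smul (n : ℕ) (c : ℂ) (f : ρ.space) :
    ρ.cesaro S n (c • f) = c • ρ.cesaro S n f := by
  simp only [cesaro, map_smul, ← Finset.smul_sum, smul_comm c]

theorem cesaro_coe {φ : α → α} (hq : Measure.QuasiMeasurePreserving φ μ μ)
    (hS : ∀ (n : ℕ) (f : ρ.space), ((S ^ n) f).1 = (compositionOperator hq)^[n] f.1)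
    (n : ℕ) (f : ρ.space) : (ρ.cesaro S n f).1 = compositionCesaro hq n f.1 := by
  rw [cesaro, compositionCesaro, Submodule.coe_smul, Submodule.coe_sum]
  simp only [hS]

end Cesaro

variable [SigmaFinite μ]

theorem tendsto_rearrangementLIntegral_indicator_zero (hres : IsResonant μ)
    {ρ : BanachFunctionNorm μ} (hri : ρ.IsRearrangementInvariant) (hACR' : ρ.associate.HasACR)
    (ψ : ρ.associate.space) {G : ℕ → Set α}
    (hlim : Tendsto (fun n => μ (G n)) atTop (𝓝 0)) :
    Tendsto (fun n => rearrangementLIntegral μ ((G n).indicator 1) fun x => ‖ψ.1 x‖ₑ) atTop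
      (𝓝 0) := by
  -- Any set of positive finite measure yields a dominating characteristic function. If no spanning
  -- set has positive measure, the whole space is null and serves instead.
  obtain ⟨E, hE, hμE, hGE⟩ : ∃ E : Set α, MeasurableSet E ∧ μ E < ∞ ∧
      ∀ᶠ n in atTop, μ (G n) ≤ μ E := by
    by_cases h0 : ∀ n, μ (spanningSets μ n) = 0
    · have h1 : μ Set.univ = 0 := by
        rw [← iUnion_spanningSets μ]
        exact measure_iUnion_null h0
      exact ⟨Set.univ, .univ, by simp [h1], .of_forall fun n => measure_mono (Set.subset_univ _)⟩
    · push Not at h0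
      obtain ⟨n, hn⟩ := h0
      exact ⟨_, measurableSet_spanningSets μ n, measure_spanningSets_lt_top μ n,
        ENNReal.tendsto_nhds_zero.1 hlim _ (pos_iff_ne_zero.2 hn)⟩
  refine tendsto_rearrangementLIntegral_zero (f := E.indicator 1) ?_ ?_
    (fun t ht => hACR'.rearrangement_lt_top ψ ht) fun ε hε => ?_
  · filter_upwards [hGE] with n hn t
    rw [rearrangement_indicator, rearrangement_indicator]
    exact Set.indicator_le_indicator_of_subset (fun t ht => lt_of_lt_of_le ht hn)
      (fun _ => bot_le) t
  · exact (ρ.rearrangementLIntegral_le hres hri (aemeasurable_indicator_one hE)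
      (aemeasurable_enorm ψ.1) (ρ.indicator_lt_top' E hE hμE)).trans_lt
      (ENNReal.mul_lt_top ψ.2 (ρ.indicator_lt_top' E hE hμE))
  · refine tendsto_of_tendsto_of_tendsto_of_le_of_le tendsto_const_nhds hlim (fun _ => bot_le)
      fun n => measure_mono fun x hx => ?_
    by_contra hxG
    have hx' : (ε : ℝ≥0∞) < (G n).indicator 1 x := hx
    simp [hxG] at hx'

/-- The mean ergodic theorem for bounded integrable functions. -/
theorem exists_limit_of_isBoundedIntegrable (hres : IsResonant μ) {ρ : BanachFunctionNorm μ}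
    (hri : ρ.IsRearrangementInvariant) (hACR' : ρ.associate.HasACR) {φ : α → α} {C : ℝ≥0}
    (hC : ∀ n, μ.map φ^[n] ≤ (C : ℝ≥0∞) • μ) (hφ : Measurable φ)
    (hq : Measure.QuasiMeasurePreserving φ μ μ) {S : ρ.space →L[ℂ] ρ.space}
    (hS : ∀ (n : ℕ) (f : ρ.space), ((S ^ n) f).1 = (compositionOperator hq)^[n] f.1)
    {P : Lp ℂ 2 μ →L[ℂ] Lp ℂ 2 μ} (hP : ∀ f : Lp ℂ 2 μ, ∃ F : ℕ → Lp ℂ 2 μ,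
      (∀ n, (F n : α →ₘ[μ] ℂ) = compositionCesaro hq n f) ∧ Tendsto F atTop (𝓝 (P f)))
    (f : ρ.space) (hf : IsBoundedIntegrable f.1) :
    ∃ g : ρ.space, g.1 = (P ⟨f.1, hf.mem_Lp_two⟩ : α →ₘ[μ] ℂ) ∧
      (∀ ψ, Tendsto (fun n => ρ.pairingSeminorm hres hri ψ (ρ.cesaro S n f - g)) atTop (𝓝 0)) ∧
      (ρ.HasACNorm f → Tendsto (fun n => ρ.cesaro S n f) atTop (𝓝 g)) := by
  obtain ⟨F, hF, hFlim⟩ := hP ⟨f.1, hf.mem_Lp_two⟩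
  set g₀ : α →ₘ[μ] ℂ := (P ⟨f.1, hf.mem_Lp_two⟩).1 with hg₀
  have hmeas : TendstoInMeasure μ (fun n => (F n : α → ℂ)) atTop g₀ :=
    tendstoInMeasure_of_tendsto_Lp hFlim
  obtain ⟨ns, -, hns⟩ := hmeas.exists_seq_tendsto_ae
  obtain ⟨M, hM, hint⟩ := hf
  have hFM : ∀ n, ∀ᵐ x ∂μ, ‖F n x‖ₑ ≤ M := fun n => by
    rw [hF n]
    exact compositionCesaro_ae_le hC hφ hq n hM
  have hFint : ∀ n, ∫⁻ x, ‖F n x‖ₑ ∂μ ≤ C * ∫⁻ x, ‖f.1 x‖ₑ ∂μ := fun n => by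
    rw [hF n]
    exact lintegral_compositionCesaro_le hC hφ hq n f.1
  have hKfin : C * ∫⁻ x, ‖f.1 x‖ₑ ∂μ < ∞ := ENNReal.mul_lt_top (by simp) hint
  have hg₀M : ∀ᵐ x ∂μ, ‖g₀ x‖ₑ ≤ M := by
    filter_upwards [hns, ae_all_iff.2 hFM] with x hx hx'
    exact le_of_tendsto' hx.enorm fun j => hx' (ns j)
  have hg₀int : ∫⁻ x, ‖g₀ x‖ₑ ∂μ ≤ C * ∫⁻ x, ‖f.1 x‖ₑ ∂μ := by
    calc ∫⁻ x, ‖g₀ x‖ₑ ∂μ = ∫⁻ x, liminf (fun j => ‖F (ns j) x‖ₑ) atTop ∂μ := by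
          refine lintegral_congr_ae ?_
          filter_upwards [hns] with x hx
          exact hx.enorm.liminf_eq.symm
      _ ≤ liminf (fun j => ∫⁻ x, ‖F (ns j) x‖ₑ ∂μ) atTop :=
          lintegral_liminf_le' fun j => aemeasurable_enorm _
      _ ≤ liminf (fun _ : ℕ => C * ∫⁻ x, ‖f.1 x‖ₑ ∂μ) atTop :=
          liminf_le_liminf (.of_forall fun j => hFint _)
      _ = _ := by simp
  have hgX : g₀ ∈ ρ.space := IsBoundedIntegrable.mem_space hres ρ hri hACR'
    ⟨M, hg₀M, hg₀int.trans_lt hKfin⟩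
  set g : ρ.space := ⟨g₀, hgX⟩ with hg
  have hdiff : ∀ n, (fun x => ‖(ρ.cesaro S n f - g).1 x‖ₑ) =ᵐ[μ] fun x => ‖F n x - g₀ x‖ₑ :=
    fun n => by
      rw [Submodule.coe_sub, ρ.cesaro_coe S hq hS, ← hF n]
      filter_upwards [AEEqFun.coeFn_sub (F n : α →ₘ[μ] ℂ) g₀] with x hx
      rw [hx, Pi.sub_apply]
  -- Stated for a general functional so that it serves both the pairings with `ψ` and the norm.
  have key : ∀ {q : (α → ℝ≥0∞) → ℝ≥0∞} {B : ℝ≥0∞}, B ≠ ∞ →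
    (∀ f g : α → ℝ≥0∞, AEMeasurable f μ → AEMeasurable g μ → f ≤ᵐ[μ] g → q f ≤ q g) →
    (∀ f g : α → ℝ≥0∞, AEMeasurable f μ → AEMeasurable g μ →
      q (fun x => f x + g x) ≤ q f + q g) →
    (∀ (a : ℝ≥0) (f : α → ℝ≥0∞), AEMeasurable f μ → q (fun x => a * f x) = a * q f) →
    (∀ f : α → ℝ≥0∞, AEMeasurable f μ → ρ.toFun f < ∞ → q f ≤ B * ρ.toFun f) →
    (∀ G : ℕ → Set α, (∀ n, MeasurableSet (G n)) →
      Tendsto (fun n => μ (G n)) atTop (𝓝 0) → Tendsto (fun n => q ((G n).indicator 1)) atTop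
        (𝓝 0)) →
    Tendsto (fun n => q fun x => ‖(ρ.cesaro S n f - g).1 x‖ₑ) atTop (𝓝 0) := by
    intro q B hB h1 h2 h3 h4 h5
    refine hACR'.tendsto_zero_of_tendsto_measure hres hri hB h1 h2 h3 h4 h5
      (fun n => aemeasurable_enorm _) (M := M + M) (fun n => ?_)
      (K := C * ∫⁻ x, ‖f.1 x‖ₑ ∂μ + C * ∫⁻ x, ‖f.1 x‖ₑ ∂μ) ?_ (fun n => ?_) fun ε hε => ?_
    · filter_upwards [hdiff n, hFM n, hg₀M] with x hx hx1 hx2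
      rw [hx, ENNReal.coe_add]
      exact enorm_sub_le.trans (add_le_add hx1 hx2)
    · exact ENNReal.add_ne_top.2 ⟨hKfin.ne, hKfin.ne⟩
    · rw [lintegral_congr_ae (hdiff n)]
      refine (lintegral_mono fun x => enorm_sub_le).trans ?_
      rw [lintegral_add_left' (aemeasurable_enorm _)]
      exact add_le_add (hFint n) hg₀int
    · refine tendsto_of_tendsto_of_tendsto_of_le_of_le tendsto_const_nhds
        (hmeas ε (by exact_mod_cast hε)) (fun _ => bot_le) fun n => measure_mono_ae ?_
      filter_upwards [hdiff n] with x hx hxε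
      have hxε' : (ε : ℝ≥0∞) < ‖(ρ.cesaro S n f - g).1 x‖ₑ := hxε
      rw [hx, ← edist_eq_enorm_sub] at hxε'
      exact hxε'.le
  have hpair : ∀ ψ, Tendsto (fun n => ρ.pairingSeminorm hres hri ψ (ρ.cesaro S n f - g)) atTop
      (𝓝 0) := fun ψ => by
    have h1 := key (q := fun h => rearrangementLIntegral μ h fun x => ‖ψ.1 x‖ₑ)
      (B := ρ.associate.eval ψ.1) ψ.2.ne (fun f g _ _ h => rearrangementLIntegral_mono h _)
      (fun f g hf hg => hres.rearrangementLIntegral_add_le hf hg (aemeasurable_enorm _))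
      (fun a f hf => hres.rearrangementLIntegral_const_mul _ hf (aemeasurable_enorm _))
      (fun f hf hf' => ρ.rearrangementLIntegral_le hres hri hf (aemeasurable_enorm _) hf')
      (fun G _ hG => tendsto_rearrangementLIntegral_indicator_zero hres hri hACR' ψ hG)
    have h2 := (ENNReal.tendsto_toReal (a := 0) (by simp)).comp h1
    refine h2.congr fun n => ?_
    rw [Function.comp_apply, rearrangementLIntegral_comm]
    rfl
  refine ⟨g, rfl, hpair, fun hAC => ?_⟩
  -- The zero function carries no information on the norms of small sets, so it is treated apart.
  rcases eq_or_ne f 0 with rfl | hf0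
  · have h0 : ∀ n, ρ.cesaro S n 0 = 0 := fun n => by simp [cesaro]
    have hg0 : (0 : ρ.space) = g := ρ.eq_of_tendsto_pairingSeminorm hres hri
      (u := fun n => ρ.cesaro S n 0) (fun ψ => by simp [h0]) hpair
    simp only [h0]
    rw [← hg0]
    exact tendsto_const_nhds
  · have h1 := key (q := ρ.toFun) (B := 1) (by simp) ρ.mono' ρ.add_le' ρ.smul'
      (fun f _ _ => by rw [one_mul])
      (fun G hG hlim => tendsto_toFun_indicator_of_hasACNorm hres hri hAC hf0 hG hlim)
    rw [tendsto_iff_norm_sub_tendsto_zero]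
    exact (ENNReal.tendsto_toReal (a := 0) (by simp)).comp h1

/-- The limit of the Cesàro means of a composition operator, as an operator. -/
theorem exists_cesaro_limit (hres : IsResonant μ) {ρ : BanachFunctionNorm μ}
    (hri : ρ.IsRearrangementInvariant) (hACR : ρ.HasACR) (hACR' : ρ.associate.HasACR)
    {C : ℝ≥0} {S : ρ.space →L[ℂ] ρ.space}
    (hSn : ∀ (n : ℕ) (f : ρ.space), ‖(S ^ n) f‖ ≤ C * ‖f‖)
    (hSp : ∀ ψ (n : ℕ) (f : ρ.space),
        ρ.pairingSeminorm hres hri ψ ((S ^ n) f) ≤ C * ρ.pairingSeminorm hres hri ψ f)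
    (hlim : ∀ f : ρ.space, IsBoundedIntegrable f.1 → ∃ g : ρ.space,
      (∀ ψ, Tendsto (fun n => ρ.pairingSeminorm hres hri ψ (ρ.cesaro S n f - g)) atTop (𝓝 0)) ∧
      (ρ.HasACNorm f → Tendsto (fun n => ρ.cesaro S n f) atTop (𝓝 g))) :
    ∃ T : ρ.space →L[ℂ] ρ.space,
      (∀ f ψ, Tendsto (fun n => ρ.pairingSeminorm hres hri ψ (ρ.cesaro S n f - T f)) atTop (𝓝 0)) ∧
      (∀ f, ‖T f‖ ≤ C * ‖f‖) ∧
      (∀ f ψ, ρ.pairingSeminorm hres hri ψ (T f) ≤ C * ρ.pairingSeminorm hres hri ψ f) ∧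
      (∀ f, ∃ ns : ℕ → ℕ, StrictMono ns ∧
        ∀ᵐ x ∂μ, Tendsto (fun j => (ρ.cesaro S (ns j) f).1 x) atTop (𝓝 ((T f).1 x))) ∧
      ∀ f, ρ.HasACNorm f → Tendsto (fun n => ρ.cesaro S n f) atTop (𝓝 (T f)) := by
  set p := ρ.pairingSeminorm hres hri with hp
  have hAp : ∀ ψ n f, p ψ (ρ.cesaro S n f) ≤ C * p ψ f := fun ψ n f =>
    (p ψ).inv_smul_sum_range_le (mul_nonneg C.2 (apply_nonneg _ _)) (fun i => hSp ψ i f) n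
  have hAn : ∀ n f, ‖ρ.cesaro S n f‖ ≤ C * ‖f‖ := fun n f => norm_cesaro_le hSn f n
  have hcauchy : ∀ f ψ (ε : ℝ), 0 < ε → ∀ᶠ N in atTop, ∀ n ≥ N, ∀ m ≥ N,
      p ψ (ρ.cesaro S n f - ρ.cesaro S m f) ≤ ε := by
    intro f ψ ε hε
    -- The difference of two means of `f` splits into four terms: two errors from replacing `f` by
    -- `u k`, bounded uniformly in the index, and two distances to the known limit for `u k`.
    obtain ⟨u, hu, -, huf, -⟩ := exists_approximation hres hri hACR hACR' f
    have h1 : ∀ᶠ k in atTop, C * p ψ (u k - f) < ε / 4 := by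
      have h2 := (huf ψ).const_mul (C : ℝ)
      rw [mul_zero] at h2
      exact h2.eventually (gt_mem_nhds (by positivity))
    obtain ⟨k, hk⟩ := h1.exists
    obtain ⟨g, hg, -⟩ := hlim (u k) (hu k)
    obtain ⟨N₀, hN₀⟩ := eventually_atTop.1
      ((hg ψ).eventually (gt_mem_nhds (show (0 : ℝ) < ε / 4 by positivity)))
    filter_upwards [eventually_ge_atTop N₀] with N hN n hn m hm
    have h3 := hAp ψ n (u k - f)
    have h4 := hAp ψ m (u k - f)
    have h5 := hN₀ n (hN.trans hn)
    have h6 := hN₀ m (hN.trans hm)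
    have h7 : ρ.cesaro S n f - ρ.cesaro S m f = -(ρ.cesaro S n (u k - f)) +
        ((ρ.cesaro S n (u k) - g) + (-(ρ.cesaro S m (u k) - g) + ρ.cesaro S m (u k - f))) := by
      rw [cesaro_sub, cesaro_sub]
      abel
    rw [h7]
    have h8 := map_add_le_add (p ψ) (-(ρ.cesaro S n (u k - f)))
      ((ρ.cesaro S n (u k) - g) + (-(ρ.cesaro S m (u k) - g) + ρ.cesaro S m (u k - f)))
    have h9 := map_add_le_add (p ψ) (ρ.cesaro S n (u k) - g)
      (-(ρ.cesaro S m (u k) - g) + ρ.cesaro S m (u k - f))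
    have h10 := map_add_le_add (p ψ) (-(ρ.cesaro S m (u k) - g)) (ρ.cesaro S m (u k - f))
    rw [map_neg_eq_map] at h8 h10
    linarith
  have hex := fun f => ρ.exists_tendsto_of_cauchy_pairingSeminorm hres hri
    (u := fun n => ρ.cesaro S n f) (fun n => hAn n f) (hcauchy f)
  choose T hTn hT ns hns hnsT using hex
  have hTadd : ∀ f g, T (f + g) = T f + T g := fun f g =>
    ρ.eq_of_tendsto_pairingSeminorm hres hri (hT (f + g)) fun ψ => by
      refine squeeze_zero (fun _ => apply_nonneg _ _) (fun n => ?_)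
        (by simpa using (hT f ψ).add (hT g ψ))
      rw [cesaro_add, add_sub_add_comm]
      exact map_add_le_add _ _ _
  have hTsmul : ∀ (c : ℂ) f, T (c • f) = c • T f := fun c f =>
    ρ.eq_of_tendsto_pairingSeminorm hres hri (hT (c • f)) fun ψ => by
      have h1 := (hT f ψ).const_mul ‖c‖
      rw [mul_zero] at h1
      refine h1.congr fun n => ?_
      rw [cesaro_smul, ← smul_sub, map_smul_eq_mul]
  let T₀ : ρ.space →ₗ[ℂ] ρ.space := { toFun := T, map_add' := hTadd, map_smul' := hTsmul }
  have hTp : ∀ f ψ, p ψ (T f) ≤ C * p ψ f := fun f ψ => by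
    have h1 := (hT f ψ).add_const (C * p ψ f)
    rw [zero_add] at h1
    refine ge_of_tendsto' h1 fun n => ?_
    have h2 : T f = -(ρ.cesaro S n f - T f) + ρ.cesaro S n f := by abel
    conv_lhs => rw [h2]
    refine (map_add_le_add _ _ _).trans ?_
    rw [map_neg_eq_map]
    exact add_le_add le_rfl (hAp ψ n f)
  refine ⟨T₀.mkContinuous C hTn, hT, hTn, hTp, fun f => ⟨ns f, hns f, hnsT f⟩, fun f hf => ?_⟩
  change Tendsto _ _ (𝓝 (T f))
  obtain ⟨u, hu, -, huf, huAC⟩ := exists_approximation hres hri hACR hACR' f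
  obtain ⟨huAC, hulim⟩ := huAC hf
  rw [Metric.tendsto_atTop]
  intro ε hε
  have h1 : ∀ᶠ k in atTop, C * ‖u k - f‖ < ε / 3 := by
    have h2 := (tendsto_iff_norm_sub_tendsto_zero.1 hulim).const_mul (C : ℝ)
    rw [mul_zero] at h2
    exact h2.eventually (gt_mem_nhds (by positivity))
  obtain ⟨k, hk⟩ := h1.exists
  obtain ⟨g, hg, hgn⟩ := hlim (u k) (hu k)
  -- The norm limit for the approximant is also its `ξ`-limit, so uniqueness identifies it and an
  -- `ε/3` argument finishes.
  have hgT : g = T (u k) := ρ.eq_of_tendsto_pairingSeminorm hres hri hg (hT (u k))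
  obtain ⟨N, hN⟩ := Metric.tendsto_atTop.1 (hgn (huAC k)) (ε / 3) (by positivity)
  refine ⟨N, fun n hn => ?_⟩
  have h3 := hN n hn
  have h4 := hAn n (u k - f)
  have h5 := hTn (u k - f)
  have h6 : T (u k - f) = T (u k) - T f := map_sub T₀ _ _
  rw [dist_eq_norm] at h3 ⊢
  rw [hgT] at h3
  have h7 : ρ.cesaro S n f - T f = -(ρ.cesaro S n (u k - f)) +
      ((ρ.cesaro S n (u k) - T (u k)) + T (u k - f)) := by
    rw [cesaro_sub, h6]
    abel
  rw [h7]
  have h8 := norm_add_le (-(ρ.cesaro S n (u k - f)))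
    ((ρ.cesaro S n (u k) - T (u k)) + T (u k - f))
  have h9 := norm_add_le (ρ.cesaro S n (u k) - T (u k)) (T (u k - f))
  rw [norm_neg] at h8
  linarith

end BanachFunctionNorm
-- Positivity, associate operators and the assembled ergodic theorem.
namespace BanachFunctionNorm

variable {α : Type*} [MeasurableSpace α] {μ : Measure α}

theorem IsBoundedIntegrable.mono {f g : α →ₘ[μ] ℂ} (hg : IsBoundedIntegrable g)
    (h : (fun x => ‖f x‖ₑ) ≤ᵐ[μ] fun x => ‖g x‖ₑ) : IsBoundedIntegrable f := by
  obtain ⟨M, hM, hint⟩ := hg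
  refine ⟨M, ?_, (lintegral_mono_ae h).trans_lt hint⟩
  filter_upwards [h, hM] with x hx hx' using hx.trans hx'

/-- Multiplying by a phase turns a product into its modulus. -/
theorem exists_mul_eq_norm_mul_norm (ρ : BanachFunctionNorm μ) (w : α →ₘ[μ] ℂ) (g : ρ.space) :
    ∃ f : ρ.space, (fun x => ‖f.1 x‖ₑ) ≤ᵐ[μ] (fun x => ‖g.1 x‖ₑ) ∧
      ∀ᵐ x ∂μ, f.1 x * w x = ((‖g.1 x‖ * ‖w x‖ : ℝ) : ℂ) := by
  have hgm : Measurable (g.1 : α → ℂ) := g.1.stronglyMeasurable.measurable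
  have hwm : Measurable (w : α → ℂ) := w.stronglyMeasurable.measurable
  have hm : AEStronglyMeasurable
      (fun x => (‖g.1 x‖ : ℂ) * ((starRingEnd ℂ) (w x) / (‖w x‖ : ℂ))) μ := by
    refine Measurable.aestronglyMeasurable ?_
    have h1 : Measurable fun x => (starRingEnd ℂ) (w x) :=
      Complex.continuous_conj.measurable.comp hwm
    exact (Complex.measurable_ofReal.comp hgm.norm).mul
      (h1.div (Complex.measurable_ofReal.comp hwm.norm))
  have hcoe := AEEqFun.coeFn_mk _ hm
  have hle : (fun x => ‖AEEqFun.mk _ hm x‖ₑ) ≤ᵐ[μ] fun x => ‖g.1 x‖ₑ := by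
    filter_upwards [hcoe] with x hx
    rw [hx, enorm_le_iff_norm_le, norm_mul, norm_div, RCLike.norm_conj, Complex.norm_real,
      Complex.norm_real, norm_norm, norm_norm]
    exact mul_le_of_le_one_right (norm_nonneg _) (div_self_le_one _)
  refine ⟨⟨_, (ρ.mono' _ _ (aemeasurable_enorm _) (aemeasurable_enorm _) hle).trans_lt g.2⟩, hle,
    ?_⟩
  filter_upwards [hcoe] with x hx
  rw [hx, Complex.ofReal_mul, mul_assoc, div_mul_eq_mul_div, Complex.conj_mul']
  congr 1
  rcases eq_or_ne (w x) 0 with h0 | h0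
  · simp [h0]
  · have : (‖w x‖ : ℂ) ≠ 0 := by simpa using h0
    rw [pow_two, mul_div_assoc, div_self this, mul_one]

/-- A limit of Cesàro means of a composition operator is positive. -/
theorem isPositiveOp_of_ae_tendsto_cesaro {ρ : BanachFunctionNorm μ} {φ : α → α} {C : ℝ≥0}
    (hC : ∀ n, μ.map φ^[n] ≤ (C : ℝ≥0∞) • μ) (hφ : Measurable φ)
    (hq : Measure.QuasiMeasurePreserving φ μ μ) {S T : ρ.space →L[ℂ] ρ.space}
    (hS : ∀ (n : ℕ) (f : ρ.space), ((S ^ n) f).1 = (compositionOperator hq)^[n] f.1)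
    (hT : ∀ f, ∃ ns : ℕ → ℕ, StrictMono ns ∧
        ∀ᵐ x ∂μ, Tendsto (fun j => (ρ.cesaro S (ns j) f).1 x) atTop (𝓝 ((T f).1 x))) :
    ρ.IsPositiveOp T := by
  intro f hf
  obtain ⟨ns, -, hns⟩ := hT f
  have h1 : ∀ i, ∀ᵐ x ∂μ, 0 ≤ (f.1 (φ^[i] x)).re ∧ (f.1 (φ^[i] x)).im = 0 := fun i =>
    (Measure.QuasiMeasurePreserving.mk (hφ.iterate i)
      (Measure.absolutelyContinuous_of_le_smul (hC i))).ae hf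
  have h2 : ∀ n, ∀ᵐ x ∂μ, (ρ.cesaro S n f).1 x = (n : ℂ)⁻¹ * ∑ i ∈ Finset.range n, f.1 (φ^[i] x) :=
    fun n => by
      rw [ρ.cesaro_coe S hq hS]
      exact compositionCesaro_coeFn hq n f.1
  filter_upwards [hns, ae_all_iff.2 h1, ae_all_iff.2 h2] with x hx hx1 hx2
  have h3 : ∀ n, 0 ≤ ((ρ.cesaro S n f).1 x).re ∧ ((ρ.cesaro S n f).1 x).im = 0 := fun n => by
    have h4 : (ρ.cesaro S n f).1 x =
        (((n : ℝ)⁻¹ * ∑ i ∈ Finset.range n, (f.1 (φ^[i] x)).re : ℝ) : ℂ) := by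
      rw [hx2 n]
      push_cast
      congr 1
      refine Finset.sum_congr rfl fun i _ => Complex.ext ?_ ?_
      · simp
      · simpa using (hx1 i).2
    rw [h4, Complex.ofReal_re, Complex.ofReal_im]
    exact ⟨mul_nonneg (by positivity) (Finset.sum_nonneg fun i _ => (hx1 i).1), rfl⟩
  exact ⟨ge_of_tendsto' ((Complex.continuous_re.tendsto _).comp hx) fun j => (h3 _).1,
    tendsto_nhds_unique ((Complex.continuous_im.tendsto _).comp hx)
      (tendsto_const_nhds.congr fun j => ((h3 _).2).symm)⟩

theorem isProj_ker_one_sub {ρ : BanachFunctionNorm μ} {S T : ρ.space →L[ℂ] ρ.space}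
    (h : LinearMap.IsProj (LinearMap.ker (1 - S : ρ.space →L[ℂ] ρ.space).toLinearMap)
      T.toLinearMap) :
    LinearMap.IsProj (LinearMap.ker T.toLinearMap)
      (1 - T : ρ.space →L[ℂ] ρ.space).toLinearMap := by
  refine ⟨fun f => ?_, fun f hf => ?_⟩
  · rw [LinearMap.mem_ker]
    change T (f - T f) = 0
    rw [map_sub, sub_eq_zero]
    exact (h.map_id _ (h.map_mem f)).symm
  · have hf' : T f = 0 := hf
    change f - T f = f
    rw [hf', sub_zero]

variable [SigmaFinite μ]

theorem HasACR.associate_associate {ρ : BanachFunctionNorm μ}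
    (hACR : ρ.HasACR) : ρ.associate.associate.HasACR := fun f =>
  hACR ⟨f.1, by
    have h1 : ρ.associate.associate.eval f.1 < ∞ := f.2
    have h2 := ρ.toFun_eq_associateFun_associate (aemeasurable_enorm f.1)
    exact h2.symm.le.trans_lt h1⟩

section Associate

variable (hres : IsResonant μ) {ρ : BanachFunctionNorm μ} (hri : ρ.IsRearrangementInvariant)
  {T : ρ.space →L[ℂ] ρ.space} {C : ℝ≥0}

/-- `w` is the image of `ψ` under the associate operator of `T`. -/
def IsAssociateImage (T : ρ.space →L[ℂ] ρ.space) (ψ w : ρ.associate.space) : Prop :=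
  ∀ f : ρ.space, ∫ x, (T f).1 x * ψ.1 x ∂μ = ∫ x, f.1 x * w.1 x ∂μ

/-- Correcting `g` by the phase of `w` makes the integrand equal to its modulus. The duality
identity is required only below `|g|`, so the bound applies before `w` is known to lie in `X'`. -/
theorem lintegral_enorm_mul_le_pairing
    (hTp : ∀ f ψ, ρ.pairingSeminorm hres hri ψ (T f) ≤ C * ρ.pairingSeminorm hres hri ψ f)
    {w : α →ₘ[μ] ℂ} {ψ : ρ.associate.space} {g : ρ.space}
    (hint : Integrable (fun x => g.1 x * w x) μ)
    (h : ∀ f : ρ.space, (fun x => ‖f.1 x‖ₑ) ≤ᵐ[μ] (fun x => ‖g.1 x‖ₑ) →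
      ∫ x, (T f).1 x * ψ.1 x ∂μ = ∫ x, f.1 x * w x ∂μ) :
    ∫⁻ x, ‖w x‖ₑ * ‖g.1 x‖ₑ ∂μ ≤ C * rearrangementPairing ψ.1 g.1 := by
  obtain ⟨f, hfg, hfw⟩ := ρ.exists_mul_eq_norm_mul_norm w g
  have h1 : ∫ x, ‖g.1 x * w x‖ ∂μ = ‖∫ x, ψ.1 x * (T f).1 x ∂μ‖ := by
    simp only [mul_comm (ψ.1 _)]
    rw [h f hfg, integral_congr_ae hfw, integral_complex_ofReal, Complex.norm_real,
      Real.norm_of_nonneg (integral_nonneg fun x => mul_nonneg (norm_nonneg _) (norm_nonneg _))]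
    simp only [norm_mul]
  have h2 : ∫ x, ‖g.1 x * w x‖ ∂μ ≤ C * ρ.pairingSeminorm hres hri ψ g := by
    rw [h1]
    refine (ρ.norm_integral_mul_le hres hri ψ (T f)).trans ((hTp f ψ).trans ?_)
    gcongr
    exact ρ.pairingSeminorm_le_of_ae_le hres hri ψ hfg
  have h3 := ENNReal.ofReal_le_ofReal h2
  rw [ofReal_integral_norm_eq_lintegral_enorm hint, ENNReal.ofReal_mul (NNReal.coe_nonneg C),
    ofReal_pairingSeminorm, ENNReal.ofReal_coe_nnreal] at h3
  refine le_trans (le_of_eq (lintegral_congr fun x => ?_)) h3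
  rw [enorm_mul, mul_comm]

include hres hri in
theorem integrable_mul' (f : ρ.space) (ψ : ρ.associate.space) :
    Integrable (fun x => f.1 x * ψ.1 x) μ := by
  simpa only [mul_comm] using ρ.integrable_mul hres hri ψ f

theorem IsAssociateImage.lintegral_le
    (hTp : ∀ f ψ, ρ.pairingSeminorm hres hri ψ (T f) ≤ C * ρ.pairingSeminorm hres hri ψ f)
    {ψ w : ρ.associate.space} (h : IsAssociateImage T ψ w) (g : ρ.space) :
    ∫⁻ x, ‖w.1 x‖ₑ * ‖g.1 x‖ₑ ∂μ ≤ C * rearrangementPairing ψ.1 g.1 :=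
  lintegral_enorm_mul_le_pairing hres hri hTp (integrable_mul' hres hri g w) fun f _ => h f

theorem IsAssociateImage.norm_le
    (hTp : ∀ f ψ, ρ.pairingSeminorm hres hri ψ (T f) ≤ C * ρ.pairingSeminorm hres hri ψ f)
    {ψ w : ρ.associate.space} (h : IsAssociateImage T ψ w) : ‖w‖ ≤ C * ‖ψ‖ := by
  have h1 : ρ.associate.eval w.1 ≤ C * ρ.associate.eval ψ.1 := by
    refine ρ.associateFun_le fun g hg hg' => ?_
    obtain ⟨G, hG⟩ := ρ.exists_enorm_eq hg hg'
    calc ∫⁻ x, ‖w.1 x‖ₑ * g x ∂μ = ∫⁻ x, ‖w.1 x‖ₑ * ‖G.1 x‖ₑ ∂μ := by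
          refine lintegral_congr_ae ?_
          filter_upwards [hG] with x hx
          rw [← hx]
      _ ≤ C * (ρ.associate.eval ψ.1 * ρ.eval G.1) := by
          refine (h.lintegral_le hres hri hTp G).trans ?_
          gcongr
          exact rearrangementPairing_le hres ρ hri ψ G
      _ = C * ρ.associate.eval ψ.1 * ρ.toFun g := by
          rw [eval, eval, ρ.toFun_congr (aemeasurable_enorm G.1) hG, mul_assoc]
  have h2 := ENNReal.toReal_mono (ENNReal.mul_lt_top (by simp) ψ.2).ne h1
  rw [ENNReal.toReal_mul] at h2
  exact h2

/-- By resonance the pairing with `F` is a supremum over functions equimeasurable with `F`. These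
lie in `X` because `X'' = X`, so the integral bound applies to each. It makes the correspondence
from `ψ` to `w` continuous for the topology `ξ` of `X'`. -/
theorem IsAssociateImage.pairingSeminorm_le
    (hTp : ∀ f ψ, ρ.pairingSeminorm hres hri ψ (T f) ≤ C * ρ.pairingSeminorm hres hri ψ f)
    {ψ w : ρ.associate.space} (h : IsAssociateImage T ψ w) (F : ρ.associate.associate.space) :
    ρ.associate.pairingSeminorm hres (hri.associate hres) F w ≤
      C * ρ.associate.pairingSeminorm hres (hri.associate hres) F ψ := by
  have h1 : rearrangementLIntegral μ (fun x => ‖w.1 x‖ₑ) (fun x => ‖F.1 x‖ₑ) ≤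
      C * rearrangementLIntegral μ (fun x => ‖ψ.1 x‖ₑ) (fun x => ‖F.1 x‖ₑ) := by
    refine hres.rearrangementLIntegral_le (aemeasurable_enorm _) (aemeasurable_enorm _)
      fun k hk he => ?_
    have hk' : ρ.toFun k < ∞ := by
      rw [hri k _ hk (aemeasurable_enorm F.1) he,
        ← ρ.toFun_eq_associateFun_associate (aemeasurable_enorm F.1)]
      exact F.2
    obtain ⟨G, hG⟩ := ρ.exists_enorm_eq hk hk'
    calc ∫⁻ x, ‖w.1 x‖ₑ * k x ∂μ = ∫⁻ x, ‖w.1 x‖ₑ * ‖G.1 x‖ₑ ∂μ := by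
          refine lintegral_congr_ae ?_
          filter_upwards [hG] with x hx
          rw [← hx]
      _ ≤ C * rearrangementLIntegral μ (fun x => ‖ψ.1 x‖ₑ) (fun x => ‖G.1 x‖ₑ) :=
          h.lintegral_le hres hri hTp G
      _ = _ := by
          rw [rearrangementLIntegral_comm, rearrangementLIntegral_congr hG,
            he.rearrangementLIntegral_eq, rearrangementLIntegral_comm]
  rw [rearrangementLIntegral_comm, rearrangementLIntegral_comm (fun x => ‖ψ.1 x‖ₑ)] at h1
  have h2 := ENNReal.toReal_mono (ENNReal.mul_ne_top (by simp)
    (rearrangementPairing_ne_top hres ρ.associate (hri.associate hres) F ψ)) h1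
  rw [ENNReal.toReal_mul] at h2
  exact h2

include hres hri in
theorem IsAssociateImage.add {ψ ψ' w w' : ρ.associate.space} (h : IsAssociateImage T ψ w)
    (h' : IsAssociateImage T ψ' w') : IsAssociateImage T (ψ + ψ') (w + w') := by
  intro f
  have key : ∀ (g : ρ.space) (u v : ρ.associate.space), ∫ x, g.1 x * (u + v).1 x ∂μ =
      ∫ x, g.1 x * u.1 x ∂μ + ∫ x, g.1 x * v.1 x ∂μ := fun g u v => by
    rw [← integral_add (integrable_mul' hres hri g u) (integrable_mul' hres hri g v)]
    refine integral_congr_ae ?_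
    filter_upwards [AEEqFun.coeFn_add u.1 v.1] with x hx
    rw [Submodule.coe_add, hx, Pi.add_apply, mul_add]
  rw [key, key, h f, h' f]

theorem IsAssociateImage.smul {ψ w : ρ.associate.space} (h : IsAssociateImage T ψ w) (c : ℂ) :
    IsAssociateImage T (c • ψ) (c • w) := by
  intro f
  have key : ∀ (g : ρ.space) (u : ρ.associate.space), ∫ x, g.1 x * (c • u).1 x ∂μ =
      c * ∫ x, g.1 x * u.1 x ∂μ := fun g u => by
    rw [← integral_const_mul]
    refine integral_congr_ae ?_
    filter_upwards [AEEqFun.coeFn_smul c u.1] with x hx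
    rw [Submodule.coe_smul, hx, Pi.smul_apply, smul_eq_mul]
    ring
  rw [key, key, h f]

include hres hri in
theorem IsAssociateImage.sub {ψ ψ' w w' : ρ.associate.space} (h : IsAssociateImage T ψ w)
    (h' : IsAssociateImage T ψ' w') : IsAssociateImage T (ψ - ψ') (w - w') := by
  have h1 := h.add hres hri (h'.smul (-1))
  rwa [neg_one_smul, neg_one_smul, ← sub_eq_add_neg, ← sub_eq_add_neg] at h1

theorem IsAssociateImage.unique
    (hTp : ∀ f ψ, ρ.pairingSeminorm hres hri ψ (T f) ≤ C * ρ.pairingSeminorm hres hri ψ f)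
    {ψ w w' : ρ.associate.space} (h : IsAssociateImage T ψ w) (h' : IsAssociateImage T ψ w') :
    w = w' := by
  have h1 := (h.sub hres hri h').norm_le hres hri hTp
  rw [sub_self, norm_zero, mul_zero] at h1
  exact sub_eq_zero.1 (norm_le_zero_iff.1 h1)

theorem exists_isAssociateImage_of_isBoundedIntegrable (hACR : ρ.HasACR)
    (hACR' : ρ.associate.HasACR)
    (hTp : ∀ f ψ, ρ.pairingSeminorm hres hri ψ (T f) ≤ C * ρ.pairingSeminorm hres hri ψ f)
    {P : Lp ℂ 2 μ →L[ℂ] Lp ℂ 2 μ}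
    (hTP : ∀ (f : ρ.space) (hf : IsBoundedIntegrable f.1),
      (T f).1 = (P ⟨f.1, hf.mem_Lp_two⟩ : α →ₘ[μ] ℂ))
    {ψ : ρ.associate.space} (hψ : IsBoundedIntegrable ψ.1) : ∃ w, IsAssociateImage T ψ w := by
  set Ψ : Lp ℂ 2 μ := ⟨ψ.1, hψ.mem_Lp_two⟩ with hΨ
  -- The pairing is bilinear while the inner product is conjugate-linear in one slot, hence the
  -- conjugations before and after the Hilbert adjoint.
  set v : Lp ℂ 2 μ := ContinuousLinearMap.adjoint P (star Ψ) with hv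
  set w : Lp ℂ 2 μ := star v with hw
  have hbdd : ∀ f : ρ.space, IsBoundedIntegrable f.1 →
      ∫ x, (T f).1 x * ψ.1 x ∂μ = ∫ x, f.1 x * w.1 x ∂μ := fun f hf => by
    have h1 := ContinuousLinearMap.adjoint_inner_left P ⟨f.1, hf.mem_Lp_two⟩ (star Ψ)
    rw [L2.inner_def, L2.inner_def] at h1
    calc ∫ x, (T f).1 x * ψ.1 x ∂μ
        = ∫ x, inner ℂ ((star Ψ : Lp ℂ 2 μ) x) ((P ⟨f.1, hf.mem_Lp_two⟩ : Lp ℂ 2 μ) x) ∂μ := by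
          refine integral_congr_ae ?_
          filter_upwards [Lp.coeFn_star Ψ] with x hx
          rw [hx, hTP f hf, RCLike.inner_apply]
          simp [hΨ]
      _ = ∫ x, f.1 x * w.1 x ∂μ := by
          rw [← h1]
          refine integral_congr_ae ?_
          filter_upwards [Lp.coeFn_star v] with x hx
          rw [hw, hx, RCLike.inner_apply]
          simp [hv]
  have hwX : ρ.associate.eval w.1 ≤ C * ρ.associate.eval ψ.1 := by
    refine ρ.associateFun_le fun g hg hg' => ?_
    rw [lintegral_mul_eq_iSup_truncate (aemeasurable_enorm w.1) hg]
    refine iSup_le fun k => ?_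
    have htr := aemeasurable_truncate hg k
    have htrle : ρ.toFun (truncate μ g k) ≤ ρ.toFun g :=
      ρ.mono' _ _ htr hg (.of_forall fun x => truncate_le g k x)
    obtain ⟨G, hG⟩ := ρ.exists_enorm_eq htr (htrle.trans_lt hg')
    have hGb : IsBoundedIntegrable G.1 := by
      refine ⟨k, ?_, ?_⟩
      · filter_upwards [hG] with x hx
        rw [hx]
        simpa using truncate_le_nat g k x
      · rw [lintegral_congr_ae hG]
        calc ∫⁻ x, truncate μ g k x ∂μ
            ≤ ∫⁻ x, (spanningSets μ k).indicator (fun _ => (k : ℝ≥0∞)) x ∂μ := by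
              refine lintegral_mono fun x => Set.indicator_le_indicator ?_
              exact min_le_right _ _
          _ = k * μ (spanningSets μ k) := lintegral_indicator_const
            (measurableSet_spanningSets μ k) _
          _ < ∞ := ENNReal.mul_lt_top (by simp) (measure_spanningSets_lt_top μ k)
    have hint : Integrable (fun x => G.1 x * w.1 x) μ :=
      (Lp.memLp (⟨G.1, hGb.mem_Lp_two⟩ : Lp ℂ 2 μ)).integrable_mul (Lp.memLp w)
    calc ∫⁻ x, ‖w.1 x‖ₑ * truncate μ g k x ∂μ = ∫⁻ x, ‖w.1 x‖ₑ * ‖G.1 x‖ₑ ∂μ := by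
          refine lintegral_congr_ae ?_
          filter_upwards [hG] with x hx
          rw [← hx]
      _ ≤ C * (ρ.associate.eval ψ.1 * ρ.eval G.1) := by
          refine (lintegral_enorm_mul_le_pairing hres hri hTp (ψ := ψ) hint
            fun f hf => hbdd f (hGb.mono hf)).trans ?_
          gcongr
          exact rearrangementPairing_le hres ρ hri ψ G
      _ ≤ C * ρ.associate.eval ψ.1 * ρ.toFun g := by
          rw [mul_assoc]
          gcongr
          rw [eval, ρ.toFun_congr (aemeasurable_enorm G.1) hG]
          exact htrle
  set W : ρ.associate.space := ⟨w.1, hwX.trans_lt (ENNReal.mul_lt_top (by simp) ψ.2)⟩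
  refine ⟨W, fun f => ?_⟩
  -- The identity is known for bounded integrable functions; both sides are `ξ`-continuous in `f`.
  obtain ⟨u, hu, -, huf, -⟩ := exists_approximation hres hri hACR hACR' f
  have h1 := ρ.tendsto_integral_of_tendsto_pairingSeminorm hres hri W (huf W)
  have h2 := ρ.tendsto_integral_of_tendsto_pairingSeminorm hres hri ψ (u := fun k => T (u k))
    (f := T f) (by
      have h3 := (huf ψ).const_mul (C : ℝ)
      rw [mul_zero] at h3
      refine squeeze_zero (fun _ => apply_nonneg _ _) (fun k => ?_) h3
      rw [← map_sub]
      exact hTp _ ψ)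
  simp only [mul_comm (ψ.1 _)] at h2
  simp only [mul_comm (W.1 _)] at h1
  refine tendsto_nhds_unique h2 (h1.congr fun k => ?_)
  exact (hbdd (u k) (hu k)).symm

/-- Approximating `ψ` in `X'` needs (ACR) for `X'` and for `X'' = X`. The images of the approximants
are norm-bounded and `ξ`-Cauchy in `X'`, hence converge, and testing against elements of `X''`
passes the identity to the limit. -/
theorem exists_isAssociateImage (hACR : ρ.HasACR) (hACR' : ρ.associate.HasACR)
    (hTp : ∀ f ψ, ρ.pairingSeminorm hres hri ψ (T f) ≤ C * ρ.pairingSeminorm hres hri ψ f)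
    {P : Lp ℂ 2 μ →L[ℂ] Lp ℂ 2 μ}
    (hTP : ∀ (f : ρ.space) (hf : IsBoundedIntegrable f.1),
      (T f).1 = (P ⟨f.1, hf.mem_Lp_two⟩ : α →ₘ[μ] ℂ))
    (ψ : ρ.associate.space) : ∃ w, IsAssociateImage T ψ w := by
  have hri' := hri.associate hres
  obtain ⟨u, hu, hule, hulim, -⟩ :=
    exists_approximation hres hri' hACR' hACR.associate_associate ψ
  choose w hw using fun k =>
    exists_isAssociateImage_of_isBoundedIntegrable hres hri hACR hACR' hTp hTP (hu k)
  obtain ⟨g, -, hg, -⟩ := ρ.associate.exists_tendsto_of_cauchy_pairingSeminorm hres hri'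
    (u := w) (B := C * ‖ψ‖) (fun k => ((hw k).norm_le hres hri hTp).trans (by
      gcongr
      exact ρ.associate.norm_le_of_ae_le (hule k))) (fun F ε hε => by
    have h1 := (hulim F).const_mul (C : ℝ)
    rw [mul_zero] at h1
    obtain ⟨N₀, hN₀⟩ := eventually_atTop.1
      (h1.eventually (gt_mem_nhds (show (0 : ℝ) < ε / 2 by positivity)))
    filter_upwards [eventually_ge_atTop N₀] with N hN n hn m hm
    refine (((hw n).sub hres hri (hw m)).pairingSeminorm_le hres hri hTp F).trans ?_
    have h2 : u n - u m = (u n - ψ) + -(u m - ψ) := by abel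
    have h3 := map_add_le_add (ρ.associate.pairingSeminorm hres hri' F) (u n - ψ) (-(u m - ψ))
    rw [map_neg_eq_map, ← h2] at h3
    have h4 := hN₀ n (hN.trans hn)
    have h5 := hN₀ m (hN.trans hm)
    have h6 := mul_le_mul_of_nonneg_left h3 (NNReal.coe_nonneg C)
    rw [mul_add] at h6
    change C * ρ.associate.pairingSeminorm hres hri' F (u n - u m) ≤ ε
    linarith)
  refine ⟨g, fun f => ?_⟩
  have hmem : ∀ f : ρ.space, f.1 ∈ ρ.associate.associate.space := fun f => by
    have h2 := ρ.toFun_eq_associateFun_associate (aemeasurable_enorm f.1)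
    exact h2.le.trans_lt f.2
  have h1 := ρ.associate.tendsto_integral_of_tendsto_pairingSeminorm hres hri' ⟨_, hmem f⟩
    (hg ⟨_, hmem f⟩)
  have h2 := ρ.associate.tendsto_integral_of_tendsto_pairingSeminorm hres hri' ⟨_, hmem (T f)⟩
    (hulim ⟨_, hmem (T f)⟩)
  refine tendsto_nhds_unique h2 (h1.congr fun k => ?_)
  exact (hw k f).symm

theorem exists_areAssociate (hACR : ρ.HasACR) (hACR' : ρ.associate.HasACR)
    (hTp : ∀ f ψ, ρ.pairingSeminorm hres hri ψ (T f) ≤ C * ρ.pairingSeminorm hres hri ψ f)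
    {P : Lp ℂ 2 μ →L[ℂ] Lp ℂ 2 μ}
    (hTP : ∀ (f : ρ.space) (hf : IsBoundedIntegrable f.1),
      (T f).1 = (P ⟨f.1, hf.mem_Lp_two⟩ : α →ₘ[μ] ℂ)) :
    ∃ T' : ρ.associate.space →L[ℂ] ρ.associate.space, ρ.AreAssociate T T' := by
  choose W hW using exists_isAssociateImage hres hri hACR hACR' hTp hTP
  let T' : ρ.associate.space →ₗ[ℂ] ρ.associate.space :=
    { toFun := W
      map_add' := fun ψ ψ' => (hW _).unique hres hri hTp ((hW ψ).add hres hri (hW ψ'))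
      map_smul' := fun c ψ => (hW _).unique hres hri hTp ((hW ψ).smul c) }
  exact ⟨T'.mkContinuous C fun ψ => (hW ψ).norm_le hres hri hTp, fun f ψ => hW ψ f⟩

end Associate

/-- The mean ergodic theorem for the composition operator of a power-measure-bounded map. -/
theorem exists_mean_ergodic (hres : IsResonant μ) {ρ : BanachFunctionNorm μ}
    (hri : ρ.IsRearrangementInvariant) (hACR : ρ.HasACR) (hACR' : ρ.associate.HasACR) {φ : α → α}
    (hφ : Measurable φ) (hpow : PowerMeasureBounded μ φ) :
    ∃ S T : ρ.space →L[ℂ] ρ.space, ∃ C : ℝ≥0,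
      (∀ f, (S f).1 = compositionOperator (hpow.quasiMeasurePreserving hφ) f.1) ∧
      (∀ f ψ, Tendsto (fun n => ρ.pairingSeminorm hres hri ψ (ρ.cesaro S n f - T f)) atTop (𝓝 0)) ∧
      (∀ f ψ, ρ.pairingSeminorm hres hri ψ (T f) ≤ C * ρ.pairingSeminorm hres hri ψ f) ∧
      (∀ f, ρ.HasACNorm f → Tendsto (fun n => ρ.cesaro S n f) atTop (𝓝 (T f))) ∧
      ρ.IsPositiveOp T ∧
      (∃ T' : ρ.associate.space →L[ℂ] ρ.associate.space, ρ.AreAssociate T T') ∧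
      LinearMap.IsProj (LinearMap.ker (1 - S : ρ.space →L[ℂ] ρ.space).toLinearMap)
        T.toLinearMap ∧
      ∀ f, T (f - S f) = 0 := by
  obtain ⟨C, hC1, hC⟩ := hpow.exists_map_iterate_le hφ
  have hq := hpow.quasiMeasurePreserving hφ
  obtain ⟨S, hS, hSn, hSp⟩ := ρ.exists_compositionOperator hres hri hC1 hC hφ hq
  obtain ⟨P, hP⟩ := exists_tendsto_compositionCesaro_L2 hC hφ hq
  have hlim := exists_limit_of_isBoundedIntegrable hres hri hACR' hC hφ hq hS hP
  obtain ⟨T, hT, hTn, hTp, hTae, hTAC⟩ := exists_cesaro_limit hres hri hACR hACR' hSn hSp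
    fun f hf => (hlim f hf).imp fun _ h => h.2
  have hTP : ∀ (f : ρ.space) (hf : IsBoundedIntegrable f.1),
      (T f).1 = (P ⟨f.1, hf.mem_Lp_two⟩ : α →ₘ[μ] ℂ) := fun f hf => by
    obtain ⟨g, hgP, hg, -⟩ := hlim f hf
    rw [← hgP, ρ.eq_of_tendsto_pairingSeminorm hres hri (hT f) hg]
  have hzero : ∀ f, T (f - S f) = 0 := fun f =>
    ρ.eq_of_tendsto_pairingSeminorm hres hri (hT (f - S f)) fun ψ => by
      have h1 := (tendsto_iff_norm_sub_tendsto_zero.1 (tendsto_cesaro_sub_apply hSn f)).const_mul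
        ‖ψ‖
      rw [mul_zero] at h1
      exact squeeze_zero (fun _ => apply_nonneg _ _)
        (fun n => ρ.pairingSeminorm_le hres hri ψ _) h1
  -- `S` commutes with the means and is bounded in every pairing seminorm, so the means of `S f`
  -- converge both to `S (T f)` and to `T (S f) = T f`.
  have hfix : ∀ f, S (T f) = T f := fun f => by
    have h1 : T (S f) = T f := by
      have h2 := hzero f
      rw [map_sub, sub_eq_zero] at h2
      exact h2.symm
    rw [← h1]
    refine ρ.eq_of_tendsto_pairingSeminorm hres hri (u := fun n => ρ.cesaro S n (S f)) (fun ψ => ?_)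
      (hT (S f))
    have h3 := (hT f ψ).const_mul (C : ℝ)
    rw [mul_zero] at h3
    refine squeeze_zero (fun _ => apply_nonneg _ _) (fun n => ?_) h3
    have h4 : ρ.cesaro S n (S f) - S (T (S f)) = (S ^ 1) (ρ.cesaro S n f - T f) := by
      rw [h1, pow_one, map_sub]
      congr 1
      simp only [cesaro, map_smul, map_sum]
      congr 1
      refine Finset.sum_congr rfl fun i _ => ?_
      rw [← mul_apply_eq_comp, ← mul_apply_eq_comp, ← pow_succ, ← pow_succ']
    rw [h4]
    exact hSp ψ 1 _
  refine ⟨S, T, C, fun f => by simpa using hS 1 f, hT, hTp, hTAC,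
    isPositiveOp_of_ae_tendsto_cesaro hC hφ hq hS hTae,
    exists_areAssociate hres hri hACR hACR' hTp hTP, ⟨fun f => ?_, fun f hf => ?_⟩, hzero⟩
  · rw [LinearMap.mem_ker]
    exact sub_eq_zero.2 (hfix f).symm
  · have hf' : S f = f := (sub_eq_zero.1 (LinearMap.mem_ker.1 hf)).symm
    refine ρ.eq_of_tendsto_pairingSeminorm hres hri (hT f) fun ψ => ?_
    refine tendsto_const_nhds.congr' ?_
    filter_upwards [eventually_ne_atTop 0] with n hn
    rw [cesaro, cesaro_of_fixed S hf' hn, sub_self, map_zero]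

end BanachFunctionNorm
end

/-! ### Kernel of the limit operator and closure of the range. -/

namespace BanachFunctionNorm

variable {α : Type*} [MeasurableSpace α] {μ : Measure α} {ρ : BanachFunctionNorm μ}
  {S T : ρ.space →L[ℂ] ρ.space}

theorem sub_cesaro_mem_range (f : ρ.space) :
    ∀ᶠ n in atTop, f - ρ.cesaro S n f ∈ LinearMap.range (1 - S : ρ.space →L[ℂ]
      ρ.space).toLinearMap :=
  (eventually_ne_atTop 0).mono fun _ hn => cesaro_mem_range S f hn

theorem range_one_sub_le_ker (hzero : ∀ f, T (f - S f) = 0) :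
    LinearMap.range (1 - S : ρ.space →L[ℂ] ρ.space).toLinearMap ≤ LinearMap.ker T.toLinearMap := by
  rintro _ ⟨f, rfl⟩
  exact hzero f

theorem topologicalClosure_range_le_ker (hzero : ∀ f, T (f - S f) = 0) :
    (LinearMap.range (1 - S : ρ.space →L[ℂ] ρ.space).toLinearMap).topologicalClosure ≤
      LinearMap.ker T.toLinearMap :=
  Submodule.topologicalClosure_minimal _ (range_one_sub_le_ker hzero) T.isClosed_ker

theorem topologicalClosure_range_eq_ker (hzero : ∀ f, T (f - S f) = 0)
    (hT : ∀ f, Tendsto (fun n => ρ.cesaro S n f) atTop (𝓝 (T f))) :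
    (LinearMap.range (1 - S : ρ.space →L[ℂ] ρ.space).toLinearMap).topologicalClosure =
      LinearMap.ker T.toLinearMap := by
  refine (topologicalClosure_range_le_ker hzero).antisymm fun f hf => ?_
  have hf' : T f = 0 := hf
  have h := (hT f).const_sub f
  rw [hf', sub_zero] at h
  exact mem_closure_of_tendsto h (sub_cesaro_mem_range f)

/-- If `T f = 0`, then `f` minus its means lies in the range and tends to `f` in `ξ`. Conversely the
kernel is `ξ`-closed, being the preimage of a point under a `ξ`-continuous map into a Hausdorff
space. -/
theorem ker_eq_closure_xi_range [SigmaFinite μ] (hres : IsResonant μ)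
    (hri : ρ.IsRearrangementInvariant) (hzero : ∀ f, T (f - S f) = 0)
    (hTc : Continuous[ρ.xi, ρ.xi] T)
    (hT : ∀ f ψ, Tendsto (fun n => ρ.pairingSeminorm hres hri ψ (ρ.cesaro S n f - T f))
      atTop (𝓝 0)) :
    (LinearMap.ker T.toLinearMap : Set ρ.space) =
      closure[ρ.xi] (Set.range (1 - S : ρ.space →L[ℂ] ρ.space)) := by
  obtain ⟨-, -, -, hT2⟩ := ρ.xi_properties hres hri
  refine Set.Subset.antisymm (fun f hf => ?_) ?_
  · have hf' : T f = 0 := hf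
    have h : Tendsto (fun n => f - ρ.cesaro S n f) atTop (@nhds _ ρ.xi f) := by
      refine (ρ.tendsto_xi_iff hres hri _ f).2 fun ψ => ?_
      refine (hT f ψ).congr fun n => ?_
      rw [hf', sub_zero, sub_sub_cancel_left, map_neg_eq_map]
    exact @mem_closure_of_tendsto _ ρ.xi _ _ _ _ _ _ h (sub_cesaro_mem_range f)
  · have hclosed : @IsClosed _ ρ.xi (T ⁻¹' {0}) :=
      @IsClosed.preimage _ _ ρ.xi ρ.xi _ hTc _
        (@isClosed_singleton _ ρ.xi (@T2Space.t1Space _ ρ.xi hT2) 0)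
    exact @closure_minimal _ ρ.xi _ _ (by rintro _ ⟨f, rfl⟩; exact hzero f) hclosed

end BanachFunctionNorm

theorem theorem1p1 {α : Type*} [MeasurableSpace α] (μ : Measure α) [SigmaFinite μ]
    (hres : IsResonant μ) (ρ : BanachFunctionNorm μ) (hri : ρ.IsRearrangementInvariant)
    (hACR' : ρ.associate.HasACR) (φ : α → α) (hφ : Measurable φ)
    (hpow : PowerMeasureBounded μ φ) :
    -- `X` has absolutely continuous norm
    (ρ.SpaceHasACNorm →
      ∃ S : ρ.space →L[ℂ] ρ.space,
        (∀ f, (S f).1 = compositionOperator (hpow.quasiMeasurePreserving hφ) f.1) ∧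
        ∃ T : ρ.space →L[ℂ] ρ.space,
          (∀ f, Tendsto (fun n : ℕ => ρ.cesaro S n f) atTop (𝓝 (T f))) ∧
          ρ.IsPositiveOp T ∧
          (∃ T' : ρ.associate.space →L[ℂ] ρ.associate.space, ρ.AreAssociate T T') ∧
          LinearMap.IsProj (LinearMap.ker (1 - S : ρ.space →L[ℂ] ρ.space).toLinearMap)
            T.toLinearMap ∧
          LinearMap.IsProj
            (LinearMap.range (1 - S : ρ.space →L[ℂ] ρ.space).toLinearMap).topologicalClosure
            (1 - T : ρ.space →L[ℂ] ρ.space).toLinearMap ∧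
          IsCompl (LinearMap.ker (1 - S : ρ.space →L[ℂ] ρ.space).toLinearMap)
            (LinearMap.range (1 - S : ρ.space →L[ℂ] ρ.space).toLinearMap).topologicalClosure) ∧
    -- `X` only has the (ACR) property
    (ρ.HasACR →
      -- `ξ` is a Hausdorff locally convex topology between the norm topology and `σ(X, X')`
      (@IsTopologicalAddGroup ρ.space ρ.xi _ ∧ @ContinuousSMul ℂ ρ.space _ _ ρ.xi ∧
        @LocallyConvexSpace ℝ ρ.space _ _ _ _ ρ.xi ∧ @T2Space ρ.space ρ.xi ∧
        (inferInstance : TopologicalSpace ρ.space) ≤ ρ.xi ∧ ρ.xi ≤ ρ.weakAssociate) ∧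
      ∃ S : ρ.space →L[ℂ] ρ.space,
        (∀ f, (S f).1 = compositionOperator (hpow.quasiMeasurePreserving hφ) f.1) ∧
        ∃ T : ρ.space →L[ℂ] ρ.space,
          Continuous[ρ.xi, ρ.xi] T ∧
          (∀ f, Tendsto (fun n : ℕ => ρ.cesaro S n f) atTop (@nhds _ ρ.xi (T f))) ∧
          (∀ f, ρ.HasACNorm f → Tendsto (fun n : ℕ => ρ.cesaro S n f) atTop (𝓝 (T f))) ∧
          ρ.IsPositiveOp T ∧
          (∃ T' : ρ.associate.space →L[ℂ] ρ.associate.space, ρ.AreAssociate T T') ∧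
          LinearMap.IsProj (LinearMap.ker (1 - S : ρ.space →L[ℂ] ρ.space).toLinearMap)
            T.toLinearMap ∧
          ∃ M : Submodule ℂ ρ.space,
            (M : Set ρ.space) = closure[ρ.xi] (Set.range (1 - S : ρ.space →L[ℂ] ρ.space)) ∧
            (LinearMap.range (1 - S : ρ.space →L[ℂ] ρ.space).toLinearMap).topologicalClosure ≤ M ∧
            LinearMap.IsProj M (1 - T : ρ.space →L[ℂ] ρ.space).toLinearMap ∧
            IsCompl (LinearMap.ker (1 - S : ρ.space →L[ℂ] ρ.space).toLinearMap) M) := by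
  constructor
  · intro hAC
    obtain ⟨S, T, -, hS, -, -, hT, hpos, hassoc, hproj, hzero⟩ :=
      BanachFunctionNorm.exists_mean_ergodic hres hri (BanachFunctionNorm.SpaceHasACNorm.hasACR
        hri hAC) hACR' hφ hpow
    have hT' := fun f => hT f (hAC f)
    have hker := BanachFunctionNorm.topologicalClosure_range_eq_ker hzero hT'
    exact ⟨S, hS, T, hT', hpos, hassoc, hproj, hker ▸ BanachFunctionNorm.isProj_ker_one_sub hproj,
      hker ▸ hproj.isCompl⟩
  · intro hACR
    obtain ⟨h1, h2, h3, h4⟩ := ρ.xi_properties hres hri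
    refine ⟨⟨h1, h2, h3, h4, ρ.topology_le_xi hres hri, ρ.xi_le_weakAssociate hres hri⟩, ?_⟩
    obtain ⟨S, T, C, hS, hTxi, hTp, hT, hpos, hassoc, hproj, hzero⟩ :=
      BanachFunctionNorm.exists_mean_ergodic hres hri hACR hACR' hφ hpow
    have hTc : Continuous[ρ.xi, ρ.xi] T :=
      ρ.continuous_xi_of_pairingSeminorm_le hres hri T.toLinearMap fun ψ f => hTp f ψ
    -- Taking `ker T` for the subspace `M` makes linearity of the `ξ`-closure automatic.
    exact ⟨S, hS, T, hTc, fun f => (ρ.tendsto_xi_iff hres hri _ _).2 (hTxi f), hT, hpos, hassoc,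
      hproj, LinearMap.ker T.toLinearMap, BanachFunctionNorm.ker_eq_closure_xi_range hres hri
        hzero hTc hTxi,
      BanachFunctionNorm.topologicalClosure_range_le_ker hzero,
        BanachFunctionNorm.isProj_ker_one_sub hproj, hproj.isCompl⟩
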